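/- Let $p,q\ge 1$ and $0\le r_b<q$ be integers and let $A\in\mathbb C^{p\times p}$, $B\in\mathbb C^{q\times q}$ be Hermitian positive semidefinite. Let $s_B^{(1)}\ge\dots\ge s_B^{(q)}\ge 0$ be the eigenvalues of $B$, and suppose that $s_B^{(r_b)}>s_B^{(r_b+1)}$ (no condition if $r_b=0$); this holds in particular if $r_b=\operatorname{rank}B<q$. *Data.* For $k=0,1,2,\dots$ let $\mathbf n_k=\tau_k\mathbf c_k+\sigma \mathbf v_k\in\mathbb C^{pq}$, $\sigma>0$, be independent clutter-plus-noise vectors, where $\tau_k$ (texture), $\mathbf c_k$ (speckle), $\mathbf v_k$ are independent, the $\tau_k>0$ are identically distributed with an arbitrary law such that $E[\tau^2]<\infty$, and $\mathbf c_k$ and $\mathbf v_k$ are zero-mean circular complex Gaussian with covariances $A\otimes B$ and $I$ (so the noise has covariance $\sigma^2I$). The vector $\mathbf n_0$ is the disturbance in the bin under test and $\mathbf n_1,\dots,\mathbf n_n$ are the training data, with sample covariance $S=\frac1n\sum_{k=1}^n\mathbf n_k\mathbf n_k^H$ and $q\times q$ blocks $S(i,j)$, $1\le i,j\le p$. *Spatial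 filter and target.* Fix $\tilde h\in\mathbb C^p$ with $\|\tilde h\|_2=1$ and $\tilde h^HA\tilde h\ne0$, and put $F_A=I-\tilde h\tilde h^H$, so that the spatial filter $F_A\otimes I$ is fixed. Let the target return be $\alpha \mathbf d$ with amplitude $\alpha\neq0$ and steering vector $\mathbf d=d_A\otimes d_B$, where $d_A$ is fixed with $F_Ad_A\ne0$, and $d_B\ne0$ is arbitrary in the orthogonal complement of the temporal clutter subspace $\operatorname{range}B$. Put $$\tilde d_A=\frac{F_Ad_A}{\|F_Ad_A\|_2},\qquad \kappa=\frac{\tilde d_A^HA\tilde d_A}{\tilde h^HA\tilde h}.$$ *Temporal stage.* Let the columns of $\hat U_B\in\mathbb C^{q\times r_b}$ be the first $r_b$ principal components (orthonormal eigenvectors for the largest eigenvalues, chosen measurably) of $R_B=\sum_{i,j}\overline{a_{ij}}\,S(i,j)/\|\hat A\|_F^2$, where $\hat A=(a_{ij})=\tilde h\tilde h^H$, and let $\hat F_B=I-\hat U_B\hat U_B^H$. For a filter vector $\mathbf w$ let $\mathrm{SINR}(\mathbf w)=|\alpha|^2|\mathbf w^H\mathbf d|^2/E|\mathbf w^H\mathbf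 n_0|^2$, the expectation being over $\mathbf n_0$ with $\mathbf w$ held fixed, and define the SINR loss given $\tilde h$ by $$\rho_t\,|\,\tilde h=\frac{\mathrm{SINR}\big((F_A\otimes\hat F_B)\mathbf d\big)}{\sup_{G\in\mathbb C^{q\times q}}\mathrm{SINR}\big((F_A\otimes G)\mathbf d\big)} .$$ *Conclusion.* (a) If $\kappa\ne0$, then for every $\sigma>0$, as $n\to\infty$, $$E[\rho_t\,|\,\tilde h]=1-\frac{\kappa}{n}\sum_{i=1}^{r_b}\frac{\Big(E[\tau^2]s_B^{(i)}+\frac{\sigma^2}{\tilde h^HA\tilde h}\Big)\Big(E[\tau^2]s_B^{(i)}+\frac{\sigma^2}{\kappa\,\tilde h^HA\tilde h}\Big)}{\big(E[\tau^2]s_B^{(i)}\big)^2}+o\!\left(\frac1n\right).$$ (b) In the small $\sigma^2$ regime $E[\rho_t\,|\,\tilde h]\approx1-\kappa r_b/n$: for every $\varepsilon>0$ there is $\sigma_0>0$ such that for every $0<\sigma<\sigma_0$ and all sufficiently large $n$ one has $\big|E[\rho_t\,|\,\tilde h]-(1-\kappa r_b/n)\big|\le\varepsilon/n$. -/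

import Mathlib

open MeasureTheory ProbabilityTheory Matrix Filter Topology Asymptotics
open scoped Kronecker ComplexOrder

namespace KronSTAP

noncomputable section

/-- `z` is a zero-mean circularly symmetric complex Gaussian vector with covariance
`E[z zᴴ] = Γ`: for every `w`, the real part of `wᴴ z` is `N(0, wᴴ Γ w / 2)`
(the imaginary parts are the real parts for `i w`). -/
def IsComplexGaussian {Ω ι : Type*} [MeasurableSpace Ω] [Fintype ι] (μ : Measure Ω)
    (z : Ω → ι → ℂ) (Γ : Matrix ι ι ℂ) : Prop :=
  AEMeasurable z μ ∧
    ∀ w : ι → ℂ, μ.map (fun ω => (star w ⬝ᵥ z ω).re) =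
      gaussianReal 0 (Real.toNNReal ((star w ⬝ᵥ (Γ *ᵥ w)).re / 2))

/-- The SIRV data model: i.i.d. range bins indexed by `k`, with textures `τ k`, speckles `c k`
and normalized sensor noises `v k`, mutually independent. The texture is a positive random
variable with an arbitrary distribution (of finite second moment), the speckle is complex
Gaussian with covariance `Γ`, the noise is complex Gaussian with identity covariance. -/
structure IsSIRVModel {Ω ι : Type*} [MeasurableSpace Ω] [Fintype ι] [DecidableEq ι]
    (μ : Measure Ω) (Γ : Matrix ι ι ℂ) (τ : ℕ → Ω → ℝ) (c v : ℕ → Ω → ι → ℂ) : Prop where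
  texture_pos : ∀ k, ∀ᵐ ω ∂μ, 0 < τ k ω
  texture_memLp : ∀ k, MemLp (τ k) 2 μ
  texture_identDistrib : ∀ k, IdentDistrib (τ k) (τ 0) μ μ
  speckle_gaussian : ∀ k, IsComplexGaussian μ (c k) Γ
  noise_gaussian : ∀ k, IsComplexGaussian μ (v k) 1
  texture_indep : ∀ k, IndepFun (τ k) (fun ω => (c k ω, v k ω)) μ
  speckle_indep_noise : ∀ k, IndepFun (c k) (v k) μ
  bins_indep : iIndepFun (fun k ω => (τ k ω, c k ω, v k ω)) μ

/-- Clutter plus noise `τ c + σ v` of the `k`-th range bin; the noise has covariance `σ² I`. -/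
def interference {Ω ι : Type*} (τ : ℕ → Ω → ℝ) (c v : ℕ → Ω → ι → ℂ) (σ : ℝ) (k : ℕ)
    (ω : Ω) : ι → ℂ :=
  fun i => (τ k ω : ℂ) * c k ω i + (σ : ℂ) * v k ω i

/-- Output signal-to-interference-plus-noise ratio of the (fixed) filter vector `w`, for a target
of amplitude `α` and steering vector `d`, in clutter plus noise `x`:
`|α|² |wᴴ d|² / E |wᴴ x|²`. -/
def sinr {Ω ι : Type*} [MeasurableSpace Ω] [Fintype ι] (μ : Measure Ω) (x : Ω → ι → ℂ)
    (α : ℂ) (d w : ι → ℂ) : ℝ :=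
  ‖α‖ ^ 2 * ‖star w ⬝ᵥ d‖ ^ 2 / ∫ ω, ‖star w ⬝ᵥ x ω‖ ^ 2 ∂μ

/-- The Kronecker product `a ⊗ b` of two vectors. -/
def kronVec {ι κ : Type*} (a : ι → ℂ) (b : κ → ℂ) : ι × κ → ℂ :=
  fun i => a i.1 * b i.2

/-- The spatial projection `I - h hᴴ`. -/
def spatialProj {p : ℕ} (h : Fin p → ℂ) : Matrix (Fin p) (Fin p) ℂ :=
  1 - vecMulVec h (star h)

/-- The temporal projection `I - U Uᴴ`. -/
def temporalProj {q r : ℕ} (U : Matrix (Fin q) (Fin r) ℂ) : Matrix (Fin q) (Fin q) ℂ :=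
  1 - U * Uᴴ

/-- The sample covariance `(1/n) ∑ x_k x_kᴴ` of the `n` vectors `x 1, …, x n`. -/
def sampleCov {ι : Type*} (x : ℕ → ι → ℂ) (n : ℕ) : Matrix ι ι ℂ :=
  (n : ℂ)⁻¹ • ∑ k ∈ Finset.Icc 1 n, vecMulVec (x k) (star (x k))

/-- The `q × q` block `S(i, j)` of a `pq × pq` matrix. -/
def block {p q : ℕ} (S : Matrix (Fin p × Fin q) (Fin p × Fin q) ℂ) (i j : Fin p) :
    Matrix (Fin q) (Fin q) ℂ :=
  fun k l => S (i, k) (j, l)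

/-- The least-squares temporal factor for a given spatial factor `A`:
`R_B = ∑ conj(a_ij) S(i, j) / ‖A‖_F²`. -/
def temporalFactor {p q : ℕ} (A : Matrix (Fin p) (Fin p) ℂ)
    (S : Matrix (Fin p × Fin q) (Fin p × Fin q) ℂ) : Matrix (Fin q) (Fin q) ℂ :=
  (((∑ i, ∑ j, ‖A i j‖ ^ 2 : ℝ) : ℂ))⁻¹ • ∑ i, ∑ j, star (A i j) • block S i j

/-- `M = V diag(s) Vᴴ` with `V` unitary and the real eigenvalues `s` in decreasing order. -/
def IsEigendecomposition {q : ℕ} (M V : Matrix (Fin q) (Fin q) ℂ) (s : Fin q → ℝ) : Prop :=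
  V ∈ unitaryGroup (Fin q) ℂ ∧ Antitone s ∧ M = V * diagonal (fun i => (s i : ℂ)) * Vᴴ

/-- The columns of `U` are `r` leading principal components of `M`: the first `r` eigenvectors in
some eigendecomposition of `M`. -/
def IsPrincipalComponents {q r : ℕ} (hr : r ≤ q) (M : Matrix (Fin q) (Fin q) ℂ)
    (U : Matrix (Fin q) (Fin r) ℂ) : Prop :=
  ∃ (V : Matrix (Fin q) (Fin q) ℂ) (s : Fin q → ℝ), IsEigendecomposition M V s ∧
    ∀ i j, U i j = V i (Fin.castLE hr j)

/-- The maximal SINR over all temporal filters `G` when the spatial filter `(I - h hᴴ) ⊗ I` is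
fixed, i.e. over all filter vectors `((I - h hᴴ) ⊗ G) d`. -/
def sinrMax {Ω : Type*} [MeasurableSpace Ω] {p q : ℕ} (μ : Measure Ω)
    (x : Ω → Fin p × Fin q → ℂ) (α : ℂ) (h : Fin p → ℂ) (d : Fin p × Fin q → ℂ) : ℝ :=
  ⨆ G : Matrix (Fin q) (Fin q) ℂ, sinr μ x α d ((spatialProj h ⊗ₖ G) *ᵥ d)

/-- The SINR loss of the temporal stage: the SINR of the filter `(I - h hᴴ) ⊗ (I - U Uᴴ)` relative
to the maximal SINR for the given spatial filter. -/
def sinrLoss {Ω : Type*} [MeasurableSpace Ω] {p q r : ℕ} (μ : Measure Ω)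
    (x : Ω → Fin p × Fin q → ℂ) (α : ℂ) (h : Fin p → ℂ) (d : Fin p × Fin q → ℂ)
    (U : Matrix (Fin q) (Fin r) ℂ) : ℝ :=
  sinr μ x α d ((spatialProj h ⊗ₖ temporalProj U) *ᵥ d) / sinrMax μ x α h d

/-- The quadratic form `xᴴ A x` of a Hermitian matrix. -/
def quadForm {p : ℕ} (A : Matrix (Fin p) (Fin p) ℂ) (x : Fin p → ℂ) : ℝ :=
  (star x ⬝ᵥ (A *ᵥ x)).re

/-- The normalized residual spatial steering vector
`(I - h hᴴ) a / ‖(I - h hᴴ) a‖₂`. -/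
def residual {p : ℕ} (h a : Fin p → ℂ) : Fin p → ℂ :=
  ((Real.sqrt (∑ i, ‖(spatialProj h *ᵥ a) i‖ ^ 2) : ℝ) : ℂ)⁻¹ • (spatialProj h *ᵥ a)

/-- `κ = (d̃ᴴ A d̃) / (hᴴ A h)` with `d̃` the normalized residual of `a`. -/
def mismatch {p : ℕ} (A : Matrix (Fin p) (Fin p) ℂ) (h a : Fin p → ℂ) : ℝ :=
  quadForm A (residual h a) / quadForm A h

end

end KronSTAP

/-!
The expansion of the expected SINR loss is a first-order perturbation computation made uniform
in the sample.

*Reduction.* Let `e` be the normalized temporal steering vector and `x` its projection onto the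
span of the estimated principal components, both written in the eigenbasis of `B`. As `B dB = 0`,
the best temporal filter is the identity (`sinrMax_eq`), and the loss depends on the sample only
through `x`: with `t = ‖x‖²`, `Q = ∑ s i |x i|²`, `a = hᴴ A h` and `b = E[τ²] κ a` it equals
`σ² (1 - t)² / (b Q + σ² (1 - t))` (`sinrLoss_eq_leakLoss`). So `1 - ρ` is the quadratic form
`∑ (1 + b s i / σ²) |x i|²` up to higher order terms, and `0 ≤ ρ ≤ 1`. For a unit vector `h`, the
fitted temporal factor is the empirical covariance `R` of the compressed data `(hᴴ ⊗ I) n_k`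
(`temporalFactor_vecMulVec`), i.i.d. vectors whose covariance in this basis is the diagonal matrix
with entries `l i = E[τ²] a s i + σ²`. In particular `σ²` is the eigenvalue of `e`.

*Perturbation.* Testing the eigenvector equations of `R` against `e` expresses `x` through the
residual `ζ = R e - σ² e`. If `R` is close to its expectation, then `x i ≈ ζ i / (l i - σ²)` for
`i < r` and `x i ≈ 0` otherwise, with a small error relative to `‖ζ‖` (`nsq_leadProj_sub_le`). The
residual is an empirical mean of i.i.d. centered vectors; as `e` carries no clutter, these are
square integrable and `n E |ζ i|² = l i σ²` exactly for `i < r`, for any law of the texture. This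
produces the limit of `n (1 - E ρ)` (`tendsto_mul_one_sub_integral_leakLoss`).

*Exceptional events.* It has to be shown that samples with `R` far from its expectation contribute
`o(1/n)`, although the texture has no more than a second moment. There are two regimes. If the
leading eigenvalues of `R` still exceed `σ²` by a fixed amount, then `n (1 - ρ)` is at most a
constant times `n ‖ζ‖²`, and these squared normalized sums are uniformly integrable
(`tendsto_setIntegral_sum_sq`), while the event has probability `o(1)` by the weak law. The leading
eigenvalues are too small with probability `o(1/n)` only: dropping the summands with large data
decreases `R`, so that the lower tail is that of an empirical mean of bounded variables
(`exists_tendsto_mul_measure_quadForm_lt`), which a fourth-moment bound controls; there `1 - ρ ≤ 1`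
suffices.

The small-noise statement follows since the limit is a polynomial in `σ` whose value at `σ = 0`
is `κ r`.
-/

namespace KronSTAP

/-! ### Normalized sums of independent real random variables -/

section RealSums

variable {Ω : Type*} [MeasurableSpace Ω] {μ : Measure Ω}

lemma integrable_of_abs_le [IsProbabilityMeasure μ] {f : Ω → ℝ} (hf : Measurable f) (C : ℝ)
    (h : ∀ ω, |f ω| ≤ C) :
    Integrable f μ :=
  Integrable.of_bound hf.aestronglyMeasurable C (ae_of_all _ fun ω => by simpa using h ω)

lemma abs_sum_range_le {Ω : Type*} {X : ℕ → Ω → ℝ} {K : ℝ} (hK : ∀ k ω, |X k ω| ≤ K) (n : ℕ)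
    (ω : Ω) :
    |∑ k ∈ Finset.range n, X k ω| ≤ n * K := by
  refine (Finset.abs_sum_le_sum_abs _ _).trans ((Finset.sum_le_sum fun k _ => hK k ω).trans ?_)
  simp

/-- Second and fourth moments of a sum of independent centered variables bounded by `K`: in the
expansion of the fourth power of a sum, a term survives only if no variable occurs exactly once. -/
lemma integral_sum_pow_le [IsProbabilityMeasure μ] {X : ℕ → Ω → ℝ} (hX : ∀ k, Measurable (X k))
    {K : ℝ}
    (hK : ∀ k ω, |X k ω| ≤ K) (hind : iIndepFun X μ) (h0 : ∀ k, ∫ ω, X k ω ∂μ = 0) (n : ℕ) :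
    ∫ ω, (∑ k ∈ Finset.range n, X k ω) ^ 2 ∂μ ≤ n * K ^ 2 ∧
    ∫ ω, (∑ k ∈ Finset.range n, X k ω) ^ 4 ∂μ ≤ 3 * n ^ 2 * K ^ 4 := by
  induction n with
  | zero => simp
  | succ n ih =>
    set S : Ω → ℝ := fun ω => ∑ k ∈ Finset.range n, X k ω with hS
    have hSm : Measurable S := Finset.measurable_fun_sum _ fun k _ => hX k
    have hSb : ∀ ω, |S ω| ≤ n * K := fun ω => abs_sum_range_le hK n ω
    have hSX : IndepFun S (X n) μ := by
      have := hind.indepFun_finsetSum_of_notMem (s := Finset.range n) (i := n) hX (by simp)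
      convert this using 1
      ext ω; simp [hS]
    have hint : ∀ i j : ℕ, Integrable (fun ω => S ω ^ i * X n ω ^ j) μ := by
      intro i j
      refine integrable_of_abs_le (by fun_prop) ((n * K) ^ i * K ^ j) fun ω => ?_
      rw [abs_mul, abs_pow, abs_pow]
      exact mul_le_mul (pow_le_pow_left₀ (abs_nonneg _) (hSb ω) i)
        (pow_le_pow_left₀ (abs_nonneg _) (hK n ω) j) (by positivity)
        (pow_nonneg ((abs_nonneg _).trans (hSb ω)) i)
    have hprod : ∀ i j : ℕ, ∫ ω, S ω ^ i * X n ω ^ j ∂μ =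
        (∫ ω, S ω ^ i ∂μ) * ∫ ω, X n ω ^ j ∂μ := by
      intro i j
      exact hSX.integral_fun_comp_mul_comp (f := fun x : ℝ => x ^ i) (g := fun x : ℝ => x ^ j)
        hSm.aemeasurable (hX n).aemeasurable (by fun_prop) (by fun_prop)
    have hXK : ∀ j, Even j → ∫ ω, X n ω ^ j ∂μ ≤ K ^ j := by
      intro j hj
      calc ∫ ω, X n ω ^ j ∂μ ≤ ∫ _, K ^ j ∂μ := by
            refine integral_mono (by simpa using hint 0 j) (integrable_const _) fun ω => ?_
            rw [← hj.pow_abs]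
            exact pow_le_pow_left₀ (abs_nonneg _) (hK n ω) j
        _ = K ^ j := by simp
    have h1 : ∫ ω, X n ω ^ 1 ∂μ = 0 := by simpa using h0 n
    have hS0 : ∫ ω, S ω ^ 1 ∂μ = 0 := by
      simp only [pow_one, hS]
      rw [integral_finsetSum _ fun k _ => integrable_of_abs_le (hX k) K (hK k)]
      exact Finset.sum_eq_zero fun k _ => h0 k
    have e2 : ∫ ω, (∑ k ∈ Finset.range (n + 1), X k ω) ^ 2 ∂μ =
        ∫ ω, S ω ^ 2 ∂μ + ∫ ω, X n ω ^ 2 ∂μ := by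
      have : ∀ ω, (∑ k ∈ Finset.range (n + 1), X k ω) ^ 2 =
          S ω ^ 2 * X n ω ^ 0 + 2 * (S ω ^ 1 * X n ω ^ 1) + S ω ^ 0 * X n ω ^ 2 := by
        intro ω; rw [Finset.sum_range_succ]; ring
      simp_rw [this]
      rw [integral_add ((hint 2 0).fun_add ((hint 1 1).const_mul 2)) (hint 0 2),
        integral_add (hint 2 0) ((hint 1 1).const_mul 2), integral_const_mul]
      simp only [hprod, h1]
      simp
    have e4 : ∫ ω, (∑ k ∈ Finset.range (n + 1), X k ω) ^ 4 ∂μ =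
        ∫ ω, S ω ^ 4 ∂μ + 6 * ((∫ ω, S ω ^ 2 ∂μ) * ∫ ω, X n ω ^ 2 ∂μ) + ∫ ω, X n ω ^ 4 ∂μ := by
      have : ∀ ω, (∑ k ∈ Finset.range (n + 1), X k ω) ^ 4 =
          S ω ^ 4 * X n ω ^ 0 + 4 * (S ω ^ 3 * X n ω ^ 1) + 6 * (S ω ^ 2 * X n ω ^ 2) +
            4 * (S ω ^ 1 * X n ω ^ 3) + S ω ^ 0 * X n ω ^ 4 := by
        intro ω; rw [Finset.sum_range_succ]; ring
      simp_rw [this]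
      rw [integral_add (((((hint 4 0).fun_add ((hint 3 1).const_mul 4)).fun_add
          ((hint 2 2).const_mul 6))).fun_add ((hint 1 3).const_mul 4)) (hint 0 4),
        integral_add ((((hint 4 0).fun_add ((hint 3 1).const_mul 4)).fun_add
          ((hint 2 2).const_mul 6))) ((hint 1 3).const_mul 4),
        integral_add ((hint 4 0).fun_add ((hint 3 1).const_mul 4)) ((hint 2 2).const_mul 6),
        integral_add (hint 4 0) ((hint 3 1).const_mul 4),
        integral_const_mul, integral_const_mul, integral_const_mul]
      simp only [hprod, h1, hS0]
      simp
    have hX2 := hXK 2 even_two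
    have hX4 := hXK 4 (by decide)
    have hX20 : 0 ≤ ∫ ω, X n ω ^ 2 ∂μ := integral_nonneg fun ω => sq_nonneg _
    have hS20 : 0 ≤ ∫ ω, S ω ^ 2 ∂μ := integral_nonneg fun ω => sq_nonneg _
    obtain ⟨i2, i4⟩ := ih
    refine ⟨?_, ?_⟩
    · rw [e2]; push_cast; linarith
    · rw [e4]; push_cast
      have : (∫ ω, S ω ^ 2 ∂μ) * ∫ ω, X n ω ^ 2 ∂μ ≤ (n * K ^ 2) * K ^ 2 :=
        mul_le_mul i2 hX2 hX20 (by positivity)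
      have hK4 : 0 ≤ K ^ 4 := by positivity
      nlinarith

/-- A fourth-moment Markov inequality: empirical means of bounded independent centered variables
leave a fixed neighbourhood of `0` with probability `o(1/n)`. -/
lemma tendsto_mul_measure_abs_sum_ge [IsProbabilityMeasure μ] {X : ℕ → Ω → ℝ}
    (hX : ∀ k, Measurable (X k)) {K : ℝ}
    (hK : ∀ k ω, |X k ω| ≤ K) (hind : iIndepFun X μ) (h0 : ∀ k, ∫ ω, X k ω ∂μ = 0)
    {δ : ℝ} (hδ : 0 < δ) :
    Tendsto (fun n : ℕ => n * μ.real {ω | δ * n ≤ |∑ k ∈ Finset.range n, X k ω|}) atTop (𝓝 0) := by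
  have hlim : Tendsto (fun n : ℕ => (3 * K ^ 4 / δ ^ 4) * (1 / (n : ℝ))) atTop (𝓝 0) := by
    simpa using (tendsto_one_div_atTop_nhds_zero_nat (𝕜 := ℝ)).const_mul (3 * K ^ 4 / δ ^ 4)
  refine tendsto_of_tendsto_of_tendsto_of_le_of_le' tendsto_const_nhds hlim
    (Eventually.of_forall fun n => by positivity) ?_
  filter_upwards [eventually_gt_atTop 0] with n hn
  have hn' : (0 : ℝ) < n := by exact_mod_cast hn
  have hm : Measurable fun ω => (∑ k ∈ Finset.range n, X k ω) ^ 4 :=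
    (Finset.measurable_fun_sum _ fun k _ => hX k).pow_const 4
  have hint : Integrable (fun ω => (∑ k ∈ Finset.range n, X k ω) ^ 4) μ := by
    refine integrable_of_abs_le hm ((n * K) ^ 4) fun ω => ?_
    rw [abs_pow]
    exact pow_le_pow_left₀ (abs_nonneg _) (abs_sum_range_le hK n ω) 4
  have hmk := mul_meas_ge_le_integral_of_nonneg (ae_of_all μ fun ω => by positivity) hint
    ((δ * n) ^ 4)
  have hsub : μ.real {ω | δ * n ≤ |∑ k ∈ Finset.range n, X k ω|} ≤
      μ.real {ω | (δ * n) ^ 4 ≤ (∑ k ∈ Finset.range n, X k ω) ^ 4} := by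
    refine measureReal_mono fun ω hω => ?_
    simp only [Set.mem_ofPred_eq] at hω ⊢
    rw [← (show Even 4 by decide).pow_abs (∑ k ∈ Finset.range n, X k ω)]
    exact pow_le_pow_left₀ (by positivity) hω 4
  have h4 := (integral_sum_pow_le hX hK hind h0 n).2
  have hP : (δ * n) ^ 4 * μ.real {ω | δ * n ≤ |∑ k ∈ Finset.range n, X k ω|} ≤
      3 * n ^ 2 * K ^ 4 :=
    ((mul_le_mul_of_nonneg_left hsub (by positivity)).trans hmk).trans h4
  have : μ.real {ω | δ * n ≤ |∑ k ∈ Finset.range n, X k ω|} ≤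
      3 * n ^ 2 * K ^ 4 / (δ * n) ^ 4 := by
    rw [le_div_iff₀ (by positivity)]; linarith
  calc (n : ℝ) * μ.real {ω | δ * n ≤ |∑ k ∈ Finset.range n, X k ω|}
      ≤ n * (3 * n ^ 2 * K ^ 4 / (δ * n) ^ 4) := by gcongr
    _ = (3 * K ^ 4 / δ ^ 4) * (1 / (n : ℝ)) := by field_simp

/-- The variance of a sum of independent centered identically distributed variables. -/
lemma integral_sum_sq_eq [IsProbabilityMeasure μ] {X : ℕ → Ω → ℝ}
    (hid : ∀ k, IdentDistrib (X k) (X 0) μ μ)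
    (hind : iIndepFun X μ) (hL : MemLp (X 0) 2 μ) (h0 : ∫ ω, X 0 ω ∂μ = 0) (n : ℕ) :
    ∫ ω, (∑ k ∈ Finset.range n, X k ω) ^ 2 ∂μ = n * ∫ ω, X 0 ω ^ 2 ∂μ := by
  have hL' : ∀ k, MemLp (X k) 2 μ := fun k => (hid k).memLp_iff.2 hL
  have h0' : ∀ k, ∫ ω, X k ω ∂μ = 0 := fun k => (hid k).integral_eq.trans h0
  have hv := IndepFun.variance_sum (μ := μ) (X := X) (s := Finset.range n) (fun k _ => hL' k)
    fun i _ j _ hij => hind.indepFun hij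
  have hm : AEMeasurable (∑ k ∈ Finset.range n, X k) μ :=
    Finset.aemeasurable_sum _ fun k _ => (hL' k).aestronglyMeasurable.aemeasurable
  have hs0 : ∫ ω, (∑ k ∈ Finset.range n, X k) ω ∂μ = 0 := by
    simp only [Finset.sum_apply]
    rw [integral_finsetSum _ fun k _ => (hL' k).integrable one_le_two]
    exact Finset.sum_eq_zero fun k _ => h0' k
  rw [variance_of_integral_eq_zero hm hs0] at hv
  have : ∀ k, variance (X k) μ = ∫ ω, X 0 ω ^ 2 ∂μ := by
    intro k
    rw [(hid k).variance_eq,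
      variance_of_integral_eq_zero hL.aestronglyMeasurable.aemeasurable h0]
  simp only [this, Finset.sum_const, Finset.card_range, nsmul_eq_mul] at hv
  simpa using hv

/-- Truncating a square integrable variable changes it little in `L²`. -/
lemma exists_integral_indicator_sq_le {X : Ω → ℝ} (hX : Measurable X) (hL : MemLp X 2 μ)
    {ε : ℝ} (hε : 0 < ε) : ∃ K : ℝ, 0 < K ∧ ∫ ω in {ω | K < |X ω|}, X ω ^ 2 ∂μ ≤ ε := by
  have hi : Integrable (fun ω => X ω ^ 2) μ := hL.integrable_sq
  have hlim : Tendsto (fun n : ℕ => ∫ ω, Set.indicator {ω | (n : ℝ) < |X ω|}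
      (fun ω => X ω ^ 2) ω ∂μ) atTop (𝓝 (∫ _, (0 : ℝ) ∂μ)) := by
    refine tendsto_integral_of_dominated_convergence (fun ω => X ω ^ 2) ?_ hi ?_ ?_
    · intro n
      exact ((hX.pow_const 2).indicator (measurableSet_lt measurable_const (by fun_prop)))
        |>.aestronglyMeasurable
    · intro n
      refine ae_of_all _ fun ω => ?_
      rw [Real.norm_eq_abs, Set.indicator]
      split_ifs
      · rw [abs_of_nonneg (sq_nonneg _)]
      · simpa using sq_nonneg _
    · refine ae_of_all _ fun ω => ?_
      refine tendsto_const_nhds.congr' ?_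
      obtain ⟨N, hN⟩ := exists_nat_ge |X ω|
      filter_upwards [eventually_ge_atTop N] with n hn
      rw [Set.indicator_of_notMem]
      simp only [Set.mem_ofPred_eq, not_lt]
      exact hN.trans (by exact_mod_cast hn)
  simp only [integral_zero] at hlim
  obtain ⟨n, hn, hn1⟩ := ((hlim.eventually (gt_mem_nhds hε)).and (eventually_gt_atTop 0)).exists
  refine ⟨n, by exact_mod_cast hn1, ?_⟩
  rw [← integral_indicator (measurableSet_lt measurable_const (by fun_prop))]
  exact hn.le

/-- The squares `S_n² / n` of the normalized partial sums of an i.i.d. centered square integrable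
sequence are uniformly integrable: they do not charge events of vanishing probability. -/
lemma tendsto_setIntegral_sum_sq [IsProbabilityMeasure μ] {X : ℕ → Ω → ℝ}
    (hX : ∀ k, Measurable (X k))
    (hid : ∀ k, IdentDistrib (X k) (X 0) μ μ) (hind : iIndepFun X μ) (hL : MemLp (X 0) 2 μ)
    (h0 : ∫ ω, X 0 ω ∂μ = 0) {D : ℕ → Set Ω}
    (hD0 : Tendsto (fun n => μ.real (D n)) atTop (𝓝 0)) :
    Tendsto (fun n : ℕ => ∫ ω in D n, (∑ k ∈ Finset.range n, X k ω) ^ 2 / n ∂μ)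
      atTop (𝓝 0) := by
  rw [tendsto_order]
  refine ⟨fun b hb => Eventually.of_forall fun n => hb.trans_le
    (integral_nonneg fun ω => by positivity), fun ε hε => ?_⟩
  obtain ⟨K, hK, hKε⟩ := exists_integral_indicator_sq_le (hX 0) hL (ε := ε / 8) (by positivity)
  -- the truncation `φ` of the identity, and the centered truncated and residual parts
  set φ : ℝ → ℝ := fun x => if K < |x| then 0 else x with hφ
  have hφm : Measurable φ :=
    Measurable.ite (measurableSet_lt measurable_const (by fun_prop)) measurable_const measurable_id
  have hφb : ∀ x, |φ x| ≤ K := by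
    intro x; simp only [hφ]; split_ifs with h
    · simpa using hK.le
    · exact not_lt.1 h
  set m : ℝ := ∫ ω, φ (X 0 ω) ∂μ with hm
  have hmb : |m| ≤ K := by
    have := norm_integral_le_of_norm_le_const (μ := μ) (f := fun ω => φ (X 0 ω)) (C := K)
      (ae_of_all _ fun ω => by simpa using hφb _)
    simpa using this
  have hφi : Integrable (fun ω => φ (X 0 ω)) μ :=
    integrable_of_abs_le (hφm.comp (hX 0)) K fun ω => hφb _
  set X₁ : ℕ → Ω → ℝ := fun k ω => φ (X k ω) - m with hX₁
  set X₂ : ℕ → Ω → ℝ := fun k ω => X k ω - φ (X k ω) + m with hX₂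
  have hX₁m : ∀ k, Measurable (X₁ k) := fun k => (hφm.comp (hX k)).sub_const m
  have hX₂m : ∀ k, Measurable (X₂ k) := fun k => ((hX k).sub (hφm.comp (hX k))).add_const m
  have hX₁b : ∀ k ω, |X₁ k ω| ≤ 2 * K := by
    intro k ω
    have := abs_sub (φ (X k ω)) m
    have := hφb (X k ω)
    simp only [hX₁]; linarith
  have hind₁ : iIndepFun X₁ μ := hind.comp (fun _ x => φ x - m) fun _ => hφm.sub_const m
  have hind₂ : iIndepFun X₂ μ :=
    hind.comp (fun _ x => x - φ x + m) fun _ => (measurable_id.sub hφm).add_const m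
  have hid₂ : ∀ k, IdentDistrib (X₂ k) (X₂ 0) μ μ := fun k =>
    (hid k).comp ((measurable_id.sub hφm).add_const m)
  have h0₁ : ∀ k, ∫ ω, X₁ k ω ∂μ = 0 := by
    intro k
    have : ∫ ω, X₁ k ω ∂μ = ∫ ω, X₁ 0 ω ∂μ := ((hid k).comp (hφm.sub_const m)).integral_eq
    rw [this]
    simp only [hX₁]
    rw [integral_sub hφi (integrable_const _)]
    simp [hm]
  have hXi : Integrable (X 0) μ := hL.integrable one_le_two
  have h0₂ : ∫ ω, X₂ 0 ω ∂μ = 0 := by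
    simp only [hX₂]
    have hsub : Integrable (fun ω => X 0 ω - φ (X 0 ω)) μ := hXi.sub hφi
    rw [integral_add hsub (integrable_const _), integral_sub hXi hφi, h0]
    simp [hm]
  have hL₁ : MemLp (X₁ 0) 2 μ :=
    MemLp.of_bound (hX₁m 0).aestronglyMeasurable (2 * K) (ae_of_all _ fun ω => by
      simpa using hX₁b 0 ω)
  have hL₂ : MemLp (X₂ 0) 2 μ := by
    convert hL.sub hL₁ using 1
    ext ω; simp [hX₁, hX₂]; ring
  have hv₂ : ∫ ω, X₂ 0 ω ^ 2 ∂μ ≤ ε / 8 := by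
    -- `X₂` is a centered variable, so its second moment is at most that of `X - φ X`
    have hY : MemLp (fun ω => X 0 ω - φ (X 0 ω)) 2 μ := by
      convert hL₂.sub (memLp_const m) using 1
      ext ω; simp [hX₂]
    have hmean : ∫ ω, (X 0 ω - φ (X 0 ω)) ∂μ = -m := by
      rw [integral_sub hXi hφi, h0]; simp [hm]
    have hYi := hY.integrable one_le_two
    have : ∫ ω, X₂ 0 ω ^ 2 ∂μ = ∫ ω, (X 0 ω - φ (X 0 ω)) ^ 2 ∂μ - m ^ 2 := by
      have e : ∀ ω, X₂ 0 ω ^ 2 = (X 0 ω - φ (X 0 ω)) ^ 2 + 2 * m * (X 0 ω - φ (X 0 ω)) + m ^ 2 := by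
        intro ω; simp only [hX₂]; ring
      simp_rw [e]
      rw [integral_add (hY.integrable_sq.fun_add (hYi.const_mul _)) (integrable_const _),
        integral_add hY.integrable_sq (hYi.const_mul _), integral_const_mul, hmean]
      simp; ring
    have e2 : ∫ ω, (X 0 ω - φ (X 0 ω)) ^ 2 ∂μ = ∫ ω in {ω | K < |X 0 ω|}, X 0 ω ^ 2 ∂μ := by
      rw [← integral_indicator (measurableSet_lt measurable_const (by fun_prop))]
      refine integral_congr_ae (ae_of_all _ fun ω => ?_)
      simp only [hφ, Set.indicator, Set.mem_ofPred_eq]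
      split_ifs <;> simp
    rw [this, e2]
    nlinarith [sq_nonneg m]
  set P : ℝ := 3 * (2 * K) ^ 4 with hP
  have hP0 : 0 < P := by positivity
  -- on the truncated part, `x ≤ x² / (2 lam) + lam / 2` with a large `lam`
  set lam : ℝ := 4 * P / ε with hlam
  have hlam0 : 0 < lam := by positivity
  have hev : ∀ᶠ n in atTop, μ.real (D n) < ε / (4 * lam) :=
    hD0.eventually (gt_mem_nhds (by positivity))
  filter_upwards [hev, eventually_gt_atTop 0] with n hn hn0
  have hn' : (0 : ℝ) < n := by exact_mod_cast hn0
  set S₁ : Ω → ℝ := fun ω => ∑ k ∈ Finset.range n, X₁ k ω with hS₁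
  set S₂ : Ω → ℝ := fun ω => ∑ k ∈ Finset.range n, X₂ k ω with hS₂
  have hS₁m : Measurable S₁ := Finset.measurable_fun_sum _ fun k _ => hX₁m k
  have hS : ∀ ω, ∑ k ∈ Finset.range n, X k ω = S₁ ω + S₂ ω := by
    intro ω
    simp only [hS₁, hS₂, ← Finset.sum_add_distrib]
    refine Finset.sum_congr rfl fun k _ => ?_
    simp only [hX₁, hX₂]; ring
  have hS₁4i : Integrable (fun ω => S₁ ω ^ 4) μ := by
    refine integrable_of_abs_le (by fun_prop) ((n * (2 * K)) ^ 4) fun ω => ?_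
    rw [abs_pow]
    exact pow_le_pow_left₀ (abs_nonneg _) (abs_sum_range_le hX₁b n ω) 4
  have hS₂i : Integrable (fun ω => S₂ ω ^ 2) μ := by
    have : MemLp S₂ 2 μ := memLp_finsetSum _ fun k _ => (hid₂ k).memLp_iff.2 hL₂
    exact this.integrable_sq
  have hb4 : ∫ ω, S₁ ω ^ 4 ∂μ ≤ n ^ 2 * P := by
    have := (integral_sum_pow_le hX₁m hX₁b hind₁ h0₁ n).2
    simp only [hP, hS₁]; linarith
  have hb2 : ∫ ω, S₂ ω ^ 2 ∂μ ≤ n * (ε / 8) := by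
    rw [hS₂, integral_sum_sq_eq hid₂ hind₂ hL₂ h0₂]
    gcongr
  set g : Ω → ℝ := fun ω => S₁ ω ^ 4 / (n ^ 2 * lam) + 2 * (S₂ ω ^ 2 / n) with hg
  have hgi : Integrable g μ := (hS₁4i.div_const _).fun_add ((hS₂i.div_const _).const_mul _)
  have hg0 : ∀ ω, 0 ≤ g ω := fun ω => by simp only [hg]; positivity
  have hpt : ∀ ω, (∑ k ∈ Finset.range n, X k ω) ^ 2 / n ≤ g ω + lam := by
    intro ω
    rw [hS ω]
    have h1 : (S₁ ω + S₂ ω) ^ 2 / n ≤ 2 * (S₁ ω ^ 2 / n) + 2 * (S₂ ω ^ 2 / n) := by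
      rw [← mul_div_assoc, ← mul_div_assoc, ← add_div]
      gcongr
      nlinarith [sq_nonneg (S₁ ω - S₂ ω)]
    have h2 : 2 * (S₁ ω ^ 2 / n) ≤ S₁ ω ^ 4 / (n ^ 2 * lam) + lam := by
      have : S₁ ω ^ 4 / (n ^ 2 * lam) + lam - 2 * (S₁ ω ^ 2 / n) =
          (S₁ ω ^ 2 / n - lam) ^ 2 / lam := by field_simp; ring
      have h3 : 0 ≤ (S₁ ω ^ 2 / n - lam) ^ 2 / lam := by positivity
      linarith
    simp only [hg]; linarith
  have hint0 : IntegrableOn (fun ω => g ω + lam) (D n) μ :=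
    (hgi.add (integrable_const _)).integrableOn
  calc ∫ ω in D n, (∑ k ∈ Finset.range n, X k ω) ^ 2 / n ∂μ
      ≤ ∫ ω in D n, (g ω + lam) ∂μ :=
        integral_mono_of_nonneg (ae_of_all _ fun ω => by positivity) hint0 (ae_of_all _ hpt)
    _ = ∫ ω in D n, g ω ∂μ + μ.real (D n) * lam := by
        rw [integral_add hgi.integrableOn (integrable_const _)]; simp
    _ ≤ ∫ ω, g ω ∂μ + μ.real (D n) * lam := by
        have := setIntegral_le_integral (s := D n) hgi (ae_of_all _ hg0)
        linarith
    _ < ε := by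
        have e : ∫ ω, g ω ∂μ =
          (∫ ω, S₁ ω ^ 4 ∂μ) / (n ^ 2 * lam) + 2 * ((∫ ω, S₂ ω ^ 2 ∂μ) / n) := by
          simp only [hg]
          rw [integral_add (hS₁4i.div_const _) ((hS₂i.div_const _).const_mul _),
            integral_div, integral_const_mul, integral_div]
        have h1 : (∫ ω, S₁ ω ^ 4 ∂μ) / (n ^ 2 * lam) ≤ ε / 4 := by
          rw [div_le_iff₀ (by positivity)]
          refine hb4.trans (le_of_eq ?_)
          simp only [hlam]; field_simp
        have h2 : (∫ ω, S₂ ω ^ 2 ∂μ) / n ≤ ε / 8 := by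
          rw [div_le_iff₀ hn']; linarith
        have h3 : μ.real (D n) * lam < ε / 4 := by
          calc μ.real (D n) * lam < ε / (4 * lam) * lam := by gcongr
            _ = ε / 4 := by field_simp
        rw [e]; linarith

/-- The weak law of large numbers for an integrable i.i.d. sequence. -/
lemma tendsto_measure_abs_mean_sub_ge [IsProbabilityMeasure μ] {X : ℕ → Ω → ℝ}
    (hid : ∀ k, IdentDistrib (X k) (X 0) μ μ) (hind : iIndepFun X μ) (hi : Integrable (X 0) μ)
    {δ : ℝ} (hδ : 0 < δ) :
    Tendsto (fun n : ℕ => μ.real {ω | δ ≤ |(∑ k ∈ Finset.range n, X k ω) / n - ∫ ω, X 0 ω ∂μ|})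
      atTop (𝓝 0) := by
  have hae := strong_law_ae_real X hi (fun i j hij => hind.indepFun hij) hid
  have hm : ∀ n : ℕ, AEStronglyMeasurable (fun ω => (∑ k ∈ Finset.range n, X k ω) / n) μ := by
    intro n
    have : AEMeasurable (fun ω => ∑ k ∈ Finset.range n, X k ω) μ :=
      Finset.aemeasurable_fun_sum _ fun k _ => (hid k).aemeasurable_fst
    exact (this.div_const _).aestronglyMeasurable
  have ht := tendstoInMeasure_of_tendsto_ae hm hae
  rw [tendstoInMeasure_iff_measureReal_norm] at ht
  simpa using ht δ hδ

end RealSums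

/-! ### Moments of complex Gaussian vectors -/

/-- The fourth moment of a centered real Gaussian. -/
lemma integral_pow_four_gaussianReal (v : NNReal) :
    ∫ x, x ^ 4 ∂gaussianReal 0 v = 3 * (v : ℝ) ^ 2 := by
  have h := iteratedDeriv_mgf_zero (X := fun x : ℝ => x) (μ := gaussianReal 0 v) (by simp) 4
  rw [mgf_fun_id_gaussianReal] at h
  have key : ∀ (p p' : ℝ → ℝ), (∀ t, HasDerivAt p (p' t) t) →
      deriv (fun t => p t * Real.exp (v * t ^ 2 / 2)) =
        fun t => (p' t + v * t * p t) * Real.exp (v * t ^ 2 / 2) := by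
    intro p p' hp
    ext t
    have h1 : HasDerivAt (fun t : ℝ => (v : ℝ) * t ^ 2 / 2) (v * t) t :=
      (((hasDerivAt_pow 2 t).const_mul (v : ℝ)).div_const 2).congr_deriv (by push_cast; ring)
    have := ((hp t).mul h1.exp).deriv
    rw [show (fun t => p t * Real.exp (v * t ^ 2 / 2)) =
      p * fun t => Real.exp (v * t ^ 2 / 2) from rfl, this]
    ring
  have e0 : (fun t : ℝ => Real.exp (0 * t + v * t ^ 2 / 2)) =
      fun t => (fun _ => (1 : ℝ)) t * Real.exp (v * t ^ 2 / 2) := by ext; simp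
  rw [e0] at h
  have d1 : deriv (fun t : ℝ => (fun _ => (1 : ℝ)) t * Real.exp (v * t ^ 2 / 2)) =
      fun t => (v * t) * Real.exp (v * t ^ 2 / 2) := by
    rw [key (fun _ => 1) (fun _ => 0) fun t => hasDerivAt_const t 1]
    ext t; ring
  have d2 : deriv (fun t : ℝ => (v * t) * Real.exp (v * t ^ 2 / 2)) =
      fun t => (v + v ^ 2 * t ^ 2) * Real.exp (v * t ^ 2 / 2) := by
    rw [key (fun t => v * t) (fun _ => v) fun t => by
      simpa using (hasDerivAt_id t).const_mul (v : ℝ)]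
    ext t; ring
  have d3 : deriv (fun t : ℝ => (v + v ^ 2 * t ^ 2) * Real.exp (v * t ^ 2 / 2)) =
      fun t => (3 * v ^ 2 * t + v ^ 3 * t ^ 3) * Real.exp (v * t ^ 2 / 2) := by
    rw [key (fun t => v + v ^ 2 * t ^ 2) (fun t => 2 * v ^ 2 * t) fun t =>
      (((hasDerivAt_pow 2 t).const_mul ((v : ℝ) ^ 2)).const_add (v : ℝ)).congr_deriv
        (by push_cast; ring)]
    ext t; ring
  have d4 : deriv (fun t : ℝ => (3 * v ^ 2 * t + v ^ 3 * t ^ 3) * Real.exp (v * t ^ 2 / 2)) =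
      fun t => (3 * v ^ 2 + 6 * v ^ 3 * t ^ 2 + v ^ 4 * t ^ 4) * Real.exp (v * t ^ 2 / 2) := by
    rw [key (fun t => 3 * v ^ 2 * t + v ^ 3 * t ^ 3) (fun t => 3 * v ^ 2 + 3 * v ^ 3 * t ^ 2)
      fun t => (((hasDerivAt_id t).const_mul (3 * (v : ℝ) ^ 2)).add
        ((hasDerivAt_pow 3 t).const_mul ((v : ℝ) ^ 3))).congr_deriv (by push_cast; ring)]
    ext t; ring
  rw [iteratedDeriv_succ, iteratedDeriv_succ, iteratedDeriv_succ, iteratedDeriv_succ,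
    iteratedDeriv_zero, d1, d2, d3, d4] at h
  simpa using h.symm

section Gaussian

variable {Ω ι : Type*} [MeasurableSpace Ω] [Fintype ι] {μ : Measure Ω} {z : Ω → ι → ℂ}
  {Γ : Matrix ι ι ℂ}

lemma measurable_star_dotProduct (w : ι → ℂ) : Measurable fun z : ι → ℂ => star w ⬝ᵥ z := by
  unfold dotProduct
  fun_prop

lemma re_star_I_smul_dotProduct (w z : ι → ℂ) :
    (star (Complex.I • w) ⬝ᵥ z).re = (star w ⬝ᵥ z).im := by
  simp [star_smul]

lemma norm_sq_star_dotProduct (w z : ι → ℂ) :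
    ‖star w ⬝ᵥ z‖ ^ 2 =
      (star w ⬝ᵥ z).re ^ 2 + (star (Complex.I • w) ⬝ᵥ z).re ^ 2 := by
  rw [re_star_I_smul_dotProduct, ← Complex.normSq_eq_norm_sq, Complex.normSq_apply]
  ring

lemma IsComplexGaussian.memLp_re (hz : IsComplexGaussian μ z Γ) (w : ι → ℂ)
    {p : ENNReal} (hp : p ≠ ⊤) : MemLp (fun ω => (star w ⬝ᵥ z ω).re) p μ := by
  have hm : AEMeasurable (fun ω => (star w ⬝ᵥ z ω).re) μ :=
    (Complex.measurable_re.comp (measurable_star_dotProduct w)).comp_aemeasurable hz.1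
  have := memLp_id_gaussianReal' (μ := 0)
    (v := Real.toNNReal ((star w ⬝ᵥ (Γ *ᵥ w)).re / 2)) p hp
  rw [← hz.2 w] at this
  exact (memLp_map_measure_iff aestronglyMeasurable_id hm).1 this

lemma IsComplexGaussian.integral_comp_re (hz : IsComplexGaussian μ z Γ) (w : ι → ℂ)
    {f : ℝ → ℝ} (hf : Measurable f) : ∫ ω, f (star w ⬝ᵥ z ω).re ∂μ =
      ∫ x, f x ∂gaussianReal 0 (Real.toNNReal ((star w ⬝ᵥ (Γ *ᵥ w)).re / 2)) := by
  have hm : AEMeasurable (fun ω => (star w ⬝ᵥ z ω).re) μ :=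
    (Complex.measurable_re.comp (measurable_star_dotProduct w)).comp_aemeasurable hz.1
  rw [← hz.2 w, integral_map hm hf.aestronglyMeasurable]

lemma IsComplexGaussian.integral_re (hz : IsComplexGaussian μ z Γ) (w : ι → ℂ) :
    ∫ ω, (star w ⬝ᵥ z ω).re ∂μ = 0 := by
  rw [hz.integral_comp_re w (f := fun x => x) measurable_id, integral_id_gaussianReal]

lemma quad_half_nonneg (hΓ : Γ.PosSemidef) (w : ι → ℂ) :
    0 ≤ (star w ⬝ᵥ (Γ *ᵥ w)).re / 2 := by
  have := (Complex.le_def.1 (hΓ.dotProduct_mulVec_nonneg w)).1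
  simp only [Complex.zero_re] at this
  linarith

lemma IsComplexGaussian.integral_re_sq (hz : IsComplexGaussian μ z Γ) (hΓ : Γ.PosSemidef)
    (w : ι → ℂ) : ∫ ω, (star w ⬝ᵥ z ω).re ^ 2 ∂μ = (star w ⬝ᵥ (Γ *ᵥ w)).re / 2 := by
  rw [hz.integral_comp_re w (f := fun x => x ^ 2) (by fun_prop)]
  have := variance_fun_id_gaussianReal (μ := 0)
    (v := Real.toNNReal ((star w ⬝ᵥ (Γ *ᵥ w)).re / 2))
  rw [variance_of_integral_eq_zero measurable_id'.aemeasurable integral_id_gaussianReal] at this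
  rw [this, Real.coe_toNNReal _ (quad_half_nonneg hΓ w)]

lemma IsComplexGaussian.integral_re_pow_four (hz : IsComplexGaussian μ z Γ) (hΓ : Γ.PosSemidef)
    (w : ι → ℂ) :
    ∫ ω, (star w ⬝ᵥ z ω).re ^ 4 ∂μ = 3 * ((star w ⬝ᵥ (Γ *ᵥ w)).re / 2) ^ 2 := by
  rw [hz.integral_comp_re w (f := fun x => x ^ 4) (by fun_prop), integral_pow_four_gaussianReal,
    Real.coe_toNNReal _ (quad_half_nonneg hΓ w)]

/-- Uncorrelated real parts have uncorrelated squares: polarization of the fourth moment, as all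
the sums and differences are Gaussian. -/
lemma IsComplexGaussian.integral_re_sq_mul_re_sq (hz : IsComplexGaussian μ z Γ)
    (hΓ : Γ.PosSemidef) (w w' : ι → ℂ) (h : star w ⬝ᵥ (Γ *ᵥ w') = 0)
    (h' : star w' ⬝ᵥ (Γ *ᵥ w) = 0) :
    ∫ ω, (star w ⬝ᵥ z ω).re ^ 2 * (star w' ⬝ᵥ z ω).re ^ 2 ∂μ =
      (star w ⬝ᵥ (Γ *ᵥ w)).re / 2 * ((star w' ⬝ᵥ (Γ *ᵥ w')).re / 2) := by
  have i4 : ∀ u : ι → ℂ, Integrable (fun ω => (star u ⬝ᵥ z ω).re ^ 4) μ := fun u => by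
    have := (hz.memLp_re u (p := (4 : ℕ)) (by simp)).integrable_norm_pow (by norm_num)
    simpa [(show Even 4 by decide).pow_abs] using this
  have e : ∀ ω, (star w ⬝ᵥ z ω).re ^ 2 * (star w' ⬝ᵥ z ω).re ^ 2 =
      ((star (w + w') ⬝ᵥ z ω).re ^ 4 + (star (w - w') ⬝ᵥ z ω).re ^ 4 -
        2 * (star w ⬝ᵥ z ω).re ^ 4 - 2 * (star w' ⬝ᵥ z ω).re ^ 4) / 12 := by
    intro ω
    simp only [star_add, star_sub, add_dotProduct, sub_dotProduct, Complex.add_re, Complex.sub_re]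
    ring
  simp_rw [e]
  have i3 : Integrable (fun ω => (star (w + w') ⬝ᵥ z ω).re ^ 4 + (star (w - w') ⬝ᵥ z ω).re ^ 4 -
      2 * (star w ⬝ᵥ z ω).re ^ 4) μ := ((i4 _).add (i4 _)).sub ((i4 _).const_mul 2)
  rw [integral_div, integral_sub i3
    ((i4 _).const_mul 2), integral_sub ((i4 _).fun_add (i4 _)) ((i4 _).const_mul 2),
    integral_add (i4 _) (i4 _), integral_const_mul, integral_const_mul]
  simp only [hz.integral_re_pow_four hΓ]
  have ep : (star (w + w') ⬝ᵥ (Γ *ᵥ (w + w'))).re =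
      (star w ⬝ᵥ (Γ *ᵥ w)).re + (star w' ⬝ᵥ (Γ *ᵥ w')).re := by
    simp [mulVec_add, h, h']
  have em : (star (w - w') ⬝ᵥ (Γ *ᵥ (w - w'))).re =
      (star w ⬝ᵥ (Γ *ᵥ w)).re + (star w' ⬝ᵥ (Γ *ᵥ w')).re := by
    simp [mulVec_sub, h, h']
  rw [ep, em]
  ring

lemma I_smul_quad (Γ : Matrix ι ι ℂ) (w : ι → ℂ) :
    star (Complex.I • w) ⬝ᵥ (Γ *ᵥ (Complex.I • w)) = star w ⬝ᵥ (Γ *ᵥ w) := by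
  simp only [star_smul, mulVec_smul, smul_dotProduct, dotProduct_smul, smul_eq_mul]
  rw [← mul_assoc]
  simp

lemma IsComplexGaussian.memLp_re_sq (hz : IsComplexGaussian μ z Γ) (w : ι → ℂ) :
    MemLp (fun ω => (star w ⬝ᵥ z ω).re ^ 2) 2 μ := by
  simp_rw [pow_two]
  refine MemLp.mul' (p := 4) (q := 4) (hpqr := ⟨?_⟩) (hz.memLp_re w (by simp))
    (hz.memLp_re w (by simp))
  rw [← two_mul, show (4 : ENNReal) = 2 * 2 by norm_num,
    ENNReal.mul_inv (by simp) (by simp), ← mul_assoc, ENNReal.mul_inv_cancel (by simp) (by simp),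
    one_mul]

lemma IsComplexGaussian.memLp_norm_sq (hz : IsComplexGaussian μ z Γ) (w : ι → ℂ) :
    MemLp (fun ω => ‖star w ⬝ᵥ z ω‖ ^ 2) 2 μ := by
  simp_rw [norm_sq_star_dotProduct]
  exact (hz.memLp_re_sq w).add (hz.memLp_re_sq _)

lemma IsComplexGaussian.integral_norm_sq [IsFiniteMeasure μ] (hz : IsComplexGaussian μ z Γ)
    (hΓ : Γ.PosSemidef) (w : ι → ℂ) :
    ∫ ω, ‖star w ⬝ᵥ z ω‖ ^ 2 ∂μ = (star w ⬝ᵥ (Γ *ᵥ w)).re := by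
  simp_rw [norm_sq_star_dotProduct]
  rw [integral_add (hz.memLp_re w (by simp)).integrable_sq
    (hz.memLp_re _ (by simp)).integrable_sq, hz.integral_re_sq hΓ, hz.integral_re_sq hΓ,
    I_smul_quad]
  ring

lemma IsComplexGaussian.integral_norm_sq_mul_norm_sq (hz : IsComplexGaussian μ z Γ)
    (hΓ : Γ.PosSemidef) (w w' : ι → ℂ) (h : star w ⬝ᵥ (Γ *ᵥ w') = 0)
    (h' : star w' ⬝ᵥ (Γ *ᵥ w) = 0) :
    ∫ ω, ‖star w ⬝ᵥ z ω‖ ^ 2 * ‖star w' ⬝ᵥ z ω‖ ^ 2 ∂μ =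
      (star w ⬝ᵥ (Γ *ᵥ w)).re * (star w' ⬝ᵥ (Γ *ᵥ w')).re := by
  have hi : ∀ u u' : ι → ℂ,
      Integrable (fun ω => (star u ⬝ᵥ z ω).re ^ 2 * (star u' ⬝ᵥ z ω).re ^ 2) μ :=
    fun u u' => (hz.memLp_re_sq u).integrable_mul (hz.memLp_re_sq u')
  simp_rw [norm_sq_star_dotProduct, add_mul, mul_add]
  rw [integral_add ((hi _ _).fun_add (hi _ _)) ((hi _ _).fun_add (hi _ _)),
    integral_add (hi _ _) (hi _ _), integral_add (hi _ _) (hi _ _),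
    hz.integral_re_sq_mul_re_sq hΓ _ _ h h',
    hz.integral_re_sq_mul_re_sq hΓ _ _ (by simp [mulVec_smul, h]) (by simp [star_smul, h']),
    hz.integral_re_sq_mul_re_sq hΓ _ _ (by simp [star_smul, h]) (by simp [mulVec_smul, h']),
    hz.integral_re_sq_mul_re_sq hΓ _ _ (by simp [star_smul, mulVec_smul, h])
      (by simp [star_smul, mulVec_smul, h']), I_smul_quad, I_smul_quad]
  ring

/-- Two complex Gaussian vectors with the same covariance have the same law (Cramér–Wold). -/
lemma IsComplexGaussian.identDistrib [IsFiniteMeasure μ] {z' : Ω → ι → ℂ}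
    (hz : IsComplexGaussian μ z Γ) (hz' : IsComplexGaussian μ z' Γ) : IdentDistrib z z' μ μ := by
  classical
  refine ⟨hz.1, hz'.1, ?_⟩
  refine Measure.ext_of_charFunDual ?_
  ext L
  -- every real-linear functional is the real part of some `wᴴ z`
  set w : ι → ℂ := fun i => (L (Pi.single i 1) : ℂ) + L (Pi.single i Complex.I) * Complex.I with hw
  have hL : ∀ x : ι → ℂ, L x = (star w ⬝ᵥ x).re := by
    intro x
    have hx : x = ∑ i, ((x i).re • (Pi.single i (1 : ℂ) : ι → ℂ) +
        (x i).im • (Pi.single i Complex.I : ι → ℂ)) := by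
      ext j
      simp only [Finset.sum_apply, Pi.add_apply, Pi.smul_apply, Pi.single_apply]
      rw [Finset.sum_eq_single j] <;> simp +contextual [eq_comm]
    conv_lhs => rw [hx]
    simp only [map_sum, map_add, map_smul, smul_eq_mul, dotProduct, Complex.re_sum]
    refine Finset.sum_congr rfl fun i _ => ?_
    simp [hw]
    ring
  have key : ∀ y : Ω → ι → ℂ, IsComplexGaussian μ y Γ → charFunDual (μ.map y) L =
      charFun (gaussianReal 0 (Real.toNNReal ((star w ⬝ᵥ (Γ *ᵥ w)).re / 2))) 1 := by
    intro y hy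
    rw [charFunDual_eq_charFun_map_one, ← hy.2 w,
      AEMeasurable.map_map_of_aemeasurable (by fun_prop) hy.1]
    congr 2
    ext ω
    simp [hL]
  rw [key z hz, key z' hz']

end Gaussian

/-! ### Moments of clutter plus noise -/

section Interference

variable {Ω ι : Type*} [MeasurableSpace Ω] [Fintype ι] {μ : Measure Ω} {Γ : Matrix ι ι ℂ}
  {τ : ℕ → Ω → ℝ} {c v : ℕ → Ω → ι → ℂ}

omit [MeasurableSpace Ω] in
lemma star_dotProduct_interference (w : ι → ℂ) (σ : ℝ) (k : ℕ) (ω : Ω) :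
    star w ⬝ᵥ interference τ c v σ k ω = τ k ω * (star w ⬝ᵥ c k ω) + σ * (star w ⬝ᵥ v k ω) := by
  simp only [interference, dotProduct, Finset.mul_sum, ← Finset.sum_add_distrib]
  exact Finset.sum_congr rfl fun i _ => by ring

omit [MeasurableSpace Ω] in
lemma norm_sq_star_dotProduct_interference (w : ι → ℂ) (σ : ℝ) (k : ℕ) (ω : Ω) :
    ‖star w ⬝ᵥ interference τ c v σ k ω‖ ^ 2 =
      τ k ω ^ 2 * ‖star w ⬝ᵥ c k ω‖ ^ 2 + σ ^ 2 * ‖star w ⬝ᵥ v k ω‖ ^ 2 +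
      2 * σ * (τ k ω * ((star w ⬝ᵥ c k ω).re * (star w ⬝ᵥ v k ω).re)) +
      2 * σ * (τ k ω * ((star (Complex.I • w) ⬝ᵥ c k ω).re *
        (star (Complex.I • w) ⬝ᵥ v k ω).re)) := by
  rw [star_dotProduct_interference]
  simp only [re_star_I_smul_dotProduct, ← Complex.normSq_eq_norm_sq, Complex.normSq_apply]
  simp
  ring

variable [DecidableEq ι]

/-- Second moments of clutter plus noise, weighted by a function of the noise: the cross terms
vanish since texture, speckle and noise are independent and the speckle is centered. -/
lemma IsSIRVModel.integral_norm_sq_mul [IsProbabilityMeasure μ] (hM : IsSIRVModel μ Γ τ c v)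
    (hΓ : Γ.PosSemidef) (σ : ℝ) (k : ℕ) (w : ι → ℂ) {g : (ι → ℂ) → ℝ} (hg : Measurable g)
    (hgL : MemLp (fun ω => g (v k ω)) 2 μ) :
    Integrable (fun ω => ‖star w ⬝ᵥ interference τ c v σ k ω‖ ^ 2 * g (v k ω)) μ ∧
    ∫ ω, ‖star w ⬝ᵥ interference τ c v σ k ω‖ ^ 2 * g (v k ω) ∂μ =
      (∫ ω, τ k ω ^ 2 ∂μ) * ((star w ⬝ᵥ (Γ *ᵥ w)).re * ∫ ω, g (v k ω) ∂μ) +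
      σ ^ 2 * ∫ ω, ‖star w ⬝ᵥ v k ω‖ ^ 2 * g (v k ω) ∂μ := by
  have hc := hM.speckle_gaussian k
  have hv := hM.noise_gaussian k
  have hτ := hM.texture_memLp k
  have hτ1 : Integrable (τ k) μ := hτ.integrable one_le_two
  have hτ2 : Integrable (fun ω => τ k ω ^ 2) μ := hτ.integrable_sq
  have hcv := hM.speckle_indep_noise k
  have hn : Measurable fun z : ι → ℂ => ‖star w ⬝ᵥ z‖ ^ 2 :=
    (measurable_star_dotProduct w).norm.pow_const 2
  have hre : ∀ u : ι → ℂ, Measurable fun z : ι → ℂ => (star u ⬝ᵥ z).re :=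
    fun u => Complex.measurable_re.comp (measurable_star_dotProduct u)
  have hgi : Integrable (fun ω => g (v k ω)) μ := hgL.integrable one_le_two
  -- clutter term
  have hcn : Integrable (fun ω => ‖star w ⬝ᵥ c k ω‖ ^ 2) μ :=
    (hc.memLp_norm_sq w).integrable one_le_two
  have hcg_ind : IndepFun (fun ω => ‖star w ⬝ᵥ c k ω‖ ^ 2) (fun ω => g (v k ω)) μ :=
    hcv.comp hn hg
  have hcg : Integrable (fun ω => ‖star w ⬝ᵥ c k ω‖ ^ 2 * g (v k ω)) μ :=
    hcg_ind.integrable_mul hcn hgi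
  have h1_ind : IndepFun (fun ω => τ k ω ^ 2) (fun ω => ‖star w ⬝ᵥ c k ω‖ ^ 2 * g (v k ω)) μ :=
    (hM.texture_indep k).comp (φ := fun x => x ^ 2)
      (ψ := fun y : (ι → ℂ) × (ι → ℂ) => ‖star w ⬝ᵥ y.1‖ ^ 2 * g y.2) (by fun_prop)
      ((hn.comp measurable_fst).mul (hg.comp measurable_snd))
  have h1 : Integrable (fun ω => τ k ω ^ 2 * (‖star w ⬝ᵥ c k ω‖ ^ 2 * g (v k ω))) μ :=
    h1_ind.integrable_mul hτ2 hcg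
  have e1 : ∫ ω, τ k ω ^ 2 * (‖star w ⬝ᵥ c k ω‖ ^ 2 * g (v k ω)) ∂μ =
      (∫ ω, τ k ω ^ 2 ∂μ) * ((star w ⬝ᵥ (Γ *ᵥ w)).re * ∫ ω, g (v k ω) ∂μ) := by
    rw [h1_ind.integral_fun_mul_eq_mul_integral hτ2.aestronglyMeasurable hcg.aestronglyMeasurable,
      hcg_ind.integral_fun_mul_eq_mul_integral hcn.aestronglyMeasurable hgi.aestronglyMeasurable,
      hc.integral_norm_sq hΓ]
  -- noise term
  have h2 : Integrable (fun ω => ‖star w ⬝ᵥ v k ω‖ ^ 2 * g (v k ω)) μ :=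
    (hv.memLp_norm_sq w).integrable_mul hgL
  -- cross terms
  have h3 : ∀ u : ι → ℂ,
      Integrable (fun ω => τ k ω * ((star u ⬝ᵥ c k ω).re * (star u ⬝ᵥ v k ω).re) * g (v k ω)) μ ∧
      ∫ ω, τ k ω * ((star u ⬝ᵥ c k ω).re * (star u ⬝ᵥ v k ω).re) * g (v k ω) ∂μ = 0 := by
    intro u
    have hci : Integrable (fun ω => (star u ⬝ᵥ c k ω).re) μ :=
      (hc.memLp_re u (p := 2) (by simp)).integrable one_le_two
    have hvg : Integrable (fun ω => (star u ⬝ᵥ v k ω).re * g (v k ω)) μ :=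
      (hv.memLp_re u (p := 2) (by simp)).integrable_mul hgL
    have hi : IndepFun (fun ω => (star u ⬝ᵥ c k ω).re)
        (fun ω => (star u ⬝ᵥ v k ω).re * g (v k ω)) μ :=
      hcv.comp (ψ := fun z : ι → ℂ => (star u ⬝ᵥ z).re * g z) (hre u) ((hre u).mul hg)
    have hi2 : Integrable (fun ω => (star u ⬝ᵥ c k ω).re *
        ((star u ⬝ᵥ v k ω).re * g (v k ω))) μ := hi.integrable_mul hci hvg
    have hi3 : IndepFun (τ k) (fun ω => (star u ⬝ᵥ c k ω).re *
        ((star u ⬝ᵥ v k ω).re * g (v k ω))) μ :=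
      (hM.texture_indep k).comp (φ := fun x => x)
        (ψ := fun y : (ι → ℂ) × (ι → ℂ) => (star u ⬝ᵥ y.1).re * ((star u ⬝ᵥ y.2).re * g y.2))
        measurable_id (((hre u).comp measurable_fst).mul
          (((hre u).comp measurable_snd).mul (hg.comp measurable_snd)))
    have e : ∀ ω, τ k ω * ((star u ⬝ᵥ c k ω).re * (star u ⬝ᵥ v k ω).re) * g (v k ω) =
        τ k ω * ((star u ⬝ᵥ c k ω).re * ((star u ⬝ᵥ v k ω).re * g (v k ω))) :=
      fun ω => by ring
    simp_rw [e]
    refine ⟨hi3.integrable_mul hτ1 hi2, ?_⟩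
    rw [hi3.integral_fun_mul_eq_mul_integral hτ1.aestronglyMeasurable hi2.aestronglyMeasurable,
      hi.integral_fun_mul_eq_mul_integral hci.aestronglyMeasurable hvg.aestronglyMeasurable,
      hc.integral_re]
    simp
  have e : ∀ ω, ‖star w ⬝ᵥ interference τ c v σ k ω‖ ^ 2 * g (v k ω) =
      τ k ω ^ 2 * (‖star w ⬝ᵥ c k ω‖ ^ 2 * g (v k ω)) +
      σ ^ 2 * (‖star w ⬝ᵥ v k ω‖ ^ 2 * g (v k ω)) +
      2 * σ * (τ k ω * ((star w ⬝ᵥ c k ω).re * (star w ⬝ᵥ v k ω).re) * g (v k ω)) +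
      2 * σ * (τ k ω * ((star (Complex.I • w) ⬝ᵥ c k ω).re *
        (star (Complex.I • w) ⬝ᵥ v k ω).re) * g (v k ω)) := fun ω => by
    rw [norm_sq_star_dotProduct_interference]; ring
  simp_rw [e]
  have h12 : Integrable (fun ω => τ k ω ^ 2 * (‖star w ⬝ᵥ c k ω‖ ^ 2 * g (v k ω)) +
      σ ^ 2 * (‖star w ⬝ᵥ v k ω‖ ^ 2 * g (v k ω))) μ := h1.add (h2.const_mul _)
  have h123 := h12.fun_add ((h3 w).1.const_mul (2 * σ))
  refine ⟨h123.fun_add ((h3 _).1.const_mul _), ?_⟩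
  rw [integral_add h123 ((h3 _).1.const_mul _), integral_add h12 ((h3 w).1.const_mul _),
    integral_add h1 (h2.const_mul _), integral_const_mul, integral_const_mul, integral_const_mul,
    (h3 w).2, (h3 _).2, e1]
  ring

lemma IsSIRVModel.integral_texture_sq (hM : IsSIRVModel μ Γ τ c v) (k : ℕ) :
    ∫ ω, τ k ω ^ 2 ∂μ = ∫ ω, τ 0 ω ^ 2 ∂μ :=
  (hM.texture_identDistrib k).sq.integral_eq

/-- The output power of a fixed filter. -/
lemma IsSIRVModel.integral_norm_sq [IsProbabilityMeasure μ] (hM : IsSIRVModel μ Γ τ c v)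
    (hΓ : Γ.PosSemidef) (σ : ℝ) (k : ℕ) (w : ι → ℂ) :
    Integrable (fun ω => ‖star w ⬝ᵥ interference τ c v σ k ω‖ ^ 2) μ ∧
    ∫ ω, ‖star w ⬝ᵥ interference τ c v σ k ω‖ ^ 2 ∂μ =
      (∫ ω, τ 0 ω ^ 2 ∂μ) * (star w ⬝ᵥ (Γ *ᵥ w)).re + σ ^ 2 * (star w ⬝ᵥ w).re := by
  have h := hM.integral_norm_sq_mul hΓ σ k w (g := fun _ => 1) measurable_const (memLp_const 1)
  simp only [mul_one, (hM.noise_gaussian k).integral_norm_sq Matrix.PosSemidef.one,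
    one_mulVec, hM.integral_texture_sq] at h
  simpa using h

/-- A linear form without clutter is almost surely pure noise. -/
lemma IsSIRVModel.star_dotProduct_interference_ae_eq [IsProbabilityMeasure μ]
    (hM : IsSIRVModel μ Γ τ c v) (hΓ : Γ.PosSemidef) (σ : ℝ) (k : ℕ) {w : ι → ℂ}
    (hw : Γ *ᵥ w = 0) :
    ∀ᵐ ω ∂μ, star w ⬝ᵥ interference τ c v σ k ω = σ * (star w ⬝ᵥ v k ω) := by
  have hc := hM.speckle_gaussian k
  have h := hc.integral_norm_sq hΓ w
  rw [hw, dotProduct_zero, Complex.zero_re, integral_eq_zero_iff_of_nonneg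
    (fun ω => by positivity) ((hc.memLp_norm_sq w).integrable one_le_two)] at h
  filter_upwards [h] with ω hω
  have : star w ⬝ᵥ c k ω = 0 := by simpa using hω
  rw [star_dotProduct_interference, this]
  simp

/-- The mixed fourth-order moments of clutter plus noise, for a clutter-free linear form `w'`. -/
lemma IsSIRVModel.integral_norm_sq_mul_norm_sq [IsProbabilityMeasure μ]
    (hM : IsSIRVModel μ Γ τ c v) (hΓ : Γ.PosSemidef) (σ : ℝ) (k : ℕ) (w : ι → ℂ) {w' : ι → ℂ}
    (hw' : Γ *ᵥ w' = 0) :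
    Integrable (fun ω => ‖star w ⬝ᵥ interference τ c v σ k ω‖ ^ 2 *
      ‖star w' ⬝ᵥ interference τ c v σ k ω‖ ^ 2) μ ∧
    (star w ⬝ᵥ w' = 0 → ∫ ω, ‖star w ⬝ᵥ interference τ c v σ k ω‖ ^ 2 *
        ‖star w' ⬝ᵥ interference τ c v σ k ω‖ ^ 2 ∂μ =
      ((∫ ω, τ 0 ω ^ 2 ∂μ) * (star w ⬝ᵥ (Γ *ᵥ w)).re + σ ^ 2 * (star w ⬝ᵥ w).re) *
        (σ ^ 2 * (star w' ⬝ᵥ w').re)) := by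
  have hv := hM.noise_gaussian k
  have h := hM.integral_norm_sq_mul hΓ σ k w (g := fun z => σ ^ 2 * ‖star w' ⬝ᵥ z‖ ^ 2)
    (((measurable_star_dotProduct w').norm.pow_const 2).const_mul _)
    ((hv.memLp_norm_sq w').const_mul _)
  have hae : (fun ω => ‖star w ⬝ᵥ interference τ c v σ k ω‖ ^ 2 *
      ‖star w' ⬝ᵥ interference τ c v σ k ω‖ ^ 2) =ᵐ[μ]
      fun ω => ‖star w ⬝ᵥ interference τ c v σ k ω‖ ^ 2 *
        (σ ^ 2 * ‖star w' ⬝ᵥ v k ω‖ ^ 2) := by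
    filter_upwards [hM.star_dotProduct_interference_ae_eq hΓ σ k hw'] with ω hω
    rw [hω, norm_mul, mul_pow]
    simp
  refine ⟨(integrable_congr hae).2 h.1, fun hww => ?_⟩
  have hww' : star w' ⬝ᵥ w = 0 := by
    rw [star_dotProduct, hww, star_zero]
  have e : ∀ ω, ‖star w ⬝ᵥ v k ω‖ ^ 2 * (σ ^ 2 * ‖star w' ⬝ᵥ v k ω‖ ^ 2) =
      σ ^ 2 * (‖star w ⬝ᵥ v k ω‖ ^ 2 * ‖star w' ⬝ᵥ v k ω‖ ^ 2) := fun ω => by ring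
  rw [integral_congr_ae hae, h.2, integral_const_mul, hv.integral_norm_sq Matrix.PosSemidef.one]
  simp_rw [e]
  rw [integral_const_mul, hv.integral_norm_sq_mul_norm_sq Matrix.PosSemidef.one w w'
    (by simpa using hww) (by simpa using hww'), hM.integral_texture_sq]
  simp only [one_mulVec]
  ring

/-- The cross-covariances of clutter plus noise, by polarization. -/
lemma IsSIRVModel.integral_mul_star [IsProbabilityMeasure μ] (hM : IsSIRVModel μ Γ τ c v)
    (hΓ : Γ.PosSemidef) (σ : ℝ) (k : ℕ) (w w' : ι → ℂ) :
    Integrable (fun ω => (star w ⬝ᵥ interference τ c v σ k ω) *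
      star (star w' ⬝ᵥ interference τ c v σ k ω)) μ ∧
    ∫ ω, (star w ⬝ᵥ interference τ c v σ k ω) * star (star w' ⬝ᵥ interference τ c v σ k ω) ∂μ =
      ((∫ ω, τ 0 ω ^ 2 ∂μ : ℝ) : ℂ) * (star w ⬝ᵥ (Γ *ᵥ w')) + (σ : ℂ) ^ 2 * (star w ⬝ᵥ w') := by
  obtain ⟨x, hx⟩ : ∃ x : Ω → ι → ℂ, x = fun ω => interference τ c v σ k ω := ⟨_, rfl⟩
  set T := ∫ ω, τ 0 ω ^ 2 ∂μ with hT
  have hN : ∀ u : ι → ℂ, Integrable (fun ω => ‖star u ⬝ᵥ x ω‖ ^ 2) μ ∧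
      ∫ ω, ‖star u ⬝ᵥ x ω‖ ^ 2 ∂μ = T * (star u ⬝ᵥ (Γ *ᵥ u)).re + σ ^ 2 * (star u ⬝ᵥ u).re :=
    fun u => by simpa only [hx] using hM.integral_norm_sq hΓ σ k u
  rw [show interference τ c v σ k = x from hx.symm]
  have hherm : star w' ⬝ᵥ (Γ *ᵥ w) = star (star w ⬝ᵥ (Γ *ᵥ w')) := by
    rw [star_dotProduct w' (Γ *ᵥ w), star_mulVec, hΓ.1.eq, dotProduct_mulVec]
  have hpol : ∀ u : ι → ℂ,
      Integrable (fun ω => (‖star (w + u) ⬝ᵥ x ω‖ ^ 2 - ‖star w ⬝ᵥ x ω‖ ^ 2 -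
        ‖star u ⬝ᵥ x ω‖ ^ 2) / 2) μ ∧
      ∫ ω, (‖star (w + u) ⬝ᵥ x ω‖ ^ 2 - ‖star w ⬝ᵥ x ω‖ ^ 2 - ‖star u ⬝ᵥ x ω‖ ^ 2) / 2 ∂μ =
        (T * ((star w ⬝ᵥ (Γ *ᵥ u)).re + (star u ⬝ᵥ (Γ *ᵥ w)).re) +
          σ ^ 2 * ((star w ⬝ᵥ u).re + (star u ⬝ᵥ w).re)) / 2 := by
    intro u
    have h1 : Integrable (fun ω => ‖star (w + u) ⬝ᵥ x ω‖ ^ 2 - ‖star w ⬝ᵥ x ω‖ ^ 2) μ :=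
      (hN _).1.sub (hN _).1
    refine ⟨(h1.sub (hN u).1).div_const 2, ?_⟩
    rw [integral_div, integral_sub h1 (hN u).1, integral_sub (hN _).1 (hN _).1, (hN _).2, (hN _).2,
      (hN _).2]
    simp only [star_add, mulVec_add, add_dotProduct, dotProduct_add, Complex.add_re]
    ring
  have hpt : ∀ ω, (star w ⬝ᵥ x ω) * star (star w' ⬝ᵥ x ω) =
      (((‖star (w + w') ⬝ᵥ x ω‖ ^ 2 - ‖star w ⬝ᵥ x ω‖ ^ 2 - ‖star w' ⬝ᵥ x ω‖ ^ 2) / 2 : ℝ) : ℂ) +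
      (((‖star (w + (-Complex.I) • w') ⬝ᵥ x ω‖ ^ 2 - ‖star w ⬝ᵥ x ω‖ ^ 2 -
        ‖star ((-Complex.I) • w') ⬝ᵥ x ω‖ ^ 2) / 2 : ℝ) : ℂ) * Complex.I := by
    intro ω
    simp only [star_add, star_smul, add_dotProduct, smul_dotProduct,
      ← Complex.normSq_eq_norm_sq, Complex.normSq_apply]
    apply Complex.ext
    · simp; ring
    · simp; ring
  have i1 := (hpol w').1.ofReal (𝕜 := ℂ)
  have i2 := ((hpol ((-Complex.I) • w')).1.ofReal (𝕜 := ℂ)).mul_const Complex.I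
  simp_rw [hpt]
  refine ⟨i1.add i2, ?_⟩
  have hadd := integral_add i1 i2
  rw [integral_mul_const] at hadd
  refine hadd.trans ?_
  have r1 := integral_ofReal (𝕜 := ℂ) (μ := μ) (f := fun ω => (‖star (w + w') ⬝ᵥ x ω‖ ^ 2 -
    ‖star w ⬝ᵥ x ω‖ ^ 2 - ‖star w' ⬝ᵥ x ω‖ ^ 2) / 2)
  have r2 := integral_ofReal (𝕜 := ℂ) (μ := μ) (f := fun ω =>
    (‖star (w + (-Complex.I) • w') ⬝ᵥ x ω‖ ^ 2 - ‖star w ⬝ᵥ x ω‖ ^ 2 -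
        ‖star ((-Complex.I) • w') ⬝ᵥ x ω‖ ^ 2) / 2)
  have r1' := r1.trans (congrArg _ (hpol w').2)
  have r2' := r2.trans (congrArg _ (hpol ((-Complex.I) • w')).2)
  refine (congrArg₂ (· + ·) r1' (congrArg (· * Complex.I) r2')).trans ?_
  have hw : star w' ⬝ᵥ w = star (star w ⬝ᵥ w') := star_dotProduct w' w
  simp only [mulVec_smul, star_smul, smul_dotProduct, dotProduct_smul, hherm, hw]
  apply Complex.ext
  · simp [pow_two]; ring
  · simp [pow_two]; ring

end Interference

/-! ### Perturbation of leading eigenspaces -/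

section Perturbation

/-- The squared Euclidean norm of a coordinate vector. -/
noncomputable def nsq {q : ℕ} (x : Fin q → ℂ) : ℝ := ∑ i, ‖x i‖ ^ 2

variable {q : ℕ}

lemma nsq_nonneg (x : Fin q → ℂ) : 0 ≤ nsq x := Finset.sum_nonneg fun _ _ => sq_nonneg _

lemma ofReal_nsq (x : Fin q → ℂ) : ((nsq x : ℝ) : ℂ) = star x ⬝ᵥ x := by
  simp only [nsq, dotProduct, Complex.ofReal_sum]
  refine Finset.sum_congr rfl fun i _ => ?_
  rw [Pi.star_apply, ← Complex.normSq_eq_norm_sq, Complex.normSq_eq_conj_mul_self]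
  rfl

lemma nsq_conjTranspose_mulVec {O : Matrix (Fin q) (Fin q) ℂ}
    (hO : O ∈ unitaryGroup (Fin q) ℂ) (c : Fin q → ℂ) : nsq (Oᴴ *ᵥ c) = nsq c := by
  have h := mem_unitaryGroup_iff.1 hO
  rw [star_eq_conjTranspose] at h
  have : ((nsq (Oᴴ *ᵥ c) : ℝ) : ℂ) = (nsq c : ℝ) := by
    rw [ofReal_nsq, ofReal_nsq, star_mulVec, conjTranspose_conjTranspose, ← dotProduct_mulVec,
      mulVec_mulVec, h, one_mulVec]
  exact_mod_cast this

lemma conjTranspose_mem_unitaryGroup {O : Matrix (Fin q) (Fin q) ℂ}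
    (hO : O ∈ unitaryGroup (Fin q) ℂ) : Oᴴ ∈ unitaryGroup (Fin q) ℂ := by
  rw [← star_eq_conjTranspose]
  exact Unitary.star_mem hO

lemma nsq_mulVec {O : Matrix (Fin q) (Fin q) ℂ}
    (hO : O ∈ unitaryGroup (Fin q) ℂ) (c : Fin q → ℂ) : nsq (O *ᵥ c) = nsq c := by
  simpa using nsq_conjTranspose_mulVec (conjTranspose_mem_unitaryGroup hO) c

lemma quadForm_diagonal (s : Fin q → ℝ) (c : Fin q → ℂ) :
    quadForm (diagonal fun i => (s i : ℂ)) c = ∑ i, s i * ‖c i‖ ^ 2 := by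
  simp only [quadForm, dotProduct, mulVec_diagonal, Complex.re_sum]
  refine Finset.sum_congr rfl fun i _ => ?_
  rw [← Complex.normSq_eq_norm_sq, Complex.normSq_apply]
  simp
  ring

lemma quadForm_eq_of_isEigendecomposition {R O : Matrix (Fin q) (Fin q) ℂ} {s : Fin q → ℝ}
    (h : IsEigendecomposition R O s) (c : Fin q → ℂ) :
    quadForm R c = ∑ i, s i * ‖(Oᴴ *ᵥ c) i‖ ^ 2 := by
  rw [← quadForm_diagonal, h.2.2]
  simp only [quadForm, star_mulVec, conjTranspose_conjTranspose, ← dotProduct_mulVec, mulVec_mulVec,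
    Matrix.mul_assoc]

/-- One half of the Courant–Fischer principle: if the quadratic form of `R` is at least `t` on
the first `j + 1` coordinates, then so is the `j`-th eigenvalue. -/
lemma le_eigenvalue {R O : Matrix (Fin q) (Fin q) ℂ} {s : Fin q → ℝ}
    (h : IsEigendecomposition R O s) (j : Fin q) {t : ℝ}
    (ht : ∀ c : Fin q → ℂ, (∀ i, j < i → c i = 0) → t * nsq c ≤ quadForm R c) : t ≤ s j := by
  -- a nonzero vector in the coordinate subspace, orthogonal to the first `j` eigenvectors:
  -- it lies in the kernel of a matrix whose `j`-th row vanishes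
  obtain ⟨c, hc0, hc⟩ := (Matrix.exists_mulVec_eq_zero_iff (M := Matrix.of fun i k =>
    if i < j then Oᴴ i k else if i = j then 0 else (1 : Matrix (Fin q) (Fin q) ℂ) i k)).2
    (Matrix.det_eq_zero_of_row_eq_zero j (by simp))
  have h1 : ∀ i, j < i → c i = 0 := by
    intro i hi
    have := congrFun hc i
    simpa [mulVec, dotProduct, hi.not_gt, hi.ne', Matrix.one_apply] using this
  have h2 : ∀ i, i < j → (Oᴴ *ᵥ c) i = 0 := by
    intro i hi
    have := congrFun hc i
    simpa [mulVec, dotProduct, hi] using this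
  have h3 := ht c h1
  rw [quadForm_eq_of_isEigendecomposition h] at h3
  have h4 : ∑ i, s i * ‖(Oᴴ *ᵥ c) i‖ ^ 2 ≤ s j * nsq c := by
    rw [← nsq_conjTranspose_mulVec h.1 c, nsq, Finset.mul_sum]
    refine Finset.sum_le_sum fun i _ => ?_
    rcases lt_or_ge i j with hi | hi
    · simp [h2 i hi]
    · exact mul_le_mul_of_nonneg_right (h.2.1 hi) (sq_nonneg _)
  have h5 : 0 < nsq c := by
    obtain ⟨i, hi⟩ := Function.ne_iff.1 hc0
    exact Finset.sum_pos' (fun _ _ => sq_nonneg _)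
      ⟨i, Finset.mem_univ i, by have := norm_pos_iff.2 hi; positivity⟩
  exact le_of_mul_le_mul_right (h3.trans h4) h5

lemma sum_norm_sq_le (c : Fin q → ℂ) : (∑ i, ‖c i‖) ^ 2 ≤ q * nsq c := by
  simpa [nsq] using sq_sum_le_card_mul_sum_sq (s := Finset.univ) (f := fun i => ‖c i‖)

lemma abs_quadForm_sub_le {R M : Matrix (Fin q) (Fin q) ℂ} {δ : ℝ}
    (h : ∀ i j, ‖R i j - M i j‖ ≤ δ) (hδ : 0 ≤ δ) (c : Fin q → ℂ) :
    |quadForm R c - quadForm M c| ≤ q * δ * nsq c := by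
  have e : quadForm R c - quadForm M c =
      (∑ i, star (c i) * ∑ j, (R i j - M i j) * c j).re := by
    simp only [quadForm, dotProduct, mulVec, ← Complex.sub_re, ← Finset.sum_sub_distrib, ← mul_sub,
      ← sub_mul, Pi.star_apply]
  rw [e]
  calc _ ≤ ‖∑ i, star (c i) * ∑ j, (R i j - M i j) * c j‖ := Complex.abs_re_le_norm _
    _ ≤ ∑ i, ‖c i‖ * ∑ j, δ * ‖c j‖ := by
        refine (norm_sum_le _ _).trans (Finset.sum_le_sum fun i _ => ?_)
        rw [norm_mul, norm_star]
        refine mul_le_mul_of_nonneg_left ?_ (norm_nonneg _)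
        refine (norm_sum_le _ _).trans (Finset.sum_le_sum fun j _ => ?_)
        rw [norm_mul]
        exact mul_le_mul_of_nonneg_right (h i j) (norm_nonneg _)
    _ = δ * (∑ i, ‖c i‖) ^ 2 := by
        rw [← Finset.sum_mul, ← Finset.mul_sum]; ring
    _ ≤ q * δ * nsq c := by
        have := mul_le_mul_of_nonneg_left (sum_norm_sq_le c) hδ
        linarith

lemma isEigendecomposition_diagonal_conj {O : Matrix (Fin q) (Fin q) ℂ}
    (hO : O ∈ unitaryGroup (Fin q) ℂ) {s : Fin q → ℝ} (hs : Antitone s) :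
    IsEigendecomposition (Oᴴ * diagonal (fun i => (s i : ℂ)) * O) Oᴴ s :=
  ⟨conjTranspose_mem_unitaryGroup hO, hs, by rw [conjTranspose_conjTranspose]⟩

lemma conjTranspose_mul_self_of_mem {O : Matrix (Fin q) (Fin q) ℂ}
    (hO : O ∈ unitaryGroup (Fin q) ℂ) : Oᴴ * O = 1 := by
  have := mem_unitaryGroup_iff'.1 hO
  rwa [star_eq_conjTranspose] at this

lemma self_mul_conjTranspose_of_mem {O : Matrix (Fin q) (Fin q) ℂ}
    (hO : O ∈ unitaryGroup (Fin q) ℂ) : O * Oᴴ = 1 := by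
  have := mem_unitaryGroup_iff.1 hO
  rwa [star_eq_conjTranspose] at this

/-- Weyl's inequality for a perturbation of a diagonal matrix. -/
lemma abs_eigenvalue_sub_le {R O : Matrix (Fin q) (Fin q) ℂ} {s μ : Fin q → ℝ}
    (h : IsEigendecomposition R O s) (hμ : Antitone μ) {δ : ℝ} (hδ : 0 ≤ δ)
    (hR : ∀ i j, ‖R i j - diagonal (fun i => (μ i : ℂ)) i j‖ ≤ δ) (j : Fin q) :
    |s j - μ j| ≤ q * δ := by
  have hq := fun c => abs_le.1 (abs_quadForm_sub_le hR hδ c)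
  have hmono : ∀ (a : Fin q → ℝ), Antitone a → ∀ c : Fin q → ℂ, (∀ i, j < i → c i = 0) →
      a j * nsq c ≤ ∑ i, a i * ‖c i‖ ^ 2 := by
    intro a ha c hc
    rw [nsq, Finset.mul_sum]
    refine Finset.sum_le_sum fun i _ => ?_
    rcases le_or_gt i j with hi | hi
    · exact mul_le_mul_of_nonneg_right (ha hi) (sq_nonneg _)
    · simp [hc i hi]
  rw [abs_le]
  constructor
  · have := le_eigenvalue h j (t := μ j - q * δ) fun c hc => by
      have h1 := (hq c).1
      rw [quadForm_diagonal] at h1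
      have h2 := hmono μ hμ c hc
      linarith
    linarith
  · have := le_eigenvalue (isEigendecomposition_diagonal_conj h.1 hμ) j (t := s j - q * δ)
      fun c hc => by
        have h1 := (hq (O *ᵥ c)).2
        rw [nsq_mulVec h.1, quadForm_eq_of_isEigendecomposition h, mulVec_mulVec,
          conjTranspose_mul_self_of_mem h.1, one_mulVec] at h1
        have h2 := hmono s h.2.1 c hc
        have h3 : quadForm (Oᴴ * diagonal (fun i => (μ i : ℂ)) * O) c =
            quadForm (diagonal fun i => (μ i : ℂ)) (O *ᵥ c) := by
          simp only [quadForm, star_mulVec, ← dotProduct_mulVec, mulVec_mulVec, Matrix.mul_assoc]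
        rw [h3]
        linarith
    linarith

/-- The projection of `e` onto the span of the first `r` columns of `O`. -/
noncomputable def leadProj (r : ℕ) (O : Matrix (Fin q) (Fin q) ℂ) (e : Fin q → ℂ) : Fin q → ℂ :=
  O *ᵥ fun j => if (j : ℕ) < r then (Oᴴ *ᵥ e) j else 0

lemma nsq_leadProj {O : Matrix (Fin q) (Fin q) ℂ} (hO : O ∈ unitaryGroup (Fin q) ℂ) (r : ℕ)
    (e : Fin q → ℂ) :
    nsq (leadProj r O e) = ∑ j : Fin q, if (j : ℕ) < r then ‖(Oᴴ *ᵥ e) j‖ ^ 2 else 0 := by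
  rw [leadProj, nsq_mulVec hO, nsq]
  refine Finset.sum_congr rfl fun j _ => ?_
  split_ifs <;> simp

lemma nsq_leadProj_le {O : Matrix (Fin q) (Fin q) ℂ} (hO : O ∈ unitaryGroup (Fin q) ℂ) (r : ℕ)
    (e : Fin q → ℂ) : nsq (leadProj r O e) ≤ nsq e := by
  rw [nsq_leadProj hO, ← nsq_conjTranspose_mulVec hO e, nsq]
  refine Finset.sum_le_sum fun j _ => ?_
  split_ifs
  · exact le_rfl
  · positivity

/-- The eigenvector equation tested against `e`. -/
lemma sub_mul_conjTranspose_mulVec {R O : Matrix (Fin q) (Fin q) ℂ} {s : Fin q → ℝ}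
    (h : IsEigendecomposition R O s) (e : Fin q → ℂ) (σ2 : ℝ) (j : Fin q) :
    ((s j - σ2 : ℝ) : ℂ) * (Oᴴ *ᵥ e) j = (Oᴴ *ᵥ (R *ᵥ e - (σ2 : ℂ) • e)) j := by
  have h1 : Oᴴ *ᵥ (R *ᵥ e) = diagonal (fun i => (s i : ℂ)) *ᵥ (Oᴴ *ᵥ e) := by
    rw [h.2.2]
    simp only [mulVec_mulVec, ← Matrix.mul_assoc, conjTranspose_mul_self_of_mem h.1,
      Matrix.one_mul]
  rw [mulVec_sub, h1, mulVec_smul, Pi.sub_apply, mulVec_diagonal, Pi.smul_apply, smul_eq_mul]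
  push_cast
  ring

/-- If the leading eigenvalues stay away from `σ2`, then the leakage of `e` into the leading
eigenspace is controlled by the residual `R e - σ2 e`. -/
lemma nsq_leadProj_le_residual {R O : Matrix (Fin q) (Fin q) ℂ} {s : Fin q → ℝ}
    (h : IsEigendecomposition R O s) (e : Fin q → ℂ) {σ2 γ : ℝ} (hγ : 0 < γ) {r : ℕ}
    (hs : ∀ j : Fin q, (j : ℕ) < r → σ2 + γ ≤ s j) :
    nsq (leadProj r O e) ≤ nsq (R *ᵥ e - (σ2 : ℂ) • e) / γ ^ 2 := by
  rw [nsq_leadProj h.1, le_div_iff₀ (by positivity), Finset.sum_mul,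
    ← nsq_conjTranspose_mulVec h.1 (R *ᵥ e - (σ2 : ℂ) • e), nsq]
  refine Finset.sum_le_sum fun j _ => ?_
  split_ifs with hj
  · rw [← sub_mul_conjTranspose_mulVec h, norm_mul, mul_pow, mul_comm, Complex.norm_real,
      Real.norm_eq_abs, sq_abs]
    have := hs j hj
    gcongr
    linarith
  · simp only [zero_mul]; positivity

/-- The entries of the overlap of the eigenbasis of `R` with the coordinate basis. -/
lemma abs_sub_mul_norm_le {R O : Matrix (Fin q) (Fin q) ℂ} {s μ : Fin q → ℝ}
    (h : IsEigendecomposition R O s) {δ : ℝ} (hδ : 0 ≤ δ)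
    (hR : ∀ i j, ‖R i j - diagonal (fun i => (μ i : ℂ)) i j‖ ≤ δ) (i j : Fin q) :
    |s j - μ i| * ‖O i j‖ ≤ q * δ := by
  have h1 : R * O = O * diagonal (fun i => (s i : ℂ)) := by
    rw [h.2.2, Matrix.mul_assoc, conjTranspose_mul_self_of_mem h.1, Matrix.mul_one]
  have h2 : ((s j - μ i : ℝ) : ℂ) * O i j =
      ∑ k, (R i k - diagonal (fun i => (μ i : ℂ)) i k) * O k j := by
    have h3 := congrFun (congrFun h1 i) j
    rw [mul_diagonal, Matrix.mul_apply] at h3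
    simp only [sub_mul, Finset.sum_sub_distrib]
    rw [h3, ← Matrix.mul_apply, diagonal_mul]
    push_cast; ring
  rw [← Real.norm_eq_abs, ← Complex.norm_real, ← norm_mul, h2]
  refine (norm_sum_le _ _).trans ((Finset.sum_le_sum (g := fun _ => δ) fun k _ => ?_).trans ?_)
  · rw [norm_mul]
    have := entry_norm_bound_of_unitary h.1 k j
    calc _ ≤ δ * 1 := mul_le_mul (hR i k) this (norm_nonneg _) hδ
      _ = δ := mul_one _
  · simp

/-- The first-order approximation of `leadProj r O e`, in terms of the residual `ζ = R e - σ2 e` and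
of the unperturbed eigenvalues. -/
noncomputable def leadApprox (r : ℕ) (μ : Fin q → ℝ) (σ2 : ℝ) (ζ : Fin q → ℂ) : Fin q → ℂ :=
  fun i => if (i : ℕ) < r then ζ i / ((μ i - σ2 : ℝ) : ℂ) else 0

/-- The relative error of the first-order approximation is of the order of the perturbation. -/
lemma nsq_leadProj_sub_le {R O : Matrix (Fin q) (Fin q) ℂ} {s μ : Fin q → ℝ}
    (h : IsEigendecomposition R O s) (hμ : Antitone μ) {δ : ℝ} (hδ : 0 ≤ δ)
    (hR : ∀ i j, ‖R i j - diagonal (fun i => (μ i : ℂ)) i j‖ ≤ δ) {σ2 g : ℝ} (hg : 0 < g) {r : ℕ}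
    (hσ : ∀ i : Fin q, (i : ℕ) < r → g ≤ μ i - σ2)
    (hgap : ∀ i j : Fin q, (i : ℕ) < r → r ≤ (j : ℕ) → g ≤ μ i - μ j) (hδg : q * δ ≤ g / 2)
    (e : Fin q → ℂ) :
    nsq (leadProj r O e - leadApprox r μ σ2 (R *ᵥ e - (σ2 : ℂ) • e)) ≤
      16 * q ^ 4 * δ ^ 2 / g ^ 4 * nsq (R *ᵥ e - (σ2 : ℂ) • e) := by
  set ζ := R *ᵥ e - (σ2 : ℂ) • e with hζ
  set c := Oᴴ *ᵥ ζ with hc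
  set Λ : Fin q → ℝ := fun j => if (j : ℕ) < r then (s j - σ2)⁻¹ else 0 with hΛ
  set Λ₀ : Fin q → ℝ := fun i => if (i : ℕ) < r then (μ i - σ2)⁻¹ else 0 with hΛ₀
  have hw := fun j => abs_le.1 (abs_eigenvalue_sub_le h hμ hδ hR j)
  have hov := fun i j => abs_sub_mul_norm_le h hδ hR i j
  have hsj : ∀ j : Fin q, (j : ℕ) < r → g / 2 ≤ s j - σ2 := fun j hj => by
    linarith [(hw j).1, hσ j hj]
  have hqδ : 0 ≤ q * δ := by positivity
  have hentry : ∀ i j, ‖O i j‖ * |Λ j - Λ₀ i| ≤ 4 * (q * δ) / g ^ 2 := by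
    intro i j
    simp only [hΛ, hΛ₀]
    have hO := hov i j
    have hO0 := norm_nonneg (O i j)
    by_cases hj : (j : ℕ) < r <;> by_cases hi : (i : ℕ) < r
    · rw [if_pos hj, if_pos hi]
      have a1 := hsj j hj
      have a2 := hσ i hi
      have a3 : 0 < s j - σ2 := by linarith
      have a4 : 0 < μ i - σ2 := by linarith
      rw [inv_sub_inv a3.ne' a4.ne', abs_div, abs_of_pos (mul_pos a3 a4),
        show μ i - σ2 - (s j - σ2) = -(s j - μ i) by ring, abs_neg, ← mul_div_assoc,
        div_le_div_iff₀ (by positivity) (by positivity)]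
      have a5 : g / 2 * g ≤ (s j - σ2) * (μ i - σ2) := mul_le_mul a1 a2 hg.le a3.le
      calc ‖O i j‖ * |s j - μ i| * g ^ 2 ≤ (q * δ) * g ^ 2 := by
            rw [mul_comm ‖O i j‖]; gcongr
        _ ≤ 4 * (q * δ) * (g / 2 * g) := by nlinarith [mul_nonneg hqδ (sq_nonneg g)]
        _ ≤ _ := by gcongr
    · -- `j` leading, `i` trailing
      rw [if_pos hj, if_neg hi, sub_zero]
      have a1 := hsj j hj
      have a2 := hgap j i hj (not_lt.1 hi)
      have a3 : g / 2 ≤ |s j - μ i| := by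
        rw [abs_of_nonneg] <;> linarith [(hw j).1]
      have a4 : ‖O i j‖ * (g / 2) ≤ q * δ := by
        rw [mul_comm]; exact (mul_le_mul_of_nonneg_right a3 hO0).trans hO
      rw [abs_of_pos (inv_pos.2 (by linarith))]
      calc ‖O i j‖ * (s j - σ2)⁻¹ ≤ ‖O i j‖ * (g / 2)⁻¹ := by gcongr
        _ = (‖O i j‖ * (g / 2)) * (4 / g ^ 2) := by field_simp; ring
        _ ≤ q * δ * (4 / g ^ 2) := by gcongr
        _ = _ := by ring
    · -- `i` leading, `j` trailing
      rw [if_neg hj, if_pos hi, zero_sub, abs_neg]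
      have a1 := hσ i hi
      have a2 := hgap i j hi (not_lt.1 hj)
      have a3 : g / 2 ≤ |s j - μ i| := by
        rw [abs_of_nonpos] <;> linarith [(hw j).2]
      have a4 : ‖O i j‖ * (g / 2) ≤ q * δ := by
        rw [mul_comm]; exact (mul_le_mul_of_nonneg_right a3 hO0).trans hO
      rw [abs_of_pos (inv_pos.2 (by linarith))]
      calc ‖O i j‖ * (μ i - σ2)⁻¹ ≤ ‖O i j‖ * (g / 2)⁻¹ := by gcongr; linarith
        _ = (‖O i j‖ * (g / 2)) * (4 / g ^ 2) := by field_simp; ring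
        _ ≤ q * δ * (4 / g ^ 2) := by gcongr
        _ = _ := by ring
    · rw [if_neg hj, if_neg hi]
      simp; positivity
  have hx : ∀ i, leadProj r O e i = ∑ j, O i j * (Λ j * c j) := by
    intro i
    simp only [leadProj, mulVec, dotProduct]
    refine Finset.sum_congr rfl fun j _ => ?_
    congr 1
    simp only [hΛ]
    split_ifs with hj
    · have := sub_mul_conjTranspose_mulVec h e σ2 j
      have h0 : ((s j - σ2 : ℝ) : ℂ) ≠ 0 := by
        have := hsj j hj
        exact_mod_cast (by linarith : 0 < s j - σ2).ne'
      rw [hc, hζ, ← this, Complex.ofReal_inv, inv_mul_cancel_left₀ h0]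
      rfl
    · simp
  have hx0 : ∀ i : Fin q, leadApprox r μ σ2 ζ i =
      ∑ j, O i j * (Λ₀ i * c j) := by
    intro i
    have : ζ i = ∑ j, O i j * c j := by
      have : O *ᵥ c = ζ := by
        rw [hc, mulVec_mulVec, self_mul_conjTranspose_of_mem h.1, one_mulVec]
      rw [← this]; rfl
    simp only [hΛ₀, leadApprox]
    split_ifs with hi
    · rw [this, div_eq_inv_mul, Finset.mul_sum]
      refine Finset.sum_congr rfl fun j _ => ?_
      push_cast; ring
    · simp
  have hbound : ∀ i, ‖(leadProj r O e - leadApprox r μ σ2 ζ) i‖ ^ 2 ≤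
      (4 * (q * δ) / g ^ 2) ^ 2 * (q * nsq ζ) := by
    intro i
    have e1 : ‖(leadProj r O e - leadApprox r μ σ2 ζ) i‖ ≤
        4 * (q * δ) / g ^ 2 * ∑ j, ‖c j‖ := by
      rw [Pi.sub_apply, hx, hx0, ← Finset.sum_sub_distrib, Finset.mul_sum]
      refine (norm_sum_le _ _).trans (Finset.sum_le_sum fun j _ => ?_)
      have : O i j * (Λ j * c j) - O i j * (Λ₀ i * c j) =
          O i j * ((Λ j - Λ₀ i : ℝ) : ℂ) * c j := by push_cast; ring
      rw [this, norm_mul, norm_mul, Complex.norm_real, Real.norm_eq_abs]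
      exact mul_le_mul_of_nonneg_right (hentry i j) (norm_nonneg _)
    calc _ ≤ (4 * (q * δ) / g ^ 2 * ∑ j, ‖c j‖) ^ 2 := pow_le_pow_left₀ (norm_nonneg _) e1 2
      _ = (4 * (q * δ) / g ^ 2) ^ 2 * (∑ j, ‖c j‖) ^ 2 := by ring
      _ ≤ _ := by
        refine mul_le_mul_of_nonneg_left ?_ (sq_nonneg _)
        rw [← nsq_conjTranspose_mulVec h.1 ζ]
        exact sum_norm_sq_le c
  refine (Finset.sum_le_sum fun i _ => hbound i).trans (le_of_eq ?_)
  rw [Finset.sum_const, Finset.card_univ, Fintype.card_fin, nsmul_eq_mul]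
  field_simp
  ring

end Perturbation

/-! ### The loss as a function of the leakage -/

section Loss

/-- The SINR loss as a function of the leakage `x` of the target into the removed subspace: `s` are
the clutter powers in the coordinates of `x`, weighted by `b`, and `σ2` is the noise power. -/
noncomputable def leakLoss {q : ℕ} (s : Fin q → ℝ) (b σ2 : ℝ) (x : Fin q → ℂ) : ℝ :=
  σ2 * (1 - nsq x) ^ 2 / (b * ∑ i, s i * ‖x i‖ ^ 2 + σ2 * (1 - nsq x))

/-- The leading part of `1 - leakLoss s b σ2 x` for small `x`. -/
noncomputable def leakQuad {q : ℕ} (s : Fin q → ℝ) (b σ2 : ℝ) (x : Fin q → ℂ) : ℝ :=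
  ∑ i, (1 + b / σ2 * s i) * ‖x i‖ ^ 2

variable {q : ℕ} {s : Fin q → ℝ} {b σ2 : ℝ}

lemma leakQuad_eq (x : Fin q → ℂ) :
    leakQuad s b σ2 x = nsq x + b / σ2 * ∑ i, s i * ‖x i‖ ^ 2 := by
  simp only [leakQuad, nsq, Finset.mul_sum, ← Finset.sum_add_distrib]
  exact Finset.sum_congr rfl fun i _ => by ring

lemma sum_mul_norm_sq_nonneg (hs : ∀ i, 0 ≤ s i) (x : Fin q → ℂ) :
    0 ≤ ∑ i, s i * ‖x i‖ ^ 2 :=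
  Finset.sum_nonneg fun i _ => mul_nonneg (hs i) (sq_nonneg _)

lemma one_sub_leakLoss (hs : ∀ i, 0 ≤ s i) (hb : 0 ≤ b) (hσ : 0 < σ2) {x : Fin q → ℂ}
    (hx : nsq x ≤ 1) : 1 - leakLoss s b σ2 x = leakQuad s b σ2 x -
      (b * ∑ i, s i * ‖x i‖ ^ 2) ^ 2 /
        (σ2 * (b * ∑ i, s i * ‖x i‖ ^ 2 + σ2 * (1 - nsq x))) := by
  rw [leakQuad_eq, leakLoss]
  set Q := ∑ i, s i * ‖x i‖ ^ 2 with hQ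
  have hQ0 : 0 ≤ b * Q := mul_nonneg hb (sum_mul_norm_sq_nonneg hs x)
  have h1 : 0 ≤ σ2 * (1 - nsq x) := mul_nonneg hσ.le (by linarith)
  rcases eq_or_ne (b * Q + σ2 * (1 - nsq x)) 0 with h0 | h0
  · have h2 : b * Q = 0 := by linarith
    have h3 : σ2 * (1 - nsq x) = 0 := by linarith
    have h4 : nsq x = 1 := by
      rcases mul_eq_zero.1 h3 with h | h <;> linarith
    have h5 : b / σ2 * Q = 0 := by rw [div_mul_eq_mul_div, h2, zero_div]
    rw [h0, h5, h4]; simp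
  · field_simp
    ring

lemma leakQuad_nonneg (hs : ∀ i, 0 ≤ s i) (hb : 0 ≤ b) (hσ : 0 < σ2) (x : Fin q → ℂ) :
    0 ≤ leakQuad s b σ2 x :=
  Finset.sum_nonneg fun i _ =>
    mul_nonneg (add_nonneg zero_le_one (mul_nonneg (div_nonneg hb hσ.le) (hs i))) (sq_nonneg _)

lemma leakLoss_nonneg (hs : ∀ i, 0 ≤ s i) (hb : 0 ≤ b) (hσ : 0 < σ2) {x : Fin q → ℂ}
    (hx : nsq x ≤ 1) : 0 ≤ leakLoss s b σ2 x :=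
  div_nonneg (mul_nonneg hσ.le (sq_nonneg _)) (add_nonneg
    (mul_nonneg hb (sum_mul_norm_sq_nonneg hs x)) (mul_nonneg hσ.le (by linarith)))

lemma leakLoss_le_one (hs : ∀ i, 0 ≤ s i) (hb : 0 ≤ b) (hσ : 0 < σ2) {x : Fin q → ℂ}
    (hx : nsq x ≤ 1) : leakLoss s b σ2 x ≤ 1 := by
  have hQ := mul_nonneg hb (sum_mul_norm_sq_nonneg hs x)
  have h0 := nsq_nonneg x
  refine div_le_one_of_le₀ ?_ (add_nonneg hQ (mul_nonneg hσ.le (by linarith)))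
  have : (1 - nsq x) ^ 2 ≤ 1 - nsq x := by nlinarith
  nlinarith [mul_le_mul_of_nonneg_left this hσ.le]

lemma one_sub_leakLoss_le (hs : ∀ i, 0 ≤ s i) (hb : 0 ≤ b) (hσ : 0 < σ2) {x : Fin q → ℂ}
    (hx : nsq x ≤ 1) : 1 - leakLoss s b σ2 x ≤ leakQuad s b σ2 x := by
  rw [one_sub_leakLoss hs hb hσ hx]
  have : 0 ≤ (b * ∑ i, s i * ‖x i‖ ^ 2) ^ 2 /
        (σ2 * (b * ∑ i, s i * ‖x i‖ ^ 2 + σ2 * (1 - nsq x))) :=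
    div_nonneg (sq_nonneg _) (mul_nonneg hσ.le (add_nonneg
      (mul_nonneg hb (sum_mul_norm_sq_nonneg hs x)) (mul_nonneg hσ.le (by linarith))))
  linarith

lemma sum_mul_norm_sq_le {a : Fin q → ℝ} {S : ℝ} (hS : ∀ i, a i ≤ S) (x : Fin q → ℂ) :
    ∑ i, a i * ‖x i‖ ^ 2 ≤ S * nsq x := by
  rw [nsq, Finset.mul_sum]
  exact Finset.sum_le_sum fun i _ => mul_le_mul_of_nonneg_right (hS i) (sq_nonneg _)

/-- The weights of `leakQuad` are at most `1 + b S / σ2` if the clutter powers are at most `S`. -/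
lemma leakQuad_le (hb : 0 ≤ b) (hσ : 0 < σ2) {S : ℝ} (hS : ∀ i, s i ≤ S) (x : Fin q → ℂ) :
    leakQuad s b σ2 x ≤ (1 + b / σ2 * S) * nsq x :=
  sum_mul_norm_sq_le (fun i => by
    have : 0 ≤ b / σ2 := div_nonneg hb hσ.le
    have := mul_le_mul_of_nonneg_left (hS i) this
    linarith) x

lemma abs_leakQuad_sub_le (hs : ∀ i, 0 ≤ s i) (hb : 0 ≤ b) (hσ : 0 < σ2) {S : ℝ}
    (hS : ∀ i, s i ≤ S) {δ : ℝ} (hδ : 0 < δ) (x y : Fin q → ℂ) :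
    |leakQuad s b σ2 x - leakQuad s b σ2 y| ≤
      (1 + b / σ2 * S) * ((1 + 1 / δ) * nsq (x - y) + δ * nsq y) := by
  have hbσ : 0 ≤ b / σ2 := div_nonneg hb hσ.le
  rw [leakQuad, leakQuad, ← Finset.sum_sub_distrib]
  refine (Finset.abs_sum_le_sum_abs _ _).trans ?_
  have hterm : ∀ i, |(1 + b / σ2 * s i) * ‖x i‖ ^ 2 - (1 + b / σ2 * s i) * ‖y i‖ ^ 2| ≤
      (1 + b / σ2 * S) * ((1 + 1 / δ) * ‖(x - y) i‖ ^ 2 + δ * ‖y i‖ ^ 2) := by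
    intro i
    have h1 : 0 ≤ 1 + b / σ2 * s i := add_nonneg zero_le_one (mul_nonneg hbσ (hs i))
    have h2 : 1 + b / σ2 * s i ≤ 1 + b / σ2 * S := by
      have := mul_le_mul_of_nonneg_left (hS i) hbσ; linarith
    rw [← mul_sub, abs_mul, abs_of_nonneg h1]
    have hd : |‖x i‖ - ‖y i‖| ≤ ‖(x - y) i‖ := abs_norm_sub_norm_le _ _
    set d := ‖(x - y) i‖
    have hd0 : 0 ≤ d := norm_nonneg _
    have hy := norm_nonneg (y i)
    have hxn := norm_nonneg (x i)
    have h3 : |‖x i‖ ^ 2 - ‖y i‖ ^ 2| ≤ d ^ 2 + 2 * d * ‖y i‖ := by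
      have : ‖x i‖ ^ 2 - ‖y i‖ ^ 2 = (‖x i‖ - ‖y i‖) * (‖x i‖ + ‖y i‖) := by ring
      rw [this, abs_mul, abs_of_nonneg (by positivity : 0 ≤ ‖x i‖ + ‖y i‖)]
      have h4 : ‖x i‖ + ‖y i‖ ≤ d + 2 * ‖y i‖ := by linarith [(abs_le.1 hd).2]
      calc _ ≤ d * (d + 2 * ‖y i‖) := mul_le_mul hd h4 (by positivity) hd0
        _ = _ := by ring
    have h5 : 2 * d * ‖y i‖ ≤ 1 / δ * d ^ 2 + δ * ‖y i‖ ^ 2 := by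
      have : 1 / δ * d ^ 2 + δ * ‖y i‖ ^ 2 - 2 * d * ‖y i‖ = (d - δ * ‖y i‖) ^ 2 / δ := by
        field_simp; ring
      have h6 : 0 ≤ (d - δ * ‖y i‖) ^ 2 / δ := by positivity
      linarith
    refine mul_le_mul h2 ?_ (abs_nonneg _) (h1.trans h2)
    linarith
  refine (Finset.sum_le_sum fun i _ => hterm i).trans (le_of_eq ?_)
  simp only [nsq, Finset.mul_sum, ← Finset.sum_add_distrib]

/-- If the leading eigenvalues of `R` stay away from the noise level, then the loss is controlled by
the residual of `e`, however large the perturbation. -/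
lemma one_sub_leakLoss_leadProj_le (hs : ∀ i, 0 ≤ s i) (hb : 0 ≤ b) (hσ : 0 < σ2) {S : ℝ}
    (hS : ∀ i, s i ≤ S) {R O : Matrix (Fin q) (Fin q) ℂ} {l : Fin q → ℝ}
    (h : IsEigendecomposition R O l) {e : Fin q → ℂ} (he : nsq e = 1) {γ : ℝ} (hγ : 0 < γ)
    (hbS : 0 ≤ b / σ2 * S) {r : ℕ} (hl : ∀ j : Fin q, (j : ℕ) < r → σ2 + γ ≤ l j) :
    1 - leakLoss s b σ2 (leadProj r O e) ≤
      (1 + b / σ2 * S) / γ ^ 2 * nsq (R *ᵥ e - (σ2 : ℂ) • e) := by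
  refine (one_sub_leakLoss_le hs hb hσ ((nsq_leadProj_le h.1 r e).trans he.le)).trans ?_
  refine (leakQuad_le hb hσ hS _).trans ?_
  calc _ ≤ (1 + b / σ2 * S) * (nsq (R *ᵥ e - (σ2 : ℂ) • e) / γ ^ 2) :=
        mul_le_mul_of_nonneg_left (nsq_leadProj_le_residual h e hγ hl) (by linarith)
    _ = _ := by ring

lemma nsq_leadApprox_le {r : ℕ} {μ : Fin q → ℝ} {g : ℝ} (hg : 0 < g)
    (hσμ : ∀ i : Fin q, (i : ℕ) < r → g ≤ μ i - σ2) (ζ : Fin q → ℂ) :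
    nsq (leadApprox r μ σ2 ζ) ≤ nsq ζ / g ^ 2 := by
  rw [nsq, nsq, Finset.sum_div]
  refine Finset.sum_le_sum fun i _ => ?_
  simp only [leadApprox]
  split_ifs with hi
  · have := hσμ i hi
    rw [norm_div, div_pow, Complex.norm_real, Real.norm_eq_abs, sq_abs]
    gcongr
  · rw [norm_zero, zero_pow two_ne_zero]; positivity

/-- First-order expansion of the loss: for `R` close to the diagonal matrix of the `μ i`, the loss
is a quadratic form in the residual of `e`, up to a small relative error. -/
lemma exists_abs_one_sub_leakLoss_sub_le (hs : ∀ i, 0 ≤ s i) (hb : 0 ≤ b) (hσ : 0 < σ2)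
    {μ : Fin q → ℝ} (hμ : Antitone μ) {e : Fin q → ℂ} (he : nsq e = 1)
    (hμe : ∀ i, (μ i : ℂ) * e i = σ2 * e i) {r : ℕ} {g : ℝ} (hg : 0 < g)
    (hσμ : ∀ i : Fin q, (i : ℕ) < r → g ≤ μ i - σ2)
    (hgap : ∀ i j : Fin q, (i : ℕ) < r → r ≤ (j : ℕ) → g ≤ μ i - μ j)
    {η : ℝ} (hη : 0 < η) :
    ∃ δ > 0, ∀ (R O : Matrix (Fin q) (Fin q) ℂ) (l : Fin q → ℝ), IsEigendecomposition R O l →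
      (∀ i j, ‖R i j - diagonal (fun i => (μ i : ℂ)) i j‖ ≤ δ) →
      |1 - leakLoss s b σ2 (leadProj r O e) -
          leakQuad s b σ2 (leadApprox r μ σ2 (R *ᵥ e - (σ2 : ℂ) • e))| ≤
        η * nsq (R *ᵥ e - (σ2 : ℂ) • e) := by
  obtain ⟨S, hS, hS0⟩ : ∃ S : ℝ, (∀ i, s i ≤ S) ∧ 0 ≤ S :=
    ⟨∑ i, s i, fun i => Finset.single_le_sum (fun j _ => hs j) (Finset.mem_univ i),
      Finset.sum_nonneg fun i _ => hs i⟩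
  set P := 1 + b / σ2 * S with hP
  have hP0 : 0 < P := by have := mul_nonneg (div_nonneg hb hσ.le) hS0; linarith
  set C := 16 * (q : ℝ) ^ 4 / g ^ 4 with hC
  have hC0 : 0 ≤ C := by positivity
  set K₁ := 4 * (q : ℝ) ^ 3 / g ^ 2 with hK₁
  have hK₁0 : 0 ≤ K₁ := by positivity
  set K := P * (2 * C + 1 / g ^ 2) + 2 * (b * S) ^ 2 / σ2 ^ 2 * (K₁ * (4 / g ^ 2)) with hK
  have hK0 : 0 ≤ K := by positivity
  -- `δ` small enough for Weyl's inequality, for a leakage at most `1/2`, and for the final error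
  obtain ⟨δ, hδ, hδ1, hδg, hδK₁, hδη⟩ : ∃ δ : ℝ, 0 < δ ∧ δ ≤ 1 ∧ q * δ ≤ g / 2 ∧
      K₁ * δ ≤ 1 / 2 ∧ K * δ ≤ η := by
    refine ⟨min (min 1 (g / 2 / (q + 1))) (min (1 / 2 / (K₁ + 1)) (η / (K + 1))),
      by positivity, (min_le_left _ _).trans (min_le_left _ _), ?_, ?_, ?_⟩
    · have h1 : min (min 1 (g / 2 / (q + 1))) (min (1 / 2 / (K₁ + 1)) (η / (K + 1))) ≤
          g / 2 / (q + 1) := (min_le_left _ _).trans (min_le_right _ _)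
      calc (q : ℝ) * _ ≤ q * (g / 2 / (q + 1)) := by gcongr
        _ ≤ g / 2 := by rw [mul_div_assoc', div_le_iff₀ (by positivity)]; nlinarith
    · have h1 : min (min 1 (g / 2 / (q + 1))) (min (1 / 2 / (K₁ + 1)) (η / (K + 1))) ≤
          1 / 2 / (K₁ + 1) := (min_le_right _ _).trans (min_le_left _ _)
      calc K₁ * _ ≤ K₁ * (1 / 2 / (K₁ + 1)) := by gcongr
        _ ≤ 1 / 2 := by rw [mul_div_assoc', div_le_iff₀ (by positivity)]; nlinarith
    · have h1 : min (min 1 (g / 2 / (q + 1))) (min (1 / 2 / (K₁ + 1)) (η / (K + 1))) ≤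
          η / (K + 1) := (min_le_right _ _).trans (min_le_right _ _)
      calc K * _ ≤ K * (η / (K + 1)) := by gcongr
        _ ≤ η := by rw [mul_div_assoc', div_le_iff₀ (by positivity)]; nlinarith
  refine ⟨δ, hδ, fun R O l h hR => ?_⟩
  set ζ := R *ᵥ e - (σ2 : ℂ) • e with hζ
  set x := leadProj r O e with hx
  set y := leadApprox r μ σ2 ζ with hy
  have hxy : nsq (x - y) ≤ C * δ ^ 2 * nsq ζ := by
    refine (nsq_leadProj_sub_le h hμ hδ.le hR hg hσμ hgap hδg e).trans (le_of_eq ?_)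
    simp only [hC]; ring
  have hyn : nsq y ≤ nsq ζ / g ^ 2 := nsq_leadApprox_le hg hσμ ζ
  have hx1 : nsq x ≤ 1 := (nsq_leadProj_le h.1 r e).trans he.le
  have hx2 : nsq x ≤ 4 / g ^ 2 * nsq ζ := by
    have hw := fun j => abs_le.1 (abs_eigenvalue_sub_le h hμ hδ.le hR j)
    have := nsq_leadProj_le_residual h e (σ2 := σ2) (half_pos hg) (r := r) fun j hj => by
      linarith [(hw j).1, hσμ j hj]
    refine this.trans (le_of_eq ?_)
    rw [← hζ]; field_simp; norm_num
  have he1 : ∀ j, ‖e j‖ ≤ 1 := by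
    intro j
    have : ‖e j‖ ^ 2 ≤ nsq e :=
      Finset.single_le_sum (f := fun i => ‖e i‖ ^ 2) (fun i _ => sq_nonneg _) (Finset.mem_univ j)
    rw [he] at this
    exact (sq_le_one_iff₀ (norm_nonneg _)).1 this
  have hζδ : nsq ζ ≤ q ^ 3 * δ := by
    have h1 : ∀ i, ‖ζ i‖ ≤ q * δ := by
      intro i
      have : ζ i = ∑ j, (R i j - diagonal (fun i => (μ i : ℂ)) i j) * e j := by
        simp only [sub_mul, Finset.sum_sub_distrib]
        have h2 : ∑ j, diagonal (fun i => (μ i : ℂ)) i j * e j = μ i * e i :=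
          mulVec_diagonal (fun i => (μ i : ℂ)) e i
        rw [h2, hμe i]
        rfl
      rw [this]
      refine (norm_sum_le _ _).trans ((Finset.sum_le_sum (g := fun _ => δ) fun j _ => ?_).trans ?_)
      · rw [norm_mul]
        calc _ ≤ δ * 1 := mul_le_mul (hR i j) (he1 j) (norm_nonneg _) hδ.le
          _ = δ := mul_one _
      · simp
    calc nsq ζ ≤ ∑ _i : Fin q, (q * δ) ^ 2 :=
          Finset.sum_le_sum fun i _ => pow_le_pow_left₀ (norm_nonneg _) (h1 i) 2
      _ = q ^ 3 * (δ * δ) := by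
          rw [Finset.sum_const, Finset.card_univ, Fintype.card_fin, nsmul_eq_mul]; ring
      _ ≤ q ^ 3 * (δ * 1) := by gcongr
      _ = _ := by ring
  have hζ0 := nsq_nonneg ζ
  have hx3 : nsq x ≤ K₁ * δ := by
    refine hx2.trans ?_
    calc 4 / g ^ 2 * nsq ζ ≤ 4 / g ^ 2 * (q ^ 3 * δ) := by gcongr
      _ = K₁ * δ := by simp only [hK₁]; ring
  have hlin : |leakQuad s b σ2 x - leakQuad s b σ2 y| ≤ P * (2 * C + 1 / g ^ 2) * δ * nsq ζ := by
    refine (abs_leakQuad_sub_le hs hb hσ hS hδ x y).trans ?_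
    rw [mul_assoc, mul_assoc]
    refine mul_le_mul_of_nonneg_left ?_ hP0.le
    calc (1 + 1 / δ) * nsq (x - y) + δ * nsq y
        ≤ (1 + 1 / δ) * (C * δ ^ 2 * nsq ζ) + δ * (nsq ζ / g ^ 2) := by gcongr
      _ = (C * (δ * δ) + C * δ) * nsq ζ + δ * (nsq ζ / g ^ 2) := by field_simp
      _ ≤ (C * (δ * 1) + C * δ) * nsq ζ + δ * (nsq ζ / g ^ 2) := by gcongr
      _ = _ := by ring
  have hQ0 : 0 ≤ ∑ i, s i * ‖x i‖ ^ 2 := sum_mul_norm_sq_nonneg hs x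
  have hQ : ∑ i, s i * ‖x i‖ ^ 2 ≤ S * nsq x := sum_mul_norm_sq_le hS x
  have hx0 := nsq_nonneg x
  have hsec : (b * ∑ i, s i * ‖x i‖ ^ 2) ^ 2 /
      (σ2 * (b * ∑ i, s i * ‖x i‖ ^ 2 + σ2 * (1 - nsq x))) ≤
      2 * (b * S) ^ 2 / σ2 ^ 2 * (K₁ * (4 / g ^ 2)) * δ * nsq ζ := by
    have hD : σ2 ^ 2 / 2 ≤ σ2 * (b * ∑ i, s i * ‖x i‖ ^ 2 + σ2 * (1 - nsq x)) := by
      have h1 : 1 / 2 ≤ 1 - nsq x := by linarith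
      have h2 := mul_le_mul_of_nonneg_left h1 hσ.le
      have h3 := mul_nonneg hb hQ0
      calc σ2 ^ 2 / 2 = σ2 * (σ2 * (1 / 2)) := by ring
        _ ≤ _ := by gcongr; linarith
    have hx4 : nsq x ^ 2 ≤ (K₁ * δ) * (4 / g ^ 2 * nsq ζ) := by
      rw [pow_two]; exact mul_le_mul hx3 hx2 hx0 (by positivity)
    calc _ ≤ (b * (S * nsq x)) ^ 2 / (σ2 ^ 2 / 2) := by gcongr
      _ = 2 * (b * S) ^ 2 / σ2 ^ 2 * nsq x ^ 2 := by field_simp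
      _ ≤ 2 * (b * S) ^ 2 / σ2 ^ 2 * ((K₁ * δ) * (4 / g ^ 2 * nsq ζ)) := by gcongr
      _ = _ := by ring
  have hsec0 : 0 ≤ (b * ∑ i, s i * ‖x i‖ ^ 2) ^ 2 /
      (σ2 * (b * ∑ i, s i * ‖x i‖ ^ 2 + σ2 * (1 - nsq x))) :=
    div_nonneg (sq_nonneg _) (mul_nonneg hσ.le (add_nonneg (mul_nonneg hb hQ0)
      (mul_nonneg hσ.le (by linarith))))
  rw [one_sub_leakLoss hs hb hσ hx1]
  have hKζ : K * δ * nsq ζ ≤ η * nsq ζ := mul_le_mul_of_nonneg_right hδη hζ0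
  have hsplit : K * δ * nsq ζ = P * (2 * C + 1 / g ^ 2) * δ * nsq ζ +
      2 * (b * S) ^ 2 / σ2 ^ 2 * (K₁ * (4 / g ^ 2)) * δ * nsq ζ := by simp only [hK]; ring
  rw [abs_le] at hlin ⊢
  constructor <;> linarith [hlin.1, hlin.2]

end Loss

/-! ### The loss in terms of the estimated principal components -/

section SINR

variable {p q : ℕ}

lemma star_kronVec_dotProduct {ι κ : Type*} [Fintype ι] [Fintype κ] (a a' : ι → ℂ)
    (b b' : κ → ℂ) :
    star (kronVec a b) ⬝ᵥ kronVec a' b' = (star a ⬝ᵥ a') * (star b ⬝ᵥ b') := by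
  simp only [dotProduct, kronVec, Fintype.sum_prod_type, Finset.sum_mul_sum, Pi.star_apply,
    star_mul']
  exact Finset.sum_congr rfl fun i _ => Finset.sum_congr rfl fun j _ => by ring

lemma kronecker_mulVec_kronVec {ι κ : Type*} [Fintype ι] [Fintype κ] (A : Matrix ι ι ℂ)
    (B : Matrix κ κ ℂ) (a : ι → ℂ) (b : κ → ℂ) :
    (A ⊗ₖ B) *ᵥ kronVec a b = kronVec (A *ᵥ a) (B *ᵥ b) := by
  ext ⟨i, j⟩
  simp only [mulVec, dotProduct, kronVec, Fintype.sum_prod_type, Finset.sum_mul_sum,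
    kroneckerMap_apply]
  exact Finset.sum_congr rfl fun k _ => Finset.sum_congr rfl fun l _ => by ring

lemma star_dotProduct_mulVec_eq_quadForm {A : Matrix (Fin p) (Fin p) ℂ} (hA : A.PosSemidef)
    (f : Fin p → ℂ) : star f ⬝ᵥ (A *ᵥ f) = (quadForm A f : ℂ) := by
  have h := (Complex.le_def.1 (hA.dotProduct_mulVec_nonneg f)).2
  apply Complex.ext
  · simp [quadForm]
  · rw [← h]; simp

lemma quadForm_nonneg {A : Matrix (Fin p) (Fin p) ℂ} (hA : A.PosSemidef) (f : Fin p → ℂ) :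
    0 ≤ quadForm A f := by
  simpa [quadForm] using (Complex.le_def.1 (hA.dotProduct_mulVec_nonneg f)).1

/-- The SINR of a Kronecker filter. -/
lemma sinr_kronVec {Ω : Type*} [MeasurableSpace Ω] {μ : Measure Ω} [IsProbabilityMeasure μ]
    {A : Matrix (Fin p) (Fin p) ℂ} (hA : A.PosSemidef) {B : Matrix (Fin q) (Fin q) ℂ}
    (hB : B.PosSemidef) {τ : ℕ → Ω → ℝ} {c v : ℕ → Ω → Fin p × Fin q → ℂ}
    (hM : IsSIRVModel μ (A ⊗ₖ B) τ c v) (σ : ℝ) (α : ℂ) (dA f : Fin p → ℂ) (dB g : Fin q → ℂ) :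
    sinr μ (interference τ c v σ 0) α (kronVec dA dB) (kronVec f g) =
      ‖α‖ ^ 2 * (‖star f ⬝ᵥ dA‖ ^ 2 * ‖star g ⬝ᵥ dB‖ ^ 2) /
        ((∫ ω, τ 0 ω ^ 2 ∂μ) * (quadForm A f * quadForm B g) + σ ^ 2 * (nsq f * nsq g)) := by
  rw [sinr, (hM.integral_norm_sq (hA.kronecker hB) σ 0 _).2, kronecker_mulVec_kronVec]
  simp only [star_kronVec_dotProduct, star_dotProduct_mulVec_eq_quadForm hA,
    star_dotProduct_mulVec_eq_quadForm hB, ← ofReal_nsq, norm_mul, mul_pow, ← Complex.ofReal_mul,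
    Complex.ofReal_re]

lemma spatialProj_isHermitian (h : Fin p → ℂ) : (spatialProj h)ᴴ = spatialProj h := by
  rw [spatialProj, conjTranspose_sub, conjTranspose_one, conjTranspose_vecMulVec, star_star]

lemma spatialProj_mul_self {h : Fin p → ℂ} (hh : ∑ i, ‖h i‖ ^ 2 = 1) :
    spatialProj h * spatialProj h = spatialProj h := by
  have h1 : star h ⬝ᵥ h = 1 := by
    rw [← ofReal_nsq, nsq, hh]; simp
  have h2 : vecMulVec h (star h) * vecMulVec h (star h) = vecMulVec h (star h) := by
    rw [vecMulVec_mul_vecMulVec, h1]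
    simp
  rw [spatialProj, sub_mul, mul_sub, mul_sub, h2]
  simp

lemma star_spatialProj_dotProduct {h : Fin p → ℂ} (hh : ∑ i, ‖h i‖ ^ 2 = 1) (d : Fin p → ℂ) :
    star (spatialProj h *ᵥ d) ⬝ᵥ d = (nsq (spatialProj h *ᵥ d) : ℂ) := by
  rw [ofReal_nsq, star_mulVec, spatialProj_isHermitian, ← dotProduct_mulVec, ← dotProduct_mulVec,
    mulVec_mulVec, spatialProj_mul_self hh]

lemma norm_sq_star_dotProduct_le (g d : Fin q → ℂ) :
    ‖star g ⬝ᵥ d‖ ^ 2 ≤ nsq g * nsq d := by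
  have h1 : ‖star g ⬝ᵥ d‖ ≤ ∑ i, ‖g i‖ * ‖d i‖ := by
    refine (norm_sum_le _ _).trans (le_of_eq ?_)
    simp
  calc ‖star g ⬝ᵥ d‖ ^ 2 ≤ (∑ i, ‖g i‖ * ‖d i‖) ^ 2 := pow_le_pow_left₀ (norm_nonneg _) h1 2
    _ ≤ _ := Finset.sum_mul_sq_le_sq_mul_sq _ _ _

lemma nsq_pos {x : Fin q → ℂ} (hx : x ≠ 0) : 0 < nsq x := by
  obtain ⟨i, hi⟩ := Function.ne_iff.1 hx
  exact Finset.sum_pos' (fun _ _ => sq_nonneg _)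
    ⟨i, Finset.mem_univ i, by have := norm_pos_iff.2 hi; positivity⟩

/-- The optimal temporal filter does nothing, as the target is orthogonal to the clutter. -/
lemma sinrMax_eq {Ω : Type*} [MeasurableSpace Ω] {μ : Measure Ω} [IsProbabilityMeasure μ]
    {A : Matrix (Fin p) (Fin p) ℂ} (hA : A.PosSemidef) {B : Matrix (Fin q) (Fin q) ℂ}
    (hB : B.PosSemidef) {τ : ℕ → Ω → ℝ} {c v : ℕ → Ω → Fin p × Fin q → ℂ}
    (hM : IsSIRVModel μ (A ⊗ₖ B) τ c v) {σ : ℝ} (hσ : 0 < σ) (α : ℂ) {h : Fin p → ℂ}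
    (hh : ∑ i, ‖h i‖ ^ 2 = 1) {dA : Fin p → ℂ} (hdA : spatialProj h *ᵥ dA ≠ 0)
    {dB : Fin q → ℂ} (hdB : dB ≠ 0) (hdB_orth : B *ᵥ dB = 0) :
    sinrMax μ (interference τ c v σ 0) α h (kronVec dA dB) =
      ‖α‖ ^ 2 * (nsq (spatialProj h *ᵥ dA) * nsq dB) / σ ^ 2 := by
  set f := spatialProj h *ᵥ dA with hf
  have hf0 : 0 < nsq f := nsq_pos hdA
  have hd0 : 0 < nsq dB := nsq_pos hdB
  have hval : ∀ G : Matrix (Fin q) (Fin q) ℂ,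
      sinr μ (interference τ c v σ 0) α (kronVec dA dB)
        ((spatialProj h ⊗ₖ G) *ᵥ kronVec dA dB) =
      ‖α‖ ^ 2 * (nsq f ^ 2 * ‖star (G *ᵥ dB) ⬝ᵥ dB‖ ^ 2) /
        ((∫ ω, τ 0 ω ^ 2 ∂μ) * (quadForm A f * quadForm B (G *ᵥ dB)) +
          σ ^ 2 * (nsq f * nsq (G *ᵥ dB))) := by
    intro G
    rw [kronecker_mulVec_kronVec, sinr_kronVec hA hB hM, star_spatialProj_dotProduct hh,
      Complex.norm_real, Real.norm_eq_abs, sq_abs]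
  have hT : 0 ≤ ∫ ω, τ 0 ω ^ 2 ∂μ := integral_nonneg fun ω => sq_nonneg _
  have hle : ∀ G : Matrix (Fin q) (Fin q) ℂ,
      sinr μ (interference τ c v σ 0) α (kronVec dA dB)
        ((spatialProj h ⊗ₖ G) *ᵥ kronVec dA dB) ≤ ‖α‖ ^ 2 * (nsq f * nsq dB) / σ ^ 2 := by
    intro G
    rw [hval]
    set g := G *ᵥ dB
    have hcs := norm_sq_star_dotProduct_le g dB
    have hg0 := nsq_nonneg g
    have hq : 0 ≤ (∫ ω, τ 0 ω ^ 2 ∂μ) * (quadForm A f * quadForm B g) :=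
      mul_nonneg hT (mul_nonneg (quadForm_nonneg hA f) (quadForm_nonneg hB g))
    refine div_le_of_le_mul₀ (by positivity) (by positivity) ?_
    have e : ‖α‖ ^ 2 * (nsq f * nsq dB) / σ ^ 2 * (σ ^ 2 * (nsq f * nsq g)) =
        ‖α‖ ^ 2 * (nsq f ^ 2 * (nsq g * nsq dB)) := by field_simp
    calc _ ≤ ‖α‖ ^ 2 * (nsq f ^ 2 * (nsq g * nsq dB)) := by gcongr
      _ = ‖α‖ ^ 2 * (nsq f * nsq dB) / σ ^ 2 * (σ ^ 2 * (nsq f * nsq g)) := e.symm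
      _ ≤ _ := by
        refine mul_le_mul_of_nonneg_left ?_ (by positivity)
        linarith
  refine le_antisymm (ciSup_le hle) ?_
  refine (le_of_eq ?_).trans (le_ciSup ⟨_, Set.forall_mem_range.2 hle⟩ 1)
  rw [hval, one_mulVec, ← ofReal_nsq, Complex.norm_real, Real.norm_eq_abs, sq_abs]
  have hq : quadForm B dB = 0 := by simp [quadForm, hdB_orth]
  rw [hq, mul_zero, mul_zero, zero_add]
  field_simp

/-- The SINR loss for an arbitrary matrix `U`. -/
lemma sinrLoss_eq {Ω : Type*} [MeasurableSpace Ω] {μ : Measure Ω} [IsProbabilityMeasure μ]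
    {A : Matrix (Fin p) (Fin p) ℂ} (hA : A.PosSemidef) {B : Matrix (Fin q) (Fin q) ℂ}
    (hB : B.PosSemidef) {τ : ℕ → Ω → ℝ} {c v : ℕ → Ω → Fin p × Fin q → ℂ}
    (hM : IsSIRVModel μ (A ⊗ₖ B) τ c v) {σ : ℝ} (hσ : 0 < σ) {α : ℂ} (hα : α ≠ 0) {h : Fin p → ℂ}
    (hh : ∑ i, ‖h i‖ ^ 2 = 1) (hAh : quadForm A h ≠ 0) {dA : Fin p → ℂ}
    (hdA : spatialProj h *ᵥ dA ≠ 0)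
    {dB : Fin q → ℂ} (hdB : dB ≠ 0) (hdB_orth : B *ᵥ dB = 0) {r : ℕ}
    (U : Matrix (Fin q) (Fin r) ℂ) :
    sinrLoss μ (interference τ c v σ 0) α h (kronVec dA dB) U =
      σ ^ 2 * ‖star (temporalProj U *ᵥ dB) ⬝ᵥ dB‖ ^ 2 / (nsq dB *
        ((∫ ω, τ 0 ω ^ 2 ∂μ) * mismatch A h dA * quadForm A h *
          quadForm B (temporalProj U *ᵥ dB) + σ ^ 2 * nsq (temporalProj U *ᵥ dB))) := by
  rw [sinrLoss, sinrMax_eq hA hB hM hσ α hh hdA hdB hdB_orth, kronecker_mulVec_kronVec,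
    sinr_kronVec hA hB hM, star_spatialProj_dotProduct hh, Complex.norm_real, Real.norm_eq_abs,
    sq_abs]
  have hres : mismatch A h dA * quadForm A h =
      quadForm A (spatialProj h *ᵥ dA) / nsq (spatialProj h *ᵥ dA) := by
    rw [mismatch, div_mul_cancel₀ _ hAh, residual]
    have hs : ∑ i, ‖(spatialProj h *ᵥ dA) i‖ ^ 2 = nsq (spatialProj h *ᵥ dA) := rfl
    rw [hs]
    set f := spatialProj h *ᵥ dA
    have h1 : star ((Real.sqrt (nsq f) : ℂ)⁻¹ • f) ⬝ᵥ (A *ᵥ ((Real.sqrt (nsq f) : ℂ)⁻¹ • f)) =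
        ((quadForm A f / nsq f : ℝ) : ℂ) := by
      rw [mulVec_smul, star_smul, smul_dotProduct, dotProduct_smul,
        star_dotProduct_mulVec_eq_quadForm hA]
      have h2 : (Real.sqrt (nsq f) : ℂ) * Real.sqrt (nsq f) = nsq f := by
        rw [← Complex.ofReal_mul, Real.mul_self_sqrt (nsq_nonneg f)]
      simp only [smul_eq_mul, star_inv₀, Complex.star_def, Complex.conj_ofReal]
      rw [← mul_assoc, ← mul_inv, h2]
      push_cast; ring
    rw [quadForm, h1, Complex.ofReal_re]
  rw [mul_assoc _ (mismatch A h dA), hres]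
  have hf0 : 0 < nsq (spatialProj h *ᵥ dA) := nsq_pos hdA
  have hd0 : 0 < nsq dB := nsq_pos hdB
  set f := spatialProj h *ᵥ dA
  set g := temporalProj U *ᵥ dB
  set T := ∫ ω, τ 0 ω ^ 2 ∂μ
  have hα' : ‖α‖ ≠ 0 := norm_ne_zero_iff.2 hα
  have e : T * (quadForm A f * quadForm B g) + σ ^ 2 * (nsq f * nsq g) =
      nsq f * (T * (quadForm A f / nsq f) * quadForm B g + σ ^ 2 * nsq g) := by field_simp
  rw [e]
  set D := T * (quadForm A f / nsq f) * quadForm B g + σ ^ 2 * nsq g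
  rcases eq_or_ne D 0 with hD | hD
  · simp [hD]
  · field_simp

lemma sum_castLE_eq {M : Type*} [AddCommMonoid M] {r : ℕ} (hr : r ≤ q) (f : Fin q → M) :
    ∑ k : Fin r, f (Fin.castLE hr k) = ∑ j : Fin q, if (j : ℕ) < r then f j else 0 := by
  rw [← Finset.sum_filter]
  refine Finset.sum_bij (fun k _ => Fin.castLE hr k) ?_ ?_ ?_ ?_
  · intro k _; simp
  · intro k _ l _ hkl; exact Fin.castLE_injective hr hkl
  · intro j hj
    exact ⟨⟨j, by simpa using hj⟩, Finset.mem_univ _, rfl⟩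
  · intro k _; rfl

lemma mul_conjTranspose_mulVec_eq_leadProj {r : ℕ} (hr : r ≤ q) {U : Matrix (Fin q) (Fin r) ℂ}
    {O : Matrix (Fin q) (Fin q) ℂ} (hU : ∀ i j, U i j = O i (Fin.castLE hr j)) (d : Fin q → ℂ) :
    (U * Uᴴ) *ᵥ d = leadProj r O d := by
  ext i
  rw [← mulVec_mulVec]
  simp only [leadProj, mulVec, dotProduct, conjTranspose_apply, hU, mul_ite, mul_zero]
  exact sum_castLE_eq hr fun j => O i j * ∑ x, star (O x j) * d x

lemma leadProj_smul (r : ℕ) (O : Matrix (Fin q) (Fin q) ℂ) (a : ℂ) (d : Fin q → ℂ) :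
    leadProj r O (a • d) = a • leadProj r O d := by
  rw [leadProj, leadProj, ← mulVec_smul]
  congr 1
  ext j
  simp [mulVec_smul]

lemma nsq_smul (a : ℂ) (x : Fin q → ℂ) : nsq (a • x) = ‖a‖ ^ 2 * nsq x := by
  simp [nsq, Finset.mul_sum, mul_pow]

lemma star_leadProj_dotProduct {O : Matrix (Fin q) (Fin q) ℂ}
    (hO : O ∈ unitaryGroup (Fin q) ℂ) (r : ℕ) (d : Fin q → ℂ) :
    star (leadProj r O d) ⬝ᵥ d = (nsq (leadProj r O d) : ℂ) := by
  rw [nsq_leadProj hO, leadProj, star_mulVec, ← dotProduct_mulVec]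
  simp only [dotProduct, Complex.ofReal_sum]
  refine Finset.sum_congr rfl fun j _ => ?_
  rw [Pi.star_apply]
  split_ifs
  · rw [← Complex.normSq_eq_norm_sq, Complex.normSq_eq_conj_mul_self]; rfl
  · simp

/-- Change of basis: in the eigenbasis `V` of `B`, the leading eigenvectors are those of `Vᴴ O`. -/
lemma conjTranspose_mulVec_leadProj {V : Matrix (Fin q) (Fin q) ℂ}
    (hV : V ∈ unitaryGroup (Fin q) ℂ) (O : Matrix (Fin q) (Fin q) ℂ) (r : ℕ) (d : Fin q → ℂ) :
    Vᴴ *ᵥ leadProj r O d = leadProj r (Vᴴ * O) (Vᴴ *ᵥ d) := by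
  have h : (Vᴴ * O)ᴴ *ᵥ (Vᴴ *ᵥ d) = Oᴴ *ᵥ d := by
    rw [conjTranspose_mul, conjTranspose_conjTranspose, mulVec_mulVec, Matrix.mul_assoc,
      self_mul_conjTranspose_of_mem hV, Matrix.mul_one]
  rw [leadProj, leadProj, mulVec_mulVec, h]

/-- The SINR loss of the leading columns of a unitary matrix `O`, as a function of the leakage of
the normalized target, in the eigenbasis of `B`. -/
lemma sinrLoss_eq_leakLoss {Ω : Type*} [MeasurableSpace Ω] {μ : Measure Ω} [IsProbabilityMeasure μ]
    {A : Matrix (Fin p) (Fin p) ℂ} (hA : A.PosSemidef) {B V : Matrix (Fin q) (Fin q) ℂ}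
    (hB : B.PosSemidef) {s : Fin q → ℝ} (hs : IsEigendecomposition B V s)
    {τ : ℕ → Ω → ℝ} {c v : ℕ → Ω → Fin p × Fin q → ℂ}
    (hM : IsSIRVModel μ (A ⊗ₖ B) τ c v) {σ : ℝ} (hσ : 0 < σ) {α : ℂ} (hα : α ≠ 0) {h : Fin p → ℂ}
    (hh : ∑ i, ‖h i‖ ^ 2 = 1) (hAh : quadForm A h ≠ 0) {dA : Fin p → ℂ}
    (hdA : spatialProj h *ᵥ dA ≠ 0)
    {dB : Fin q → ℂ} (hdB : dB ≠ 0) (hdB_orth : B *ᵥ dB = 0) {r : ℕ} (hr : r ≤ q)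
    {U : Matrix (Fin q) (Fin r) ℂ} {O : Matrix (Fin q) (Fin q) ℂ}
    (hO : O ∈ unitaryGroup (Fin q) ℂ) (hU : ∀ i j, U i j = O i (Fin.castLE hr j)) :
    sinrLoss μ (interference τ c v σ 0) α h (kronVec dA dB) U =
      leakLoss s ((∫ ω, τ 0 ω ^ 2 ∂μ) * mismatch A h dA * quadForm A h) (σ ^ 2)
        (leadProj r (Vᴴ * O) ((Real.sqrt (nsq dB) : ℂ)⁻¹ • (Vᴴ *ᵥ dB))) := by
  rw [sinrLoss_eq hA hB hM hσ hα hh hAh hdA hdB hdB_orth, leakLoss]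
  set b := (∫ ω, τ 0 ω ^ 2 ∂μ) * mismatch A h dA * quadForm A h
  have hd0 : 0 < nsq dB := nsq_pos hdB
  set y := leadProj r O dB with hy
  have hg : temporalProj U *ᵥ dB = dB - y := by
    rw [temporalProj, sub_mulVec, one_mulVec, mul_conjTranspose_mulVec_eq_leadProj hr hU]
  have hyd : star y ⬝ᵥ dB = (nsq y : ℂ) := star_leadProj_dotProduct hO r dB
  have hdy : star dB ⬝ᵥ y = (nsq y : ℂ) := by
    rw [star_dotProduct, hyd]; simp
  have hx : leadProj r (Vᴴ * O) ((Real.sqrt (nsq dB) : ℂ)⁻¹ • (Vᴴ *ᵥ dB)) =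
      (Real.sqrt (nsq dB) : ℂ)⁻¹ • (Vᴴ *ᵥ y) := by
    rw [leadProj_smul, conjTranspose_mulVec_leadProj hs.1]
  have hnorm : ‖(Real.sqrt (nsq dB) : ℂ)⁻¹‖ ^ 2 = (nsq dB)⁻¹ := by
    rw [norm_inv, Complex.norm_real, Real.norm_eq_abs, inv_pow, sq_abs, Real.sq_sqrt hd0.le]
  have hxn : nsq ((Real.sqrt (nsq dB) : ℂ)⁻¹ • (Vᴴ *ᵥ y)) = nsq y / nsq dB := by
    rw [nsq_smul, hnorm, nsq_conjTranspose_mulVec hs.1]; ring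
  have hQ : ∑ i, s i * ‖((Real.sqrt (nsq dB) : ℂ)⁻¹ • (Vᴴ *ᵥ y)) i‖ ^ 2 =
      quadForm B y / nsq dB := by
    rw [quadForm_eq_of_isEigendecomposition hs, Finset.sum_div]
    refine Finset.sum_congr rfl fun i _ => ?_
    rw [Pi.smul_apply, smul_eq_mul, norm_mul, mul_pow, hnorm]; ring
  have h1 : star (dB - y) ⬝ᵥ dB = ((nsq dB - nsq y : ℝ) : ℂ) := by
    rw [star_sub, sub_dotProduct, hyd, ← ofReal_nsq]; push_cast; ring
  have h2 : nsq (dB - y) = nsq dB - nsq y := by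
    have : ((nsq (dB - y) : ℝ) : ℂ) = ((nsq dB - nsq y : ℝ) : ℂ) := by
      rw [ofReal_nsq, dotProduct_sub, h1, star_sub, sub_dotProduct, hdy, ← ofReal_nsq]
      push_cast; ring
    exact_mod_cast this
  have h3 : quadForm B (dB - y) = quadForm B y := by
    have : star dB ⬝ᵥ (B *ᵥ y) = 0 := by
      rw [dotProduct_mulVec, ← hB.1.eq, ← star_mulVec, hdB_orth, star_zero, zero_dotProduct]
    simp only [quadForm, mulVec_sub, hdB_orth, zero_sub, dotProduct_neg, star_sub, sub_dotProduct,
      this, neg_neg]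
  rw [hx, hxn, hQ, hg, h1, h2, h3, Complex.norm_real, Real.norm_eq_abs, sq_abs]
  have e1 : b * (quadForm B y / nsq dB) + σ ^ 2 * (1 - nsq y / nsq dB) =
      (b * quadForm B y + σ ^ 2 * (nsq dB - nsq y)) / nsq dB := by field_simp
  have e2 : (1 - nsq y / nsq dB) = (nsq dB - nsq y) / nsq dB := by field_simp
  rw [e1, e2]
  rcases eq_or_ne (b * quadForm B y + σ ^ 2 * (nsq dB - nsq y)) 0 with hD | hD
  · simp [hD]
  · field_simp

/-- Measurability of the SINR loss in the estimated principal components. -/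
lemma aemeasurable_sinrLoss {Ω : Type*} [MeasurableSpace Ω] {μ : Measure Ω}
    [IsProbabilityMeasure μ]
    {A : Matrix (Fin p) (Fin p) ℂ} (hA : A.PosSemidef) {B : Matrix (Fin q) (Fin q) ℂ}
    (hB : B.PosSemidef) {τ : ℕ → Ω → ℝ} {c v : ℕ → Ω → Fin p × Fin q → ℂ}
    (hM : IsSIRVModel μ (A ⊗ₖ B) τ c v) {σ : ℝ} (hσ : 0 < σ) {α : ℂ} (hα : α ≠ 0) {h : Fin p → ℂ}
    (hh : ∑ i, ‖h i‖ ^ 2 = 1) (hAh : quadForm A h ≠ 0) {dA : Fin p → ℂ}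
    (hdA : spatialProj h *ᵥ dA ≠ 0)
    {dB : Fin q → ℂ} (hdB : dB ≠ 0) (hdB_orth : B *ᵥ dB = 0) {r : ℕ}
    {U : Ω → Matrix (Fin q) (Fin r) ℂ} (hU : ∀ i j, AEMeasurable (fun ω => U ω i j) μ) :
    AEMeasurable (fun ω => sinrLoss μ (interference τ c v σ 0) α h (kronVec dA dB) (U ω)) μ := by
  simp_rw [sinrLoss_eq hA hB hM hσ hα hh hAh hdA hdB hdB_orth]
  have hg : ∀ i, AEMeasurable (fun ω => (temporalProj (U ω) *ᵥ dB) i) μ := by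
    intro i
    simp only [temporalProj, mulVec, dotProduct, Matrix.sub_apply, Matrix.mul_apply,
      conjTranspose_apply]
    refine Finset.aemeasurable_fun_sum _ fun j _ => AEMeasurable.mul_const ?_ _
    refine aemeasurable_const.sub (Finset.aemeasurable_fun_sum _ fun k _ => (hU i k).mul ?_)
    exact continuous_star.measurable.comp_aemeasurable (hU j k)
  have hstar : ∀ i, AEMeasurable (fun ω => star ((temporalProj (U ω) *ᵥ dB) i)) μ :=
    fun i => continuous_star.measurable.comp_aemeasurable (hg i)
  have h1 : AEMeasurable (fun ω => star (temporalProj (U ω) *ᵥ dB) ⬝ᵥ dB) μ :=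
    Finset.aemeasurable_fun_sum _ fun i _ => (hstar i).mul_const _
  have h2 : AEMeasurable (fun ω => nsq (temporalProj (U ω) *ᵥ dB)) μ :=
    Finset.aemeasurable_fun_sum _ fun i _ => (hg i).norm.pow_const 2
  have h3 : AEMeasurable (fun ω => quadForm B (temporalProj (U ω) *ᵥ dB)) μ :=
    Complex.measurable_re.comp_aemeasurable <| Finset.aemeasurable_fun_sum _ fun i _ =>
      (hstar i).mul <| by
        simp only [mulVec.eq_1 B, dotProduct]
        exact Finset.aemeasurable_fun_sum _ fun j _ => (hg j).const_mul _
  exact ((h1.norm.pow_const 2).const_mul _).div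
    (((h3.const_mul _).add (h2.const_mul _)).const_mul _)

end SINR

/-! ### Sums of independent complex random variables -/

section ComplexSums

variable {Ω : Type*} [MeasurableSpace Ω] {μ : Measure Ω} [IsProbabilityMeasure μ] {X : ℕ → Ω → ℂ}

omit [MeasurableSpace Ω] in
lemma norm_sq_sum_eq (n : ℕ) (ω : Ω) :
    ‖∑ k ∈ Finset.range n, X k ω‖ ^ 2 =
      (∑ k ∈ Finset.range n, (X k ω).re) ^ 2 + (∑ k ∈ Finset.range n, (X k ω).im) ^ 2 := by
  rw [← Complex.normSq_eq_norm_sq, Complex.normSq_apply, Complex.re_sum, Complex.im_sum]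
  ring

omit [IsProbabilityMeasure μ] in
lemma integrable_sum_sq {X : ℕ → Ω → ℝ} (hid : ∀ k, IdentDistrib (X k) (X 0) μ μ)
    (hL : MemLp (X 0) 2 μ) (n : ℕ) :
    Integrable (fun ω => (∑ k ∈ Finset.range n, X k ω) ^ 2) μ :=
  (memLp_finsetSum (f := X) _ fun k _ => (hid k).memLp_iff.2 hL).integrable_sq

omit [IsProbabilityMeasure μ] in
lemma integral_re_im_eq_zero {f : Ω → ℂ} (hf : Integrable f μ) (h0 : ∫ ω, f ω ∂μ = 0) :
    ∫ ω, (f ω).re ∂μ = 0 ∧ ∫ ω, (f ω).im ∂μ = 0 := by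
  have hre := integral_re (𝕜 := ℂ) hf
  have him := integral_im (𝕜 := ℂ) hf
  rw [h0] at hre him
  exact ⟨by simpa using hre, by simpa using him⟩

/-- The complex variance of a sum of independent centered identically distributed variables. -/
lemma integral_norm_sq_sum (hid : ∀ k, IdentDistrib (X k) (X 0) μ μ) (hind : iIndepFun X μ)
    (hL : MemLp (X 0) 2 μ) (h0 : ∫ ω, X 0 ω ∂μ = 0) (n : ℕ) :
    Integrable (fun ω => ‖∑ k ∈ Finset.range n, X k ω‖ ^ 2) μ ∧
    ∫ ω, ‖∑ k ∈ Finset.range n, X k ω‖ ^ 2 ∂μ = n * ∫ ω, ‖X 0 ω‖ ^ 2 ∂μ := by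
  have hi := hL.integrable one_le_two
  obtain ⟨hre, him⟩ := integral_re_im_eq_zero hi h0
  have hidr : ∀ k, IdentDistrib (fun ω => (X k ω).re) (fun ω => (X 0 ω).re) μ μ :=
    fun k => (hid k).comp Complex.measurable_re
  have hidi : ∀ k, IdentDistrib (fun ω => (X k ω).im) (fun ω => (X 0 ω).im) μ μ :=
    fun k => (hid k).comp Complex.measurable_im
  have hindr : iIndepFun (fun k ω => (X k ω).re) μ := hind.comp _ fun _ => Complex.measurable_re
  have hindi : iIndepFun (fun k ω => (X k ω).im) μ := hind.comp _ fun _ => Complex.measurable_im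
  have hLr : MemLp (fun ω => (X 0 ω).re) 2 μ := hL.re
  have hLi : MemLp (fun ω => (X 0 ω).im) 2 μ := hL.im
  have ir := integrable_sum_sq hidr hLr n
  have ii := integrable_sum_sq hidi hLi n
  simp_rw [norm_sq_sum_eq]
  refine ⟨ir.add ii, ?_⟩
  rw [integral_add ir ii, integral_sum_sq_eq hidr hindr hLr hre,
    integral_sum_sq_eq hidi hindi hLi him, ← mul_add, ← integral_add hLr.integrable_sq
    hLi.integrable_sq]
  congr 1
  refine integral_congr_ae (ae_of_all _ fun ω => ?_)
  simp only [← Complex.normSq_eq_norm_sq, Complex.normSq_apply]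
  ring

/-- Uniform integrability of the squares of normalized sums of complex variables. -/
lemma tendsto_setIntegral_norm_sq_sum (hX : ∀ k, Measurable (X k))
    (hid : ∀ k, IdentDistrib (X k) (X 0) μ μ) (hind : iIndepFun X μ)
    (hL : MemLp (X 0) 2 μ) (h0 : ∫ ω, X 0 ω ∂μ = 0) {D : ℕ → Set Ω}
    (hD0 : Tendsto (fun n => μ.real (D n)) atTop (𝓝 0)) :
    Tendsto (fun n : ℕ => ∫ ω in D n, ‖∑ k ∈ Finset.range n, X k ω‖ ^ 2 / n ∂μ)
      atTop (𝓝 0) := by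
  have hi := hL.integrable one_le_two
  obtain ⟨hre, him⟩ := integral_re_im_eq_zero hi h0
  have hidr : ∀ k, IdentDistrib (fun ω => (X k ω).re) (fun ω => (X 0 ω).re) μ μ :=
    fun k => (hid k).comp Complex.measurable_re
  have hidi : ∀ k, IdentDistrib (fun ω => (X k ω).im) (fun ω => (X 0 ω).im) μ μ :=
    fun k => (hid k).comp Complex.measurable_im
  have hindr : iIndepFun (fun k ω => (X k ω).re) μ := hind.comp _ fun _ => Complex.measurable_re
  have hindi : iIndepFun (fun k ω => (X k ω).im) μ := hind.comp _ fun _ => Complex.measurable_im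
  have hLr : MemLp (fun ω => (X 0 ω).re) 2 μ := hL.re
  have hLi : MemLp (fun ω => (X 0 ω).im) 2 μ := hL.im
  have hr := tendsto_setIntegral_sum_sq (X := fun k ω => (X k ω).re)
    (fun k => Complex.measurable_re.comp (hX k)) hidr hindr hLr hre hD0
  have hi' := tendsto_setIntegral_sum_sq (X := fun k ω => (X k ω).im)
    (fun k => Complex.measurable_im.comp (hX k)) hidi hindi hLi him hD0
  have := hr.add hi'
  rw [add_zero] at this
  refine this.congr fun n => ?_
  rw [← integral_add ((integrable_sum_sq hidr hLr n).div_const _).integrableOn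
    ((integrable_sum_sq hidi hLi n).div_const _).integrableOn]
  refine integral_congr_ae (ae_of_all _ fun ω => ?_)
  simp only [norm_sq_sum_eq]
  ring

lemma half_le_abs_re_or_im {z : ℂ} {δ : ℝ} (h : δ ≤ ‖z‖) : δ / 2 ≤ |z.re| ∨ δ / 2 ≤ |z.im| := by
  by_contra! h'
  have := Complex.norm_le_abs_re_add_abs_im z
  linarith [h'.1, h'.2]

/-- The weak law of large numbers for complex variables. -/
lemma tendsto_measure_norm_mean_sub_ge (hid : ∀ k, IdentDistrib (X k) (X 0) μ μ)
    (hind : iIndepFun X μ) (hi : Integrable (X 0) μ) {δ : ℝ} (hδ : 0 < δ) :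
    Tendsto (fun n : ℕ => μ.real {ω | δ ≤ ‖(n : ℂ)⁻¹ * ∑ k ∈ Finset.range n, X k ω -
      ∫ ω, X 0 ω ∂μ‖}) atTop (𝓝 0) := by
  have hre : ∫ ω, (X 0 ω).re ∂μ = (∫ ω, X 0 ω ∂μ).re := integral_re (𝕜 := ℂ) hi
  have him : ∫ ω, (X 0 ω).im ∂μ = (∫ ω, X 0 ω ∂μ).im := integral_im (𝕜 := ℂ) hi
  have hr := tendsto_measure_abs_mean_sub_ge (X := fun k ω => (X k ω).re)
    (fun k => (hid k).comp Complex.measurable_re) (hind.comp _ fun _ => Complex.measurable_re)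
    hi.re (half_pos hδ)
  have hm := tendsto_measure_abs_mean_sub_ge (X := fun k ω => (X k ω).im)
    (fun k => (hid k).comp Complex.measurable_im) (hind.comp _ fun _ => Complex.measurable_im)
    hi.im (half_pos hδ)
  have hsum := hr.add hm
  rw [add_zero] at hsum
  refine squeeze_zero (fun n => measureReal_nonneg) (fun n => ?_) hsum
  refine (measureReal_mono (fun ω hω => ?_)).trans (measureReal_union_le _ _)
  have h1 := half_le_abs_re_or_im (Set.mem_ofPred_eq ▸ hω)
  have e1 : ((n : ℂ)⁻¹ * ∑ k ∈ Finset.range n, X k ω - ∫ ω, X 0 ω ∂μ).re =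
      (∑ k ∈ Finset.range n, (X k ω).re) / n - ∫ ω, (X 0 ω).re ∂μ := by
    rw [hre, Complex.sub_re, ← Complex.ofReal_natCast, ← Complex.ofReal_inv, Complex.re_ofReal_mul,
      Complex.re_sum]
    ring
  have e2 : ((n : ℂ)⁻¹ * ∑ k ∈ Finset.range n, X k ω - ∫ ω, X 0 ω ∂μ).im =
      (∑ k ∈ Finset.range n, (X k ω).im) / n - ∫ ω, (X 0 ω).im ∂μ := by
    rw [him, Complex.sub_im, ← Complex.ofReal_natCast, ← Complex.ofReal_inv, Complex.im_ofReal_mul,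
      Complex.im_sum]
    ring
  rw [e1, e2] at h1
  exact h1

/-- Deviations of empirical means of bounded complex variables have probability `o(1/n)`. -/
lemma tendsto_mul_measure_norm_mean_sub_ge (hX : ∀ k, Measurable (X k)) {K : ℝ}
    (hK : ∀ k ω, ‖X k ω‖ ≤ K) (hid : ∀ k, IdentDistrib (X k) (X 0) μ μ) (hind : iIndepFun X μ)
    {δ : ℝ} (hδ : 0 < δ) :
    Tendsto (fun n : ℕ => n * μ.real {ω | δ ≤ ‖(n : ℂ)⁻¹ * ∑ k ∈ Finset.range n, X k ω -
      ∫ ω, X 0 ω ∂μ‖}) atTop (𝓝 0) := by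
  have hi : ∀ k, Integrable (X k) μ := fun k =>
    Integrable.of_bound (hX k).aestronglyMeasurable K (ae_of_all _ (hK k))
  set m := ∫ ω, X 0 ω ∂μ with hm
  have hmK : ‖m‖ ≤ K := by
    have := norm_integral_le_of_norm_le_const (μ := μ) (ae_of_all _ (hK 0))
    simpa using this
  have hXm : ∀ k, ∫ ω, X k ω ∂μ = m := fun k => (hid k).integral_eq
  have hb : ∀ k ω, ‖X k ω - m‖ ≤ 2 * K := fun k ω => by
    have := norm_sub_le (X k ω) m
    linarith [hK k ω]
  have hr := tendsto_mul_measure_abs_sum_ge (μ := μ) (X := fun k ω => (X k ω - m).re)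
    (fun k => Complex.measurable_re.comp ((hX k).sub_const m))
    (fun k ω => (Complex.abs_re_le_norm _).trans (hb k ω))
    (hind.comp (fun _ z => (z - m).re) fun _ =>
      Complex.measurable_re.comp (measurable_id.sub_const m))
    (fun k => by
      have := integral_re (𝕜 := ℂ) ((hi k).sub (integrable_const m))
      refine (this.trans ?_)
      simp only [Pi.sub_apply]
      rw [integral_sub (hi k) (integrable_const m), hXm]; simp) (half_pos hδ)
  have hm' := tendsto_mul_measure_abs_sum_ge (μ := μ) (X := fun k ω => (X k ω - m).im)
    (fun k => Complex.measurable_im.comp ((hX k).sub_const m))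
    (fun k ω => (Complex.abs_im_le_norm _).trans (hb k ω))
    (hind.comp (fun _ z => (z - m).im) fun _ =>
      Complex.measurable_im.comp (measurable_id.sub_const m))
    (fun k => by
      have := integral_im (𝕜 := ℂ) ((hi k).sub (integrable_const m))
      refine (this.trans ?_)
      simp only [Pi.sub_apply]
      rw [integral_sub (hi k) (integrable_const m), hXm]; simp) (half_pos hδ)
  have hsum := hr.add hm'
  rw [add_zero] at hsum
  refine squeeze_zero' (Eventually.of_forall fun n => by positivity) ?_ hsum
  filter_upwards [eventually_gt_atTop 0] with n hn
  have hn' : (0 : ℝ) < n := by exact_mod_cast hn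
  rw [← mul_add]
  refine mul_le_mul_of_nonneg_left ?_ hn'.le
  refine (measureReal_mono (fun ω hω => ?_)).trans (measureReal_union_le _ _)
  have h1 := half_le_abs_re_or_im (Set.mem_ofPred_eq ▸ hω)
  have e : (n : ℂ)⁻¹ * ∑ k ∈ Finset.range n, X k ω - m =
      ((n : ℝ)⁻¹ : ℝ) * ∑ k ∈ Finset.range n, (X k ω - m) := by
    have : (n : ℂ) ≠ 0 := by exact_mod_cast hn.ne'
    rw [Finset.sum_sub_distrib]
    simp only [Finset.sum_const, Finset.card_range, nsmul_eq_mul]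
    push_cast
    field_simp
  rw [e, Complex.re_ofReal_mul, Complex.im_ofReal_mul, Complex.re_sum, Complex.im_sum, abs_mul,
    abs_mul, abs_of_pos (inv_pos.2 hn'), inv_mul_eq_div, inv_mul_eq_div, le_div_iff₀ hn',
    le_div_iff₀ hn'] at h1
  exact h1

end ComplexSums

/-! ### The empirical covariance and its residual -/

section Core

/-- The empirical covariance of the first `n` terms of a sequence of vectors. -/
noncomputable def empCov {q : ℕ} (y : ℕ → Fin q → ℂ) (n : ℕ) : Matrix (Fin q) (Fin q) ℂ :=
  (n : ℂ)⁻¹ • ∑ k ∈ Finset.range n, vecMulVec (y k) (star (y k))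

variable {q : ℕ}

lemma empCov_apply (y : ℕ → Fin q → ℂ) (n : ℕ) (i j : Fin q) :
    empCov y n i j = (n : ℂ)⁻¹ * ∑ k ∈ Finset.range n, y k i * star (y k j) := by
  simp [empCov, Matrix.sum_apply, vecMulVec_apply]

lemma quadForm_empCov (y : ℕ → Fin q → ℂ) (n : ℕ) (c : Fin q → ℂ) :
    quadForm (empCov y n) c = (n : ℝ)⁻¹ * ∑ k ∈ Finset.range n, ‖star c ⬝ᵥ y k‖ ^ 2 := by
  have h : ∀ k, star c ⬝ᵥ (vecMulVec (y k) (star (y k)) *ᵥ c) =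
    ((‖star c ⬝ᵥ y k‖ ^ 2 : ℝ) : ℂ) := by
    intro k
    rw [vecMulVec_mulVec, dotProduct_smul, star_dotProduct (y k) c, op_smul_eq_smul, smul_eq_mul,
      ← Complex.normSq_eq_norm_sq, Complex.normSq_eq_conj_mul_self]
    rfl
  rw [quadForm, empCov, smul_mulVec, dotProduct_smul, Matrix.sum_mulVec, dotProduct_sum]
  simp only [h, smul_eq_mul]
  rw [← Complex.ofReal_sum, ← Complex.ofReal_natCast, ← Complex.ofReal_inv, ← Complex.ofReal_mul,
    Complex.ofReal_re]

/-- The residual of `e` is an empirical mean of centered vectors. -/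
lemma empCov_mulVec_sub (y : ℕ → Fin q → ℂ) {n : ℕ} (hn : n ≠ 0) (e : Fin q → ℂ) (σ2 : ℝ)
    (i : Fin q) :
    (empCov y n *ᵥ e - (σ2 : ℂ) • e) i =
      (n : ℂ)⁻¹ * ∑ k ∈ Finset.range n, (y k i * star (star e ⬝ᵥ y k) - σ2 * e i) := by
  have h : ∀ k, (vecMulVec (y k) (star (y k)) *ᵥ e) i = y k i * star (star e ⬝ᵥ y k) := by
    intro k
    rw [vecMulVec_mulVec, star_dotProduct (y k) e]
    simp
  have hn' : (n : ℂ) ≠ 0 := by exact_mod_cast hn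
  rw [Pi.sub_apply, empCov, smul_mulVec, Matrix.sum_mulVec, Pi.smul_apply, Finset.sum_apply]
  simp only [h, Finset.sum_sub_distrib, Finset.sum_const, Finset.card_range, nsmul_eq_mul,
    Pi.smul_apply, smul_eq_mul]
  field_simp

variable {Ω : Type*} [MeasurableSpace Ω] {μ : Measure Ω} [IsProbabilityMeasure μ]
  {Y : ℕ → Ω → Fin q → ℂ}

/-- The weak law of large numbers for the empirical covariance. -/
lemma tendsto_measure_empCov (hid : ∀ k, IdentDistrib (Y k) (Y 0) μ μ) (hind : iIndepFun Y μ)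
    {M : Matrix (Fin q) (Fin q) ℂ}
    (hcov : ∀ i j, Integrable (fun ω => Y 0 ω i * star (Y 0 ω j)) μ ∧
      ∫ ω, Y 0 ω i * star (Y 0 ω j) ∂μ = M i j) {δ : ℝ} (hδ : 0 < δ) :
    Tendsto (fun n => μ.real {ω | ¬ ∀ i j, ‖empCov (fun k => Y k ω) n i j - M i j‖ ≤ δ})
      atTop (𝓝 0) := by
  have hm : ∀ i j : Fin q, Measurable fun z : Fin q → ℂ => z i * star (z j) := fun i j =>
    (measurable_pi_apply i).mul (continuous_star.measurable.comp (measurable_pi_apply j))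
  have h1 : ∀ i j : Fin q, Tendsto (fun n : ℕ => μ.real {ω | δ ≤
      ‖empCov (fun k => Y k ω) n i j - M i j‖}) atTop (𝓝 0) := by
    intro i j
    have := tendsto_measure_norm_mean_sub_ge (X := fun k ω => Y k ω i * star (Y k ω j))
      (fun k => (hid k).comp (hm i j)) (hind.comp _ fun _ => hm i j) (hcov i j).1 hδ
    simpa only [empCov_apply, (hcov i j).2] using this
  have h2 := tendsto_finsetSum (Finset.univ : Finset (Fin q × Fin q)) fun x _ => h1 x.1 x.2
  rw [Finset.sum_const_zero] at h2
  refine squeeze_zero (fun n => measureReal_nonneg) (fun n => ?_) h2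
  refine (measureReal_mono (fun ω hω => ?_) (measure_ne_top _ _)).trans
    (measureReal_biUnion_finset_le _ _)
  simp only [Set.mem_ofPred_eq, not_forall, not_le] at hω
  obtain ⟨i, j, hij⟩ := hω
  simp only [Set.mem_iUnion, Set.mem_ofPred_eq]
  exact ⟨(i, j), Finset.mem_univ _, hij.le⟩

/-- Lower tails of the empirical covariance are light, even when only second moments are finite:
dropping the terms with large `Y k` decreases the quadratic form, and the empirical covariance of
the other terms is a mean of bounded variables. -/
lemma exists_tendsto_mul_measure_quadForm_lt (hY : ∀ k, Measurable (Y k))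
    (hid : ∀ k, IdentDistrib (Y k) (Y 0) μ μ) (hind : iIndepFun Y μ)
    {M : Matrix (Fin q) (Fin q) ℂ}
    (hcov : ∀ i j, Integrable (fun ω => Y 0 ω i * star (Y 0 ω j)) μ ∧
      ∫ ω, Y 0 ω i * star (Y 0 ω j) ∂μ = M i j) {δ : ℝ} (hδ : 0 < δ) :
    ∃ D : ℕ → Set Ω, (∀ n, MeasurableSet (D n)) ∧
      Tendsto (fun n : ℕ => n * μ.real (D n)) atTop (𝓝 0) ∧
      ∀ n, ∀ ω ∉ D n, ∀ c : Fin q → ℂ,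
        quadForm M c - q * δ * nsq c ≤ quadForm (empCov (fun k => Y k ω) n) c := by
  -- truncation of a vector at level `K`
  set φ : ℝ → (Fin q → ℂ) → Fin q → ℂ := fun K z => if ∀ i, ‖z i‖ ≤ K then z else 0 with hφ
  have hset : ∀ K : ℝ, MeasurableSet {z : Fin q → ℂ | ∀ i, ‖z i‖ ≤ K} := by
    intro K
    simp only [Set.ofPred_forall]
    exact MeasurableSet.iInter fun i =>
      measurableSet_le (measurable_pi_apply i).norm measurable_const
  have hφm : ∀ K, Measurable (φ K) :=
    fun K => Measurable.ite (hset K) measurable_id measurable_const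
  have hm : ∀ i j : Fin q, Measurable fun z : Fin q → ℂ => z i * star (z j) := fun i j =>
    (measurable_pi_apply i).mul (continuous_star.measurable.comp (measurable_pi_apply j))
  have hφm2 : ∀ (K : ℝ) (i j : Fin q), Measurable fun z => φ K z i * star (φ K z j) :=
    fun K i j => (hm i j).comp (hφm K)
  have hlim : ∀ i j, Tendsto (fun n : ℕ => ∫ ω, φ n (Y 0 ω) i * star (φ n (Y 0 ω) j) ∂μ) atTop
      (𝓝 (M i j)) := by
    intro i j
    rw [← (hcov i j).2]
    refine tendsto_integral_of_dominated_convergence (fun ω => ‖Y 0 ω i * star (Y 0 ω j)‖)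
      (fun n => ((hφm2 n i j).comp (hY 0)).aestronglyMeasurable) (hcov i j).1.norm ?_ ?_
    · intro n
      refine ae_of_all _ fun ω => ?_
      simp only [hφ]
      split_ifs <;> simp [mul_nonneg]
    · refine ae_of_all _ fun ω => tendsto_const_nhds.congr' ?_
      obtain ⟨N, hN⟩ := exists_nat_ge (∑ i, ‖Y 0 ω i‖)
      filter_upwards [eventually_ge_atTop N] with n hn
      have : ∀ i, ‖Y 0 ω i‖ ≤ n := fun i =>
        (Finset.single_le_sum (f := fun i => ‖Y 0 ω i‖) (fun _ _ => norm_nonneg _)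
          (Finset.mem_univ i)).trans (hN.trans (by exact_mod_cast hn))
      simp only [hφ, if_pos this]
  have hev : ∀ᶠ n : ℕ in atTop, ∀ i j, ‖∫ ω, φ n (Y 0 ω) i * star (φ n (Y 0 ω) j) ∂μ - M i j‖ <
      δ / 2 := by
    simp only [eventually_all]
    intro i j
    have := (tendsto_sub_nhds_zero_iff.2 (hlim i j)).norm
    rw [norm_zero] at this
    exact this.eventually (gt_mem_nhds (half_pos hδ))
  obtain ⟨N, hN⟩ := hev.exists
  set M' : Matrix (Fin q) (Fin q) ℂ :=
    Matrix.of fun i j => ∫ ω, φ N (Y 0 ω) i * star (φ N (Y 0 ω) j) ∂μ with hM'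
  have hφb : ∀ (z : Fin q → ℂ) i, ‖φ N z i‖ ≤ N := by
    intro z i
    simp only [hφ]
    split_ifs with h
    · exact h i
    · simp
  have hem : ∀ n i j, Measurable fun ω => empCov (fun k => φ N (Y k ω)) n i j := by
    intro n i j
    simp only [empCov_apply]
    exact (Finset.measurable_fun_sum _ fun k _ => (hφm2 N i j).comp (hY k)).const_mul _
  refine ⟨fun n => ⋃ x : Fin q × Fin q,
    {ω | δ / 2 ≤ ‖empCov (fun k => φ N (Y k ω)) n x.1 x.2 - M' x.1 x.2‖}, ?_, ?_, ?_⟩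
  · exact fun n => MeasurableSet.iUnion fun x =>
      measurableSet_le measurable_const ((hem n x.1 x.2).sub_const _).norm
  · have h1 : ∀ i j : Fin q, Tendsto (fun n : ℕ => n * μ.real {ω | δ / 2 ≤
        ‖empCov (fun k => φ N (Y k ω)) n i j - M' i j‖}) atTop (𝓝 0) := by
      intro i j
      have := tendsto_mul_measure_norm_mean_sub_ge (μ := μ)
        (X := fun k ω => φ N (Y k ω) i * star (φ N (Y k ω) j)) (K := N * N)
        (fun k => (hφm2 N i j).comp (hY k))
        (fun k ω => by
          rw [norm_mul, norm_star]
          exact mul_le_mul (hφb _ _) (hφb _ _) (norm_nonneg _) (Nat.cast_nonneg _))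
        (fun k => (hid k).comp (hφm2 N i j)) (hind.comp _ fun _ => hφm2 N i j) (half_pos hδ)
      simpa only [empCov_apply, hM', Matrix.of_apply] using this
    have h2 := tendsto_finsetSum (Finset.univ : Finset (Fin q × Fin q)) fun x _ => h1 x.1 x.2
    rw [Finset.sum_const_zero] at h2
    refine squeeze_zero (fun n => by positivity) (fun n => ?_) h2
    rw [← Finset.mul_sum]
    exact mul_le_mul_of_nonneg_left (measureReal_iUnion_fintype_le _) (Nat.cast_nonneg n)
  · intro n ω hω c
    simp only [Set.mem_iUnion, Set.mem_ofPred_eq, not_exists, not_le] at hω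
    have h1 : ∀ i j, ‖empCov (fun k => φ N (Y k ω)) n i j - M i j‖ ≤ δ := by
      intro i j
      have := norm_add_le (empCov (fun k => φ N (Y k ω)) n i j - M' i j) (M' i j - M i j)
      rw [sub_add_sub_cancel] at this
      have h2 := hω (i, j)
      have h3 := hN i j
      simp only [hM', Matrix.of_apply] at this h2
      linarith
    have h2 := (abs_le.1 (abs_quadForm_sub_le h1 hδ.le c)).1
    have h3 : quadForm (empCov (fun k => φ N (Y k ω)) n) c ≤
        quadForm (empCov (fun k => Y k ω) n) c := by
      rw [quadForm_empCov, quadForm_empCov]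
      refine mul_le_mul_of_nonneg_left (Finset.sum_le_sum fun k _ => ?_) (by positivity)
      simp only [hφ]
      split_ifs
      · exact le_rfl
      · simp
    linarith

end Core

/-! ### Asymptotics of the expected loss -/

section Asymptotics

variable {q : ℕ} {Ω : Type*} [MeasurableSpace Ω] {μ : Measure Ω} [IsProbabilityMeasure μ]
  {Y : ℕ → Ω → Fin q → ℂ}

/-- The summands of the residual of `e` for the empirical covariance. -/
noncomputable def residualTerm (Y : ℕ → Ω → Fin q → ℂ) (e : Fin q → ℂ) (σ2 : ℝ) (i : Fin q) (k : ℕ)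
    (ω : Ω) : ℂ :=
  Y k ω i * star (star e ⬝ᵥ Y k ω) - σ2 * e i

omit [MeasurableSpace Ω] in
lemma mul_nsq_residual (e : Fin q → ℂ) (σ2 : ℝ) {n : ℕ} (hn : n ≠ 0) (ω : Ω) (i : Fin q) :
    n * ‖(empCov (fun k => Y k ω) n *ᵥ e - (σ2 : ℂ) • e) i‖ ^ 2 =
      ‖∑ k ∈ Finset.range n, residualTerm Y e σ2 i k ω‖ ^ 2 / n := by
  have hn' : (n : ℝ) ≠ 0 := by exact_mod_cast hn
  rw [empCov_mulVec_sub _ hn, norm_mul, mul_pow, norm_inv, Complex.norm_natCast]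
  simp only [residualTerm]
  field_simp

/-- The asymptotic expansion of the expected loss, for i.i.d. vectors `Y k` with a diagonal
covariance, whose leading entries exceed the noise level. The loss is compared to a quadratic form
in the residual of `e`, of expectation exactly `L / n`. -/
theorem tendsto_mul_one_sub_integral_leakLoss (hY : ∀ k, Measurable (Y k))
    (hid : ∀ k, IdentDistrib (Y k) (Y 0) μ μ) (hind : iIndepFun Y μ)
    {s : Fin q → ℝ} (hs : ∀ i, 0 ≤ s i) {b σ2 : ℝ} (hb : 0 ≤ b) (hσ : 0 < σ2)
    {l : Fin q → ℝ} (hl : Antitone l) {e : Fin q → ℂ} (he : nsq e = 1)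
    (hle : ∀ i, (l i : ℂ) * e i = σ2 * e i) {r : ℕ} {g : ℝ} (hg : 0 < g)
    (hσl : ∀ i : Fin q, (i : ℕ) < r → g ≤ l i - σ2)
    (hgap : ∀ i j : Fin q, (i : ℕ) < r → r ≤ (j : ℕ) → g ≤ l i - l j)
    (hcov : ∀ i j, Integrable (fun ω => Y 0 ω i * star (Y 0 ω j)) μ ∧
      ∫ ω, Y 0 ω i * star (Y 0 ω j) ∂μ = diagonal (fun i => (l i : ℂ)) i j)
    (h4 : ∀ i, Integrable (fun ω => ‖Y 0 ω i‖ ^ 2 * ‖star e ⬝ᵥ Y 0 ω‖ ^ 2) μ)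
    (h4r : ∀ i : Fin q, (i : ℕ) < r →
      ∫ ω, ‖Y 0 ω i‖ ^ 2 * ‖star e ⬝ᵥ Y 0 ω‖ ^ 2 ∂μ = l i * σ2)
    {ρ : ℕ → Ω → ℝ} (hρm : ∀ n, AEMeasurable (ρ n) μ)
    (hρ : ∀ n, ∀ᵐ ω ∂μ, ∃ (O : Matrix (Fin q) (Fin q) ℂ) (t : Fin q → ℝ),
      IsEigendecomposition (empCov (fun k => Y k ω) n) O t ∧
        ρ n ω = leakLoss s b σ2 (leadProj r O e)) :
    Tendsto (fun n : ℕ => n * (1 - ∫ ω, ρ n ω ∂μ)) atTop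
      (𝓝 (∑ i : Fin q, if (i : ℕ) < r then
        (1 + b / σ2 * s i) * (l i * σ2 / (l i - σ2) ^ 2) else 0)) := by
  set ξ : Fin q → ℕ → Ω → ℂ := residualTerm Y e σ2 with hξ
  set ζ : ℕ → Ω → Fin q → ℂ := fun n ω =>
    empCov (fun k => Y k ω) n *ᵥ e - (σ2 : ℂ) • e with hζ
  -- the summands `ξ` are i.i.d., centered and square integrable
  have hξm : ∀ i, Measurable fun z : Fin q → ℂ => z i * star (star e ⬝ᵥ z) - σ2 * e i := fun i =>
    ((measurable_pi_apply i).mul (continuous_star.measurable.comp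
      (measurable_star_dotProduct e))).sub_const _
  have hξY : ∀ i k, Measurable (ξ i k) := fun i k => (hξm i).comp (hY k)
  have hξid : ∀ i k, IdentDistrib (ξ i k) (ξ i 0) μ μ := fun i k => (hid k).comp (hξm i)
  have hξind : ∀ i, iIndepFun (ξ i) μ := fun i => hind.comp _ fun _ => hξm i
  have hξL : ∀ i, MemLp (ξ i 0) 2 μ := by
    intro i
    have h1 : MemLp (fun ω => Y 0 ω i * star (star e ⬝ᵥ Y 0 ω)) 2 μ := by
      refine (memLp_two_iff_integrable_sq_norm ?_).2 ?_
      · exact (((measurable_pi_apply i).mul (continuous_star.measurable.comp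
          (measurable_star_dotProduct e))).comp (hY 0)).aestronglyMeasurable
      · simpa only [norm_mul, norm_star, mul_pow] using h4 i
    exact h1.sub (memLp_const _)
  have hξ0 : ∀ i, ∫ ω, ξ i 0 ω ∂μ = 0 := by
    intro i
    have e1 : ∀ ω, Y 0 ω i * star (star e ⬝ᵥ Y 0 ω) = ∑ j, e j * (Y 0 ω i * star (Y 0 ω j)) := by
      intro ω
      simp only [dotProduct, star_sum, star_mul', Pi.star_apply, star_star, Finset.mul_sum]
      exact Finset.sum_congr rfl fun j _ => by ring
    have i1 : Integrable (fun ω => Y 0 ω i * star (star e ⬝ᵥ Y 0 ω)) μ := by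
      simp only [e1]
      exact integrable_finsetSum _ fun j _ => (hcov i j).1.const_mul _
    simp only [hξ, residualTerm]
    rw [integral_sub i1 (integrable_const _)]
    simp only [e1]
    rw [integral_finsetSum _ fun j _ => (hcov i j).1.const_mul _]
    simp only [integral_const_mul, (hcov i _).2]
    have : ∑ j, e j * diagonal (fun i => (l i : ℂ)) i j = l i * e i := by
      rw [← mulVec_diagonal (fun i => (l i : ℂ)) e i]
      simp only [mulVec, dotProduct]
      exact Finset.sum_congr rfl fun j _ => mul_comm _ _
    rw [this, hle i]
    simp
  have hξ2 : ∀ i : Fin q, (i : ℕ) < r → ∫ ω, ‖ξ i 0 ω‖ ^ 2 ∂μ = l i * σ2 := by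
    intro i hi
    have hei : e i = 0 := by
      have h1 := hσl i hi
      have h2 : ((l i - σ2 : ℝ) : ℂ) * e i = 0 := by
        push_cast; rw [sub_mul, hle i, sub_self]
      exact (mul_eq_zero.1 h2).resolve_left (Complex.ofReal_ne_zero.2 (hg.trans_le h1).ne')
    rw [← h4r i hi]
    refine integral_congr_ae (ae_of_all _ fun ω => ?_)
    simp [hξ, residualTerm, hei, mul_pow]
  have hS := fun i => integral_norm_sq_sum (hξid i) (hξind i) (hξL i) (hξ0 i)
  have hζξ : ∀ {n : ℕ}, n ≠ 0 → ∀ ω i, n * ‖ζ n ω i‖ ^ 2 =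
      ‖∑ k ∈ Finset.range n, ξ i k ω‖ ^ 2 / n := fun hn ω i => mul_nsq_residual e σ2 hn ω i
  -- the quadratic approximation `W` and its expectation
  set w : Fin q → ℝ := fun i =>
    if (i : ℕ) < r then (1 + b / σ2 * s i) / (l i - σ2) ^ 2 else 0 with hw
  have hquad : ∀ z : Fin q → ℂ, leakQuad s b σ2 (leadApprox r l σ2 z) = ∑ i, w i * ‖z i‖ ^ 2 := by
    intro z
    refine Finset.sum_congr rfl fun i _ => ?_
    simp only [hw, leadApprox]
    split_ifs
    · rw [norm_div, div_pow, Complex.norm_real, Real.norm_eq_abs, sq_abs]; ring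
    · simp
  set L := ∑ i : Fin q, if (i : ℕ) < r then
    (1 + b / σ2 * s i) * (l i * σ2 / (l i - σ2) ^ 2) else 0 with hL
  have hcomp : ∀ {n : ℕ}, n ≠ 0 → ∀ i, Integrable (fun ω => n * ‖ζ n ω i‖ ^ 2) μ ∧
      ∫ ω, n * ‖ζ n ω i‖ ^ 2 ∂μ = ∫ ω, ‖ξ i 0 ω‖ ^ 2 ∂μ := by
    intro n hn i
    have hn' : (n : ℝ) ≠ 0 := by exact_mod_cast hn
    simp only [hζξ hn]
    refine ⟨(hS i n).1.div_const _, ?_⟩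
    rw [integral_div, (hS i n).2]
    field_simp
  set W : ℕ → Ω → ℝ := fun n ω => n * leakQuad s b σ2 (leadApprox r l σ2 (ζ n ω)) with hW
  set Z : ℕ → Ω → ℝ := fun n ω => n * nsq (ζ n ω) with hZ
  have hWe : ∀ n ω, W n ω = ∑ i, w i * (n * ‖ζ n ω i‖ ^ 2) := by
    intro n ω
    simp only [hW, hquad, Finset.mul_sum]
    exact Finset.sum_congr rfl fun i _ => by ring
  have hZe : ∀ n ω, Z n ω = ∑ i, n * ‖ζ n ω i‖ ^ 2 := fun n ω => by
    simp only [hZ, nsq, Finset.mul_sum]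
  have hWi : ∀ {n : ℕ}, n ≠ 0 → Integrable (W n) μ ∧ ∫ ω, W n ω ∂μ = L := by
    intro n hn
    have : W n = fun ω => ∑ i, w i * (n * ‖ζ n ω i‖ ^ 2) := funext (hWe n)
    rw [this]
    refine ⟨integrable_finsetSum _ fun i _ => (hcomp hn i).1.const_mul _, ?_⟩
    rw [integral_finsetSum _ fun i _ => (hcomp hn i).1.const_mul _]
    simp only [integral_const_mul, (hcomp hn _).2, hw, hL]
    refine Finset.sum_congr rfl fun i _ => ?_
    split_ifs with hi
    · rw [hξ2 i hi]; ring
    · simp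
  set CZ := ∑ i, ∫ ω, ‖ξ i 0 ω‖ ^ 2 ∂μ with hCZ
  have hCZ0 : 0 ≤ CZ := Finset.sum_nonneg fun i _ => integral_nonneg fun ω => sq_nonneg _
  have hZi : ∀ {n : ℕ}, n ≠ 0 → Integrable (Z n) μ ∧ ∫ ω, Z n ω ∂μ = CZ := by
    intro n hn
    have : Z n = fun ω => ∑ i, n * ‖ζ n ω i‖ ^ 2 := funext (hZe n)
    rw [this]
    refine ⟨integrable_finsetSum _ fun i _ => (hcomp hn i).1, ?_⟩
    rw [integral_finsetSum _ fun i _ => (hcomp hn i).1]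
    simp only [(hcomp hn _).2, hCZ]
  have hZ0 : ∀ n ω, 0 ≤ Z n ω := fun n ω => mul_nonneg (Nat.cast_nonneg n) (nsq_nonneg _)
  have hW0 : ∀ n ω, 0 ≤ W n ω := fun n ω =>
    mul_nonneg (Nat.cast_nonneg n) (leakQuad_nonneg hs hb hσ _)
  -- bounds on the loss
  obtain ⟨S, hSs, hS0⟩ : ∃ S : ℝ, (∀ i, s i ≤ S) ∧ 0 ≤ S :=
    ⟨∑ i, s i, fun i => Finset.single_le_sum (fun j _ => hs j) (Finset.mem_univ i),
      Finset.sum_nonneg fun i _ => hs i⟩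
  have hbS : 0 ≤ b / σ2 * S := mul_nonneg (div_nonneg hb hσ.le) hS0
  set C := (1 + b / σ2 * S) / (g / 2) ^ 2 with hC
  have hC0 : 0 ≤ C := by positivity
  have hWZ : ∀ n ω, W n ω ≤ C * Z n ω := by
    intro n ω
    have h1 := leakQuad_le hb hσ hSs (leadApprox r l σ2 (ζ n ω))
    have h2 := nsq_leadApprox_le (σ2 := σ2) hg hσl (ζ n ω)
    have h3 := nsq_nonneg (ζ n ω)
    have h4 : leakQuad s b σ2 (leadApprox r l σ2 (ζ n ω)) ≤ C * nsq (ζ n ω) := by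
      calc _ ≤ (1 + b / σ2 * S) * (nsq (ζ n ω) / g ^ 2) :=
            h1.trans (mul_le_mul_of_nonneg_left h2 (by linarith))
        _ ≤ (1 + b / σ2 * S) * (nsq (ζ n ω) / (g / 2) ^ 2) := by
            gcongr; linarith
        _ = _ := by simp only [hC]; ring
    calc W n ω ≤ n * (C * nsq (ζ n ω)) := mul_le_mul_of_nonneg_left h4 (Nat.cast_nonneg n)
      _ = C * Z n ω := by simp only [hZ]; ring
  obtain ⟨H, hHm, hH0, hH⟩ := exists_tendsto_mul_measure_quadForm_lt hY hid hind hcov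
    (δ := g / 2 / (q + 1)) (by positivity)
  have hq : (q : ℝ) * (g / 2 / (q + 1)) ≤ g / 2 := by
    rw [mul_div_assoc', div_le_iff₀ (by positivity)]; nlinarith
  have hlead : ∀ n, ∀ ω ∉ H n, ∀ (O : Matrix (Fin q) (Fin q) ℂ) (t : Fin q → ℝ),
      IsEigendecomposition (empCov (fun k => Y k ω) n) O t →
      ∀ j : Fin q, (j : ℕ) < r → σ2 + g / 2 ≤ t j := by
    intro n ω hω O t hOt j hj
    refine le_eigenvalue hOt j fun c hc => le_trans ?_ (hH n ω hω c)
    have h1 : (σ2 + g) * nsq c ≤ quadForm (diagonal fun i => (l i : ℂ)) c := by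
      rw [quadForm_diagonal, nsq, Finset.mul_sum]
      refine Finset.sum_le_sum fun i _ => ?_
      rcases le_or_gt i j with hi | hi
      · have := hσl i (lt_of_le_of_lt hi hj)
        exact mul_le_mul_of_nonneg_right (by linarith) (sq_nonneg _)
      · simp [hc i hi]
    have h2 := mul_le_mul_of_nonneg_right hq (nsq_nonneg c)
    linarith
  have hρ01 : ∀ n, ∀ᵐ ω ∂μ, 0 ≤ ρ n ω ∧ ρ n ω ≤ 1 := by
    intro n
    filter_upwards [hρ n] with ω ⟨O, t, hOt, h⟩
    have := (nsq_leadProj_le hOt.1 r e).trans he.le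
    rw [h]
    exact ⟨leakLoss_nonneg hs hb hσ this, leakLoss_le_one hs hb hσ this⟩
  have hρi : ∀ n, Integrable (ρ n) μ := fun n =>
    Integrable.of_bound (hρm n).aestronglyMeasurable 1 (by
      filter_upwards [hρ01 n] with ω h
      rw [Real.norm_eq_abs, abs_of_nonneg h.1]; exact h.2)
  rw [Metric.tendsto_atTop']
  intro ε hε
  set η := ε / (2 * (CZ + 1)) with hη
  have hη0 : 0 < η := by positivity
  obtain ⟨δ, hδ, hδη⟩ := exists_abs_one_sub_leakLoss_sub_le hs hb hσ hl he hle hg hσl hgap hη0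
  set G : ℕ → Set Ω := fun n =>
    {ω | ¬ ∀ i j, ‖empCov (fun k => Y k ω) n i j - diagonal (fun i => (l i : ℂ)) i j‖ ≤ δ} with hG
  have hG0 : Tendsto (fun n => μ.real (G n)) atTop (𝓝 0) :=
    tendsto_measure_empCov hid hind hcov hδ
  have hGm : ∀ n, MeasurableSet (G n) := by
    intro n
    have : G n = (⋂ i, ⋂ j, {ω | ‖empCov (fun k => Y k ω) n i j -
        diagonal (fun i => (l i : ℂ)) i j‖ ≤ δ})ᶜ := by
      ext ω; simp [hG]
    rw [this]
    refine MeasurableSet.compl <| MeasurableSet.iInter fun i => MeasurableSet.iInter fun j =>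
      measurableSet_le (Measurable.norm (Measurable.sub_const ?_ _)) measurable_const
    simp only [empCov_apply]
    refine (Finset.measurable_fun_sum _ fun k _ => ?_).const_mul _
    exact ((measurable_pi_apply i).comp (hY k)).mul (continuous_star.measurable.comp
      ((measurable_pi_apply j).comp (hY k)))
  -- uniform integrability of the squared residuals
  have hGZ : Tendsto (fun n => ∫ ω in G n, Z n ω ∂μ) atTop (𝓝 0) := by
    have h1 := tendsto_finsetSum (Finset.univ : Finset (Fin q)) fun i _ =>
      tendsto_setIntegral_norm_sq_sum (hξY i) (hξid i) (hξind i) (hξL i) (hξ0 i) hG0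
    rw [Finset.sum_const_zero] at h1
    refine h1.congr' ?_
    filter_upwards [eventually_ne_atTop 0] with n hn
    simp only [hZe, hζξ hn]
    rw [integral_finsetSum _ fun i _ => ((hS i n).1.div_const _).integrableOn]
  have hsmall : ∀ᶠ n : ℕ in atTop, C * ∫ ω in G n, Z n ω ∂μ < ε / 4 := by
    have := hGZ.const_mul C
    rw [mul_zero] at this
    exact this.eventually (gt_mem_nhds (by positivity))
  have hsmall' : ∀ᶠ n : ℕ in atTop, n * μ.real (H n) < ε / 4 :=
    hH0.eventually (gt_mem_nhds (by positivity))
  obtain ⟨N, hN⟩ := (hsmall.and (hsmall'.and (eventually_ne_atTop 0))).exists_forall_of_atTop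
  refine ⟨N, fun n hn => ?_⟩
  obtain ⟨h1, h2, hn0⟩ := hN n hn.le
  -- pointwise comparison of the loss with its quadratic approximation
  have hpt : ∀ᵐ ω ∂μ, |n * (1 - ρ n ω) - W n ω| ≤
      η * Z n ω + C * (G n).indicator (Z n) ω + (H n).indicator (fun _ => (n : ℝ)) ω := by
    filter_upwards [hρ n, hρ01 n] with ω ⟨O, t, hOt, hρO⟩ ⟨hρ0, hρ1⟩
    have hZω := hZ0 n ω
    have hWω := hW0 n ω
    have hWZω := hWZ n ω
    have hn1 : (0 : ℝ) ≤ n := Nat.cast_nonneg n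
    have hι : 0 ≤ (H n).indicator (fun _ => (n : ℝ)) ω := Set.indicator_nonneg (fun _ _ => hn1) ω
    have hηZ : 0 ≤ η * Z n ω := by positivity
    by_cases hωG : ω ∈ G n
    · rw [Set.indicator_of_mem hωG, abs_le]
      have hlow : 0 ≤ n * (1 - ρ n ω) := mul_nonneg hn1 (by linarith)
      refine ⟨by linarith, ?_⟩
      by_cases hωH : ω ∈ H n
      · rw [Set.indicator_of_mem hωH]
        have : n * (1 - ρ n ω) ≤ n * 1 := mul_le_mul_of_nonneg_left (by linarith) hn1
        have := mul_nonneg hC0 hZω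
        linarith
      · have h3 := one_sub_leakLoss_leadProj_le hs hb hσ hSs hOt he (half_pos hg) hbS
          (hlead n ω hωH O t hOt)
        rw [← hρO] at h3
        have h4 : n * (1 - ρ n ω) ≤ C * Z n ω := by
          calc n * (1 - ρ n ω) ≤ n * (C * nsq (ζ n ω)) := mul_le_mul_of_nonneg_left h3 hn1
            _ = C * Z n ω := by simp only [hZ]; ring
        linarith
    · rw [Set.indicator_of_notMem hωG]
      have h3 := hδη _ O t hOt (not_not.1 hωG)
      rw [← hρO] at h3
      have h4 : |n * (1 - ρ n ω) - W n ω| ≤ η * Z n ω := by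
        simp only [hW, hZ]
        rw [← mul_sub, abs_mul, abs_of_nonneg hn1]
        calc _ ≤ n * (η * nsq (ζ n ω)) := mul_le_mul_of_nonneg_left h3 hn1
          _ = _ := by ring
      linarith
  have hfi : Integrable (fun ω => n * (1 - ρ n ω)) μ :=
    ((integrable_const 1).sub (hρi n)).const_mul _
  have hf : ∫ ω, n * (1 - ρ n ω) ∂μ = n * (1 - ∫ ω, ρ n ω ∂μ) := by
    rw [integral_const_mul, integral_sub (integrable_const 1) (hρi n)]; simp
  have hb1 : Integrable (fun ω => η * Z n ω) μ := (hZi hn0).1.const_mul _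
  have hb2 : Integrable (fun ω => C * (G n).indicator (Z n) ω) μ :=
    ((hZi hn0).1.indicator (hGm n)).const_mul _
  have hb3 : Integrable ((H n).indicator fun _ => (n : ℝ)) μ :=
    (integrable_const _).indicator (hHm n)
  rw [Real.dist_eq, ← hf, ← (hWi hn0).2, ← integral_sub hfi (hWi hn0).1]
  calc |∫ ω, (n * (1 - ρ n ω) - W n ω) ∂μ|
      ≤ ∫ ω, |n * (1 - ρ n ω) - W n ω| ∂μ := abs_integral_le_integral_abs
    _ ≤ ∫ ω, (η * Z n ω + C * (G n).indicator (Z n) ω +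
          (H n).indicator (fun _ => (n : ℝ)) ω) ∂μ :=
        integral_mono_ae (hfi.sub (hWi hn0).1).abs ((hb1.fun_add hb2).fun_add hb3) hpt
    _ = η * CZ + C * ∫ ω in G n, Z n ω ∂μ + n * μ.real (H n) := by
        rw [integral_add (hb1.fun_add hb2) hb3, integral_add hb1 hb2, integral_const_mul,
          (hZi hn0).2, integral_const_mul, integral_indicator (hGm n), integral_indicator (hHm n)]
        simp [mul_comm]
    _ < ε := by
        have h5 : η * CZ ≤ ε / 2 := by
          simp only [hη]
          rw [div_mul_eq_mul_div, div_le_div_iff₀ (by positivity) (by positivity)]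
          nlinarith
        linarith

end Asymptotics

/-! ### The spatially compressed training data -/

section Compression

variable {p q : ℕ}

/-- The spatial compression `(hᴴ ⊗ I) x` of a space-time vector. -/
noncomputable def compress (h : Fin p → ℂ) (x : Fin p × Fin q → ℂ) : Fin q → ℂ :=
  fun k => ∑ i, star (h i) * x (i, k)

lemma star_dotProduct_compress (h : Fin p → ℂ) (b : Fin q → ℂ) (x : Fin p × Fin q → ℂ) :
    star b ⬝ᵥ compress h x = star (kronVec h b) ⬝ᵥ x := by
  simp only [dotProduct, compress, kronVec, Fintype.sum_prod_type, Finset.mul_sum, Pi.star_apply,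
    star_mul']
  rw [Finset.sum_comm]
  exact Finset.sum_congr rfl fun i _ => Finset.sum_congr rfl fun j _ => by ring

lemma star_dotProduct_conjTranspose_mulVec_compress (V : Matrix (Fin q) (Fin q) ℂ) (h : Fin p → ℂ)
    (c : Fin q → ℂ) (x : Fin p × Fin q → ℂ) :
    star c ⬝ᵥ (Vᴴ *ᵥ compress h x) = star (kronVec h (V *ᵥ c)) ⬝ᵥ x := by
  rw [← star_dotProduct_compress, star_mulVec, ← dotProduct_mulVec]

lemma conjTranspose_mulVec_compress_apply (V : Matrix (Fin q) (Fin q) ℂ) (h : Fin p → ℂ)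
    (x : Fin p × Fin q → ℂ) (i : Fin q) :
    (Vᴴ *ᵥ compress h x) i = star (kronVec h (V *ᵥ Pi.single i 1)) ⬝ᵥ x := by
  rw [← star_dotProduct_conjTranspose_mulVec_compress, ← Pi.single_star, star_one,
    single_one_dotProduct]

lemma measurable_compress (h : Fin p → ℂ) :
    Measurable (compress h : (Fin p × Fin q → ℂ) → Fin q → ℂ) := by
  unfold compress
  fun_prop

/-- For a unit vector `h`, the temporal factor fitted to `h hᴴ` is the sample covariance of the
compressed data. -/
lemma temporalFactor_vecMulVec {h : Fin p → ℂ} (hh : ∑ i, ‖h i‖ ^ 2 = 1)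
    (x : ℕ → Fin p × Fin q → ℂ) (n : ℕ) :
    temporalFactor (vecMulVec h (star h)) (sampleCov x n) =
      empCov (fun k => compress h (x (k + 1))) n := by
  have h1 : ∑ i, ∑ j, ‖vecMulVec h (star h) i j‖ ^ 2 = 1 := by
    have : ∀ i j, ‖vecMulVec h (star h) i j‖ ^ 2 = ‖h i‖ ^ 2 * ‖h j‖ ^ 2 := fun i j => by
      rw [vecMulVec_apply, norm_mul, mul_pow, Pi.star_apply, norm_star]
    simp only [this, ← Finset.sum_mul_sum, hh, one_mul]
  rw [temporalFactor, h1]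
  ext k l
  rw [empCov_apply, Complex.ofReal_one, inv_one, one_smul]
  simp only [Matrix.sum_apply, Matrix.smul_apply, block, sampleCov, smul_eq_mul, vecMulVec_apply,
    Pi.star_apply]
  have hshift : ∀ f : ℕ → ℂ, ∑ m ∈ Finset.Icc 1 n, f m = ∑ m ∈ Finset.range n, f (m + 1) := by
    intro f
    rw [Finset.range_eq_Ico, Finset.sum_Ico_add' f 0 n 1]
    rfl
  have hm : ∀ m, compress h (x (m + 1)) k * star (compress h (x (m + 1)) l) =
      ∑ i, ∑ j, star (h i * star (h j)) * (x (m + 1) (i, k) * star (x (m + 1) (j, l))) := by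
    intro m
    simp only [compress, star_sum, Finset.sum_mul_sum, star_mul', star_star]
    exact Finset.sum_congr rfl fun i _ => Finset.sum_congr rfl fun j _ => by ring
  simp only [hshift, hm]
  conv_rhs => rw [Finset.sum_comm, Finset.mul_sum]
  refine Finset.sum_congr rfl fun i _ => ?_
  conv_rhs => rw [Finset.sum_comm, Finset.mul_sum]
  refine Finset.sum_congr rfl fun j _ => ?_
  rw [Finset.mul_sum, Finset.mul_sum, Finset.mul_sum]
  exact Finset.sum_congr rfl fun m _ => by ring

lemma conjTranspose_mul_empCov_mul (V : Matrix (Fin q) (Fin q) ℂ) (y : ℕ → Fin q → ℂ) (n : ℕ) :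
    Vᴴ * empCov y n * V = empCov (fun k => Vᴴ *ᵥ y k) n := by
  simp only [empCov, Matrix.mul_smul, Matrix.smul_mul, Matrix.mul_sum, Matrix.sum_mul,
    mul_vecMulVec, vecMulVec_mul, star_mulVec, conjTranspose_conjTranspose]

lemma IsEigendecomposition.conj {R W V : Matrix (Fin q) (Fin q) ℂ} {t : Fin q → ℝ}
    (h : IsEigendecomposition R W t) (hV : V ∈ unitaryGroup (Fin q) ℂ) :
    IsEigendecomposition (Vᴴ * R * V) (Vᴴ * W) t := by
  refine ⟨mul_mem (conjTranspose_mem_unitaryGroup hV) h.1, h.2.1, ?_⟩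
  rw [h.2.2, conjTranspose_mul, conjTranspose_conjTranspose]
  simp only [Matrix.mul_assoc]

lemma star_mulVec_dotProduct_mulVec_mulVec {B V : Matrix (Fin q) (Fin q) ℂ} {s : Fin q → ℝ}
    (hs : IsEigendecomposition B V s) (c c' : Fin q → ℂ) :
    star (V *ᵥ c) ⬝ᵥ (B *ᵥ (V *ᵥ c')) = star c ⬝ᵥ (diagonal (fun i => (s i : ℂ)) *ᵥ c') := by
  rw [hs.2.2, star_mulVec, ← dotProduct_mulVec, mulVec_mulVec, mulVec_mulVec]
  congr 2
  rw [← Matrix.mul_assoc, ← Matrix.mul_assoc, conjTranspose_mul_self_of_mem hs.1, Matrix.one_mul,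
    Matrix.mul_assoc, conjTranspose_mul_self_of_mem hs.1, Matrix.mul_one]

lemma star_mulVec_dotProduct_mulVec {V : Matrix (Fin q) (Fin q) ℂ}
    (hV : V ∈ unitaryGroup (Fin q) ℂ) (c c' : Fin q → ℂ) :
    star (V *ᵥ c) ⬝ᵥ (V *ᵥ c') = star c ⬝ᵥ c' := by
  rw [star_mulVec, ← dotProduct_mulVec, mulVec_mulVec, conjTranspose_mul_self_of_mem hV,
    one_mulVec]

lemma eigenvalue_nonneg {B V : Matrix (Fin q) (Fin q) ℂ} (hB : B.PosSemidef) {s : Fin q → ℝ}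
    (hs : IsEigendecomposition B V s) (i : Fin q) : 0 ≤ s i := by
  have h1 := quadForm_nonneg hB (V *ᵥ Pi.single i 1)
  rw [quadForm, star_mulVec_dotProduct_mulVec_mulVec hs, ← Pi.single_star, star_one,
    single_one_dotProduct, mulVec_diagonal, Pi.single_eq_same, mul_one, Complex.ofReal_re] at h1
  exact h1

end Compression

/-! ### Distribution of the training data -/

section Data

variable {Ω ι : Type*} [MeasurableSpace Ω] [Fintype ι] [DecidableEq ι] {μ : Measure Ω}
  [IsProbabilityMeasure μ] {Γ : Matrix ι ι ℂ} {τ : ℕ → Ω → ℝ} {c v : ℕ → Ω → ι → ℂ}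

omit [DecidableEq ι] [Fintype ι] in
lemma measurable_interference_fun (σ : ℝ) : Measurable fun z : ℝ × (ι → ℂ) × (ι → ℂ) =>
    fun i => (z.1 : ℂ) * z.2.1 i + (σ : ℂ) * z.2.2 i := by
  fun_prop

lemma IsSIRVModel.identDistrib_interference (hM : IsSIRVModel μ Γ τ c v) (σ : ℝ) (k l : ℕ) :
    IdentDistrib (interference τ c v σ k) (interference τ c v σ l) μ μ := by
  have hcv := ((hM.speckle_gaussian k).identDistrib (hM.speckle_gaussian l)).prodMk
    ((hM.noise_gaussian k).identDistrib (hM.noise_gaussian l)) (hM.speckle_indep_noise k)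
    (hM.speckle_indep_noise l)
  have hτ := (hM.texture_identDistrib k).trans (hM.texture_identDistrib l).symm
  exact (hτ.prodMk hcv (hM.texture_indep k) (hM.texture_indep l)).comp
    (measurable_interference_fun σ)

omit [IsProbabilityMeasure μ] in
lemma IsSIRVModel.iIndepFun_interference (hM : IsSIRVModel μ Γ τ c v) (σ : ℝ) :
    iIndepFun (interference τ c v σ) μ :=
  hM.bins_indep.comp _ fun _ => measurable_interference_fun σ

lemma IsSIRVModel.integral_texture_sq_pos (hM : IsSIRVModel μ Γ τ c v) :
    0 < ∫ ω, τ 0 ω ^ 2 ∂μ := by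
  refine lt_of_le_of_ne (integral_nonneg fun ω => sq_nonneg _) fun h0 => ?_
  rw [eq_comm, integral_eq_zero_iff_of_nonneg (fun ω => sq_nonneg _)
    (hM.texture_memLp 0).integrable_sq] at h0
  have : ∀ᵐ _ω ∂μ, False := by
    filter_upwards [h0, hM.texture_pos 0] with ω h1 h2
    have : τ 0 ω ^ 2 = 0 := h1
    exact h2.ne' (by simpa using this)
  exact IsProbabilityMeasure.ne_zero μ (by simpa using this)

end Data

/-! ### The expected SINR loss -/

section Main

variable {Ω : Type*} [MeasurableSpace Ω] {μ : Measure Ω} [IsProbabilityMeasure μ] {p q r : ℕ}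

lemma mismatch_nonneg {A : Matrix (Fin p) (Fin p) ℂ} (hA : A.PosSemidef) (h d : Fin p → ℂ) :
    0 ≤ mismatch A h d :=
  div_nonneg (quadForm_nonneg hA _) (quadForm_nonneg hA _)

lemma exists_gap (hr : r < q) {s : Fin q → ℝ} (hs : Antitone s)
    (hgap : ∀ i j : Fin q, (i : ℕ) < r → r ≤ (j : ℕ) → s j < s i) :
    ∃ g > 0, ∀ i j : Fin q, (i : ℕ) < r → r ≤ (j : ℕ) → g ≤ s i - s j := by
  rcases Nat.eq_zero_or_pos r with rfl | hr0
  · exact ⟨1, one_pos, fun i j hi => absurd hi (Nat.not_lt_zero _)⟩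
  · refine ⟨s ⟨r - 1, by omega⟩ - s ⟨r, hr⟩, sub_pos.2 (hgap _ _ (by simp; omega) le_rfl),
      fun i j hi hj => ?_⟩
    have h1 : s ⟨r - 1, by omega⟩ ≤ s i := hs (Fin.mk_le_mk.2 (by omega) : i ≤ ⟨r - 1, by omega⟩)
    have h2 : s j ≤ s ⟨r, hr⟩ := hs (Fin.mk_le_mk.2 hj : (⟨r, hr⟩ : Fin q) ≤ j)
    linarith

/-- The limit of `n (1 - E ρ)`, at a fixed noise level. -/
theorem tendsto_mul_one_sub_integral_sinrLoss (hr : r < q)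
    {A : Matrix (Fin p) (Fin p) ℂ} (hA : A.PosSemidef)
    {B V : Matrix (Fin q) (Fin q) ℂ} (hB : B.PosSemidef)
    {s : Fin q → ℝ} (hs : IsEigendecomposition B V s)
    (hgap : ∀ i j : Fin q, (i : ℕ) < r → r ≤ (j : ℕ) → s j < s i)
    {τ : ℕ → Ω → ℝ} {c v : ℕ → Ω → Fin p × Fin q → ℂ}
    (hM : IsSIRVModel μ (A ⊗ₖ B) τ c v)
    {h : Fin p → ℂ} (hh : ∑ i, ‖h i‖ ^ 2 = 1) (hAh : quadForm A h ≠ 0)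
    {α : ℂ} (hα : α ≠ 0) {dA : Fin p → ℂ} (hdA : spatialProj h *ᵥ dA ≠ 0)
    {dB : Fin q → ℂ} (hdB : dB ≠ 0) (hdB_orth : B *ᵥ dB = 0) {σ : ℝ} (hσ : 0 < σ)
    {U : ℕ → Ω → Matrix (Fin q) (Fin r) ℂ}
    (hU_meas : ∀ n i j, AEMeasurable (fun ω => U n ω i j) μ)
    (hU : ∀ n, ∀ᵐ ω ∂μ, IsPrincipalComponents hr.le
      (temporalFactor (vecMulVec h (star h))
        (sampleCov (fun k => interference τ c v σ k ω) n)) (U n ω)) :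
    Tendsto (fun n : ℕ => n * (1 - ∫ ω, sinrLoss μ (interference τ c v σ 0) α h (kronVec dA dB)
        (U n ω) ∂μ)) atTop
      (𝓝 (∑ i : Fin r,
        ((∫ ω, τ 0 ω ^ 2 ∂μ) * quadForm A h * s (Fin.castLE hr.le i) + σ ^ 2) *
          (σ ^ 2 + mismatch A h dA *
            ((∫ ω, τ 0 ω ^ 2 ∂μ) * quadForm A h * s (Fin.castLE hr.le i))) /
          ((∫ ω, τ 0 ω ^ 2 ∂μ) * quadForm A h * s (Fin.castLE hr.le i)) ^ 2)) := by
  have hT := hM.integral_texture_sq_pos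
  have ha : 0 < quadForm A h := lt_of_le_of_ne (quadForm_nonneg hA h) (Ne.symm hAh)
  have hκ := mismatch_nonneg hA h dA
  have hΓ : (A ⊗ₖ B).PosSemidef := hA.kronecker hB
  set T := ∫ ω, τ 0 ω ^ 2 ∂μ
  set a := quadForm A h with ha_def
  set κ := mismatch A h dA
  have hTa : 0 < T * a := mul_pos hT ha
  have hs0 := eigenvalue_nonneg hB hs
  have hσ2 : 0 < σ ^ 2 := by positivity
  obtain ⟨g, hg, hgs⟩ := exists_gap hr hs.2.1 hgap
  set l : Fin q → ℝ := fun i => T * a * s i + σ ^ 2 with hl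
  have hlanti : Antitone l := fun i j hij => by
    have := mul_le_mul_of_nonneg_left (hs.2.1 hij) hTa.le
    simp only [hl]; linarith
  have hspos : ∀ i : Fin q, (i : ℕ) < r → g ≤ s i := fun i hi => by
    linarith [hgs i ⟨r, hr⟩ hi le_rfl, hs0 ⟨r, hr⟩]
  -- the normalized target in the eigenbasis of `B`
  set e : Fin q → ℂ := (Real.sqrt (nsq dB) : ℂ)⁻¹ • (Vᴴ *ᵥ dB) with he_def
  have hd0 : 0 < nsq dB := nsq_pos hdB
  have he : nsq e = 1 := by
    rw [he_def, nsq_smul, nsq_conjTranspose_mulVec hs.1, norm_inv, Complex.norm_real,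
      Real.norm_eq_abs, inv_pow, sq_abs, Real.sq_sqrt hd0.le, inv_mul_cancel₀ hd0.ne']
  have hBe : B *ᵥ (V *ᵥ e) = 0 := by
    rw [he_def, mulVec_smul, mulVec_mulVec, self_mul_conjTranspose_of_mem hs.1, one_mulVec,
      mulVec_smul, hdB_orth, smul_zero]
  have hse : ∀ i, (s i : ℂ) * e i = 0 := by
    intro i
    have h1 := star_mulVec_dotProduct_mulVec_mulVec hs (Pi.single i 1) e
    rw [hBe, dotProduct_zero, ← Pi.single_star, star_one, single_one_dotProduct,
      mulVec_diagonal] at h1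
    exact h1.symm
  have hle : ∀ i, (l i : ℂ) * e i = (σ ^ 2 : ℝ) * e i := by
    intro i
    simp only [hl]
    push_cast
    rw [add_mul, mul_assoc _ (s i : ℂ), hse i]
    ring
  -- the compressed data and their moments
  set f : (Fin q → ℂ) → Fin p × Fin q → ℂ := fun x => kronVec h (V *ᵥ x) with hf
  have hhh : star h ⬝ᵥ h = 1 := by
    rw [← ofReal_nsq, nsq, hh]; simp
  have hf1 : ∀ x y, star (f x) ⬝ᵥ f y = star x ⬝ᵥ y := by
    intro x y
    rw [hf, star_kronVec_dotProduct, hhh, one_mul, star_mulVec_dotProduct_mulVec hs.1]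
  have hf2 : ∀ x y, star (f x) ⬝ᵥ ((A ⊗ₖ B) *ᵥ f y) =
      a * (star x ⬝ᵥ (diagonal (fun i => (s i : ℂ)) *ᵥ y)) := by
    intro x y
    rw [hf, kronecker_mulVec_kronVec, star_kronVec_dotProduct,
      star_mulVec_dotProduct_mulVec_mulVec hs, star_dotProduct_mulVec_eq_quadForm hA]
  have hfe : (A ⊗ₖ B) *ᵥ f e = 0 := by
    rw [hf, kronecker_mulVec_kronVec, hBe]
    ext i; simp [kronVec]
  set X : ℕ → Ω → Fin p × Fin q → ℂ := fun k => interference τ c v σ (k + 1) with hX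
  set F : (Fin p × Fin q → ℂ) → Fin q → ℂ := fun x => Vᴴ *ᵥ compress h x with hF
  have hFm : Measurable F := by
    have hc : Measurable (compress h : (Fin p × Fin q → ℂ) → Fin q → ℂ) := measurable_compress h
    refine measurable_pi_lambda _ fun i => ?_
    simp only [hF, mulVec, dotProduct]
    exact Finset.measurable_fun_sum _ fun j _ =>
      ((measurable_pi_apply j).comp hc).const_mul _
  have hFi : ∀ x i, F x i = star (f (Pi.single i 1)) ⬝ᵥ x := fun x i =>
    conjTranspose_mulVec_compress_apply V h x i
  have hFc : ∀ x z, star z ⬝ᵥ F x = star (f z) ⬝ᵥ x := fun x z =>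
    star_dotProduct_conjTranspose_mulVec_compress V h z x
  have hXid : ∀ k, IdentDistrib (X k) (X 0) μ μ := fun k => hM.identDistrib_interference σ _ _
  have hFX : ∀ k, AEMeasurable (fun ω => F (X k ω)) μ := fun k =>
    hFm.comp_aemeasurable (hXid k).aemeasurable_fst
  -- a measurable version of the compressed data
  set Y : ℕ → Ω → Fin q → ℂ := fun k => (hFX k).mk with hY
  have hYF : ∀ k, (fun ω => F (X k ω)) =ᵐ[μ] Y k := fun k => (hFX k).ae_eq_mk
  have hYm : ∀ k, Measurable (Y k) := fun k => (hFX k).measurable_mk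
  have hYid : ∀ k, IdentDistrib (Y k) (Y 0) μ μ := fun k =>
    ((IdentDistrib.of_ae_eq (hFX k) (hYF k)).symm.trans ((hXid k).comp hFm)).trans
      (IdentDistrib.of_ae_eq (hFX 0) (hYF 0))
  have hYind : iIndepFun Y μ :=
    (((hM.iIndepFun_interference σ).precomp Nat.succ_injective).comp _ fun _ => hFm).congr hYF
  have hentry : ∀ i j : Fin q, star (Pi.single i 1 : Fin q → ℂ) ⬝ᵥ (Pi.single j 1 : Fin q → ℂ) =
      if i = j then 1 else 0 := by
    intro i j
    rw [← Pi.single_star, star_one, single_one_dotProduct, Pi.single_apply]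
  have hentry' : ∀ i j : Fin q, star (Pi.single i 1 : Fin q → ℂ) ⬝ᵥ
      (diagonal (fun i => (s i : ℂ)) *ᵥ (Pi.single j 1 : Fin q → ℂ)) =
      if i = j then (s i : ℂ) else 0 := by
    intro i j
    rw [← Pi.single_star, star_one, single_one_dotProduct, mulVec_diagonal, Pi.single_apply]
    simp
  have hcov : ∀ i j, Integrable (fun ω => Y 0 ω i * star (Y 0 ω j)) μ ∧
      ∫ ω, Y 0 ω i * star (Y 0 ω j) ∂μ = diagonal (fun i => (l i : ℂ)) i j := by
    intro i j
    have h1 := hM.integral_mul_star hΓ σ 1 (f (Pi.single i 1)) (f (Pi.single j 1))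
    rw [hf1, hf2, hentry, hentry'] at h1
    have h2 : (fun ω => (star (f (Pi.single i 1)) ⬝ᵥ interference τ c v σ 1 ω) *
        star (star (f (Pi.single j 1)) ⬝ᵥ interference τ c v σ 1 ω)) =ᵐ[μ]
        fun ω => Y 0 ω i * star (Y 0 ω j) := by
      filter_upwards [hYF 0] with ω hω
      rw [← hω, hFi, hFi]
    refine ⟨(integrable_congr h2).1 h1.1, ?_⟩
    rw [← integral_congr_ae h2, h1.2, diagonal_apply]
    split_ifs
    · simp only [hl]; push_cast; ring
    · simp
  have h4ae : ∀ i, (fun ω => ‖star (f (Pi.single i 1)) ⬝ᵥ interference τ c v σ 1 ω‖ ^ 2 *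
      ‖star (f e) ⬝ᵥ interference τ c v σ 1 ω‖ ^ 2) =ᵐ[μ]
      fun ω => ‖Y 0 ω i‖ ^ 2 * ‖star e ⬝ᵥ Y 0 ω‖ ^ 2 := by
    intro i
    filter_upwards [hYF 0] with ω hω
    rw [← hω, hFi, hFc]
  have h4 : ∀ i, Integrable (fun ω => ‖Y 0 ω i‖ ^ 2 * ‖star e ⬝ᵥ Y 0 ω‖ ^ 2) μ := fun i =>
    (integrable_congr (h4ae i)).1 (hM.integral_norm_sq_mul_norm_sq hΓ σ 1 _ hfe).1
  have h4r : ∀ i : Fin q, (i : ℕ) < r →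
      ∫ ω, ‖Y 0 ω i‖ ^ 2 * ‖star e ⬝ᵥ Y 0 ω‖ ^ 2 ∂μ = l i * σ ^ 2 := by
    intro i hi
    have hei : star (f (Pi.single i 1)) ⬝ᵥ f e = 0 := by
      rw [hf1, ← Pi.single_star, star_one, single_one_dotProduct]
      exact (mul_eq_zero.1 (hse i)).resolve_left
        (Complex.ofReal_ne_zero.2 (hg.trans_le (hspos i hi)).ne')
    have h1 := (hM.integral_norm_sq_mul_norm_sq hΓ σ 1 (f (Pi.single i 1)) hfe).2 hei
    rw [integral_congr_ae (h4ae i)] at h1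
    rw [h1, hf1, hf1, hf2, hentry, hentry', if_pos rfl, if_pos rfl, ← ofReal_nsq, he,
      ← Complex.ofReal_mul]
    simp only [hl, Complex.ofReal_re, Complex.one_re]
    ring
  have hρ : ∀ n, ∀ᵐ ω ∂μ, ∃ (O : Matrix (Fin q) (Fin q) ℂ) (t : Fin q → ℝ),
      IsEigendecomposition (empCov (fun k => Y k ω) n) O t ∧
        sinrLoss μ (interference τ c v σ 0) α h (kronVec dA dB) (U n ω) =
          leakLoss s (T * κ * a) (σ ^ 2) (leadProj r O e) := by
    intro n
    filter_upwards [hU n, ae_all_iff.2 hYF] with ω ⟨W, t, hW, hcol⟩ hω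
    refine ⟨Vᴴ * W, t, ?_, sinrLoss_eq_leakLoss hA hB hs hM hσ hα hh hAh hdA hdB hdB_orth hr.le
      hW.1 hcol⟩
    have h1 := hW.conj hs.1
    rw [temporalFactor_vecMulVec hh, conjTranspose_mul_empCov_mul] at h1
    have h2 : (fun k => Y k ω) = fun k => Vᴴ *ᵥ compress h (interference τ c v σ (k + 1) ω) :=
      funext fun k => (hω k).symm
    rw [h2]
    exact h1
  have hmain := tendsto_mul_one_sub_integral_leakLoss hYm hYid hYind hs0
    (b := T * κ * a) (mul_nonneg (mul_nonneg hT.le hκ) ha.le) hσ2 hlanti he hle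
    (g := T * a * g) (mul_pos hTa hg) (r := r)
    (fun i hi => by
      have := mul_le_mul_of_nonneg_left (hspos i hi) hTa.le
      simp only [hl]; linarith)
    (fun i j hi hj => by
      have := mul_le_mul_of_nonneg_left (hgs i j hi hj) hTa.le
      simp only [hl]; linarith)
    hcov h4 h4r
    (fun n => aemeasurable_sinrLoss hA hB hM hσ hα hh hAh hdA hdB hdB_orth (hU_meas n)) hρ
  convert hmain using 2
  have hsum := sum_castLE_eq hr.le fun i : Fin q =>
    (T * a * s i + σ ^ 2) * (σ ^ 2 + κ * (T * a * s i)) / (T * a * s i) ^ 2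
  rw [hsum]
  refine Finset.sum_congr rfl fun i _ => ?_
  split_ifs with hi
  · have hsi : s i ≠ 0 := (hg.trans_le (hspos i hi)).ne'
    have hT' := hT.ne'
    have ha' := ha.ne'
    have hσ' := hσ.ne'
    simp only [hl, add_sub_cancel_right]
    field_simp
  · rfl

end Main

/-! ### Conclusion -/

lemma abs_sub_one_sub_div_le {N x L ε : ℝ} (hN : 0 < N) (h : |N * (1 - x) - L| ≤ ε) :
    |x - (1 - L / N)| ≤ ε / N := by
  have h1 : x - (1 - L / N) = -((N * (1 - x) - L) / N) := by
    field_simp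
    ring
  rw [h1, abs_neg, abs_div, abs_of_pos hN]
  exact div_le_div_of_nonneg_right h hN.le

end KronSTAP

theorem theorem3 {Ω : Type*} [MeasurableSpace Ω] (μ : Measure Ω) [IsProbabilityMeasure μ]
    {p q r : ℕ} (hr : r < q)
    -- the Kronecker factors of the clutter covariance and the eigenvalues of the temporal factor
    (A : Matrix (Fin p) (Fin p) ℂ) (hA : A.PosSemidef)
    (B V : Matrix (Fin q) (Fin q) ℂ) (hB : B.PosSemidef)
    (s : Fin q → ℝ) (hs : KronSTAP.IsEigendecomposition B V s)
    (hgap : ∀ i j : Fin q, (i : ℕ) < r → r ≤ (j : ℕ) → s j < s i)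
    -- the data: bin `0` is under test, bins `1, 2, …` are for training
    (τ : ℕ → Ω → ℝ) (c v : ℕ → Ω → Fin p × Fin q → ℂ)
    (hmodel : KronSTAP.IsSIRVModel μ (A ⊗ₖ B) τ c v)
    -- the fixed spatial subspace estimate
    (h : Fin p → ℂ) (hh : ∑ i, ‖h i‖ ^ 2 = 1) (hAh : KronSTAP.quadForm A h ≠ 0)
    -- the target: amplitude and spatial and temporal steering vectors
    (α : ℂ) (hα : α ≠ 0)
    (dA : Fin p → ℂ) (hdA : KronSTAP.spatialProj h *ᵥ dA ≠ 0)
    -- (the latter orthogonal to the temporal clutter subspace, the range of `B`)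
    (dB : Fin q → ℂ) (hdB : dB ≠ 0) (hdB_orth : B *ᵥ dB = 0)
    -- the estimated temporal principal components at noise level `σ`, from `n` training samples
    (U : ℝ → ℕ → Ω → Matrix (Fin q) (Fin r) ℂ)
    (hU_meas : ∀ σ > 0, ∀ n i j, AEMeasurable (fun ω => U σ n ω i j) μ)
    (hU : ∀ σ > 0, ∀ n, ∀ᵐ ω ∂μ, KronSTAP.IsPrincipalComponents hr.le
      (KronSTAP.temporalFactor (vecMulVec h (star h))
        (KronSTAP.sampleCov (fun k => KronSTAP.interference τ c v σ k ω) n)) (U σ n ω)) :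
    let T : ℝ := ∫ ω, τ 0 ω ^ 2 ∂μ
    let a : ℝ := KronSTAP.quadForm A h
    let κ : ℝ := KronSTAP.mismatch A h dA
    -- `Eρ σ n` is the expected SINR loss at noise level `σ` with `n` training samples
    let Eρ : ℝ → ℕ → ℝ := fun σ n =>
      ∫ ω, KronSTAP.sinrLoss μ (KronSTAP.interference τ c v σ 0) α h (KronSTAP.kronVec dA dB)
        (U σ n ω) ∂μ
    (κ ≠ 0 → ∀ σ > 0,
      (fun n : ℕ => Eρ σ n - (1 - κ / n * ∑ i : Fin r,
        (T * s (Fin.castLE hr.le i) + σ ^ 2 / a) *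
          (T * s (Fin.castLE hr.le i) + σ ^ 2 / (κ * a)) /
            (T * s (Fin.castLE hr.le i)) ^ 2)) =o[atTop] (fun n : ℕ => 1 / (n : ℝ))) ∧
    (∀ ε > 0, ∃ σ₀ > 0, ∀ σ : ℝ, 0 < σ → σ < σ₀ → ∀ᶠ n : ℕ in atTop,
      |Eρ σ n - (1 - κ * r / n)| ≤ ε / n) := by
  intro T a κ Eρ
  have hT : 0 < T := hmodel.integral_texture_sq_pos
  have ha : 0 < a := lt_of_le_of_ne (KronSTAP.quadForm_nonneg hA h) (Ne.symm hAh)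
  have hs0 : ∀ i : Fin r, 0 < s (Fin.castLE hr.le i) := fun i =>
    (KronSTAP.eigenvalue_nonneg hB hs ⟨r, hr⟩).trans_lt (hgap _ ⟨r, hr⟩ i.2 le_rfl)
  have hlim : ∀ σ > 0, Tendsto (fun n : ℕ => n * (1 - Eρ σ n)) atTop
      (𝓝 (∑ i : Fin r, (T * a * s (Fin.castLE hr.le i) + σ ^ 2) *
        (σ ^ 2 + κ * (T * a * s (Fin.castLE hr.le i))) /
          (T * a * s (Fin.castLE hr.le i)) ^ 2)) := fun σ hσ =>
    KronSTAP.tendsto_mul_one_sub_integral_sinrLoss hr hA hB hs hgap hmodel hh hAh hα hdA hdB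
      hdB_orth hσ (hU_meas σ hσ) (hU σ hσ)
  constructor
  · intro hκ σ hσ
    have hL : κ * ∑ i : Fin r, (T * s (Fin.castLE hr.le i) + σ ^ 2 / a) *
          (T * s (Fin.castLE hr.le i) + σ ^ 2 / (κ * a)) / (T * s (Fin.castLE hr.le i)) ^ 2 =
        ∑ i : Fin r, (T * a * s (Fin.castLE hr.le i) + σ ^ 2) *
          (σ ^ 2 + κ * (T * a * s (Fin.castLE hr.le i))) /
            (T * a * s (Fin.castLE hr.le i)) ^ 2 := by
      rw [Finset.mul_sum]
      refine Finset.sum_congr rfl fun i _ => ?_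
      have h1 := (hs0 i).ne'
      have h2 := hT.ne'
      have h3 := ha.ne'
      field_simp
      ring
    refine isLittleO_iff.2 fun ε hε => ?_
    filter_upwards [Metric.tendsto_nhds.1 (hlim σ hσ) ε hε, eventually_gt_atTop 0] with n hn hn0
    have hn0' : (0 : ℝ) < n := Nat.cast_pos.2 hn0
    rw [Real.dist_eq, ← hL] at hn
    rw [div_mul_eq_mul_div, Real.norm_eq_abs, Real.norm_eq_abs, abs_of_pos (one_div_pos.2 hn0'),
      mul_one_div]
    exact KronSTAP.abs_sub_one_sub_div_le hn0' hn.le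
  · intro ε hε
    -- the limit is a polynomial in `σ`, with value `κ r` at `σ = 0`
    have hcont : Continuous fun σ : ℝ => ∑ i : Fin r,
        (T * a * s (Fin.castLE hr.le i) + σ ^ 2) *
          (σ ^ 2 + κ * (T * a * s (Fin.castLE hr.le i))) /
            (T * a * s (Fin.castLE hr.le i)) ^ 2 := by
      fun_prop
    have hL0 : ∑ i : Fin r, (T * a * s (Fin.castLE hr.le i) + (0 : ℝ) ^ 2) *
          ((0 : ℝ) ^ 2 + κ * (T * a * s (Fin.castLE hr.le i))) /
            (T * a * s (Fin.castLE hr.le i)) ^ 2 = κ * r := by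
      have : ∀ i : Fin r, (T * a * s (Fin.castLE hr.le i) + (0 : ℝ) ^ 2) *
          ((0 : ℝ) ^ 2 + κ * (T * a * s (Fin.castLE hr.le i))) /
            (T * a * s (Fin.castLE hr.le i)) ^ 2 = κ := fun i => by
        have h1 := (hs0 i).ne'
        have h2 := hT.ne'
        have h3 := ha.ne'
        field_simp
        ring
      simp only [this, Finset.sum_const, Finset.card_univ, Fintype.card_fin, nsmul_eq_mul]
      ring
    obtain ⟨σ₀, hσ₀, hclose⟩ := Metric.continuousAt_iff.1 (hcont.continuousAt (x := 0))
      (ε / 2) (half_pos hε)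
    refine ⟨σ₀, hσ₀, fun σ hσ hσlt => ?_⟩
    have h1 := hclose (x := σ) (by rw [Real.dist_eq, sub_zero, abs_of_pos hσ]; exact hσlt)
    rw [hL0, Real.dist_eq] at h1
    filter_upwards [Metric.tendsto_nhds.1 (hlim σ hσ) (ε / 2) (half_pos hε),
      eventually_gt_atTop 0] with n hn hn0
    have hn0' : (0 : ℝ) < n := Nat.cast_pos.2 hn0
    rw [Real.dist_eq] at hn
    refine KronSTAP.abs_sub_one_sub_div_le hn0' ?_
    exact (abs_sub_le _ _ _).trans (by linarith)
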